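/- The symmetry breaking-preserving game on a finite graph $G$ with $m$ edges is played by two players $\mathcal A$ and $\mathcal B$. In round $i$, where $1\le i\le\lfloor m/2\rfloor$, player $\mathcal A$ colors a previously uncolored edge $a_i$ of $G$ red, and then player $\mathcal B$ colors a previously uncolored edge $b_i$ blue. Let $A_i$ and $B_i$ be the subgraphs of $G$ formed by the edges $a_1,\dots,a_i$ and $b_1,\dots,b_i$ respectively. A strategy of a player is a function that determines each of his moves from the moves made so far by the opponent. For strategies $S_1$ of $\mathcal A$ and $S_2$ of $\mathcal B$, let $l(S_1,S_2)$ be the largest $l\le\lfloor m/2\rfloor$ such that $A_i$ and $B_i$ are isomorphic for every $i\le l$ when the players follow $S_1$ and $S_2$. The length of the game is $L(G)=\max_{S_2}\min_{S_1} l(S_1,S_2)$. Let $P_n$ be the path with $n$ edges and, for $n\ge3$, let $C_n$ be the cycle with $n$ edges. Let $\log$ denote the logarithm to base $2$. Theorem. Let $n$ range over the odd positive integers, with $n\ge 3$ in the statements about $C_n$. 1. $L(P_n)=\Omega(\log n)$ and $L(C_n)=\Omega(\log n)$; that is, there is a constant $c>0$ such that $L(P_n)\ge c\log n$ and $L(C_n)\ge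 c\log n$ for all such $n$. 2. $L(P_n)=O(\log^2 n)$ and $L(C_n)=O(\log^2 n)$; that is, there is a constant $C$ such that $L(P_n)\le C\log^2 n$ and $L(C_n)\le C\log^2 n$ for all such $n$. 3. More precisely, for every odd $n\ge3$, $$L(P_n)>\tfrac12\log(n-1)-1\quad\text{and}\quad L(C_n)>\tfrac12\log n-\tfrac12 .$$ 4. More precisely, $L(P_n)\le(3.5+o(1))\log^2 n$ and $L(C_n)\le(3.5+o(1))\log^2 n$, where $o(1)$ denotes a function of $n$ that tends to $0$ as $n\to\infty$. -/

import Mathlib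

open Filter Topology

namespace SymGame

variable {V : Type*}

/-- The subgraph consisting of a set `s` of edges: its vertices are the endpoints of the edges
in `s`, and its edges are the members of `s`. -/
def edgeSubgraph (s : Set (Sym2 V)) :
    SimpleGraph (SimpleGraph.fromEdgeSet s).support :=
  (SimpleGraph.fromEdgeSet s).induce (SimpleGraph.fromEdgeSet s).support

/-- The subgraphs formed by two sets of edges are isomorphic. -/
def EdgeSetsIso (s t : Set (Sym2 V)) : Prop :=
  Nonempty (edgeSubgraph s ≃g edgeSubgraph t)

/-- The size of a (finite) graph: its number of edges. -/
noncomputable def size (G : SimpleGraph V) : ℕ := Nat.card G.edgeSet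

/-- A strategy of the first player `𝒜`. `move [b₁, …, bᵢ]` is the edge coloured red in round
`i + 1` after the opponent has coloured `b₁, …, bᵢ`. It differs from `b₁, …, bᵢ` and from the
strategy's own earlier edges `move []`, `move [b₁]`, …, `move [b₁, …, bᵢ₋₁]`. This is required
as long as the number `2 * i` of edges coloured before the move is less than the size of the
graph; afterwards no uncoloured edge is left and the values of `move` are never used. -/
structure StrategyA (G : SimpleGraph V) where
  /-- The edge chosen in answer to the opponent's edges so far. -/
  move : List G.edgeSet → G.edgeSet
  notMem_of_nodup : ∀ l : List G.edgeSet, l.Nodup → 2 * l.length < size G → move l ∉ l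
  ne_of_prefix : ∀ l : List G.edgeSet, l.Nodup → 2 * l.length < size G →
    ∀ l' : List G.edgeSet, l' <+: l → l' ≠ l → move l ≠ move l'

/-- A strategy of the second player `ℬ`. For a nonempty list, `move [a₁, …, aᵢ]` is the edge
coloured blue in round `i` after the opponent has coloured `a₁, …, aᵢ`. It differs from
`a₁, …, aᵢ` and from the strategy's own earlier edges `move [a₁]`, …, `move [a₁, …, aᵢ₋₁]`.
This is required as long as the number `2 * i` of edges coloured after the move is at most the
size of the graph. The value `move []` is never used. -/
structure StrategyB (G : SimpleGraph V) where
  /-- The edge chosen in answer to the opponent's edges so far. -/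
  move : List G.edgeSet → G.edgeSet
  notMem_of_nodup : ∀ l : List G.edgeSet, l.Nodup → l ≠ [] → 2 * l.length ≤ size G →
    move l ∉ l
  ne_of_prefix : ∀ l : List G.edgeSet, l.Nodup → l ≠ [] → 2 * l.length ≤ size G →
    ∀ l' : List G.edgeSet, l' ≠ [] → l' <+: l → l' ≠ l → move l ≠ move l'

/-- The pair of lists `([a₁, …, aᵢ], [b₁, …, bᵢ])` of the edges coloured red and blue during the
first `i` rounds, in the order of play. -/
def play {G : SimpleGraph V} (S₁ : StrategyA G) (S₂ : StrategyB G) :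
    ℕ → List G.edgeSet × List G.edgeSet
  | 0 => ([], [])
  | i + 1 =>
    let as := (play S₁ S₂ i).1 ++ [S₁.move (play S₁ S₂ i).2]
    (as, (play S₁ S₂ i).2 ++ [S₂.move as])

/-- The red edges `Aᵢ = {a₁, …, aᵢ}`. -/
def red {G : SimpleGraph V} (S₁ : StrategyA G) (S₂ : StrategyB G) (i : ℕ) : Set (Sym2 V) :=
  {e | ∃ x ∈ (play S₁ S₂ i).1, (x : Sym2 V) = e}

/-- The blue edges `Bᵢ = {b₁, …, bᵢ}`. -/
def blue {G : SimpleGraph V} (S₁ : StrategyA G) (S₂ : StrategyB G) (i : ℕ) : Set (Sym2 V) :=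
  {e | ∃ x ∈ (play S₁ S₂ i).2, (x : Sym2 V) = e}

/-- `l(S₁, S₂)`: the largest `k`, among the numbers of rounds that can be played, such that `Aᵢ`
and `Bᵢ` are isomorphic for every `i ≤ k`. -/
noncomputable def playLength {G : SimpleGraph V} (S₁ : StrategyA G) (S₂ : StrategyB G) : ℕ :=
  sSup {k : ℕ | 2 * k ≤ size G ∧ ∀ i ≤ k, EdgeSetsIso (red S₁ S₂ i) (blue S₁ S₂ i)}

/-- The length `L(G) = max_{S₂} min_{S₁} l(S₁, S₂)` of the symmetry breaking-preserving game on
a finite graph `G`. All values are at most half of the size of `G`, so the supremum is attained. -/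
noncomputable def gameLength (G : SimpleGraph V) : ℕ :=
  ⨆ S₂ : StrategyB G, ⨅ S₁ : StrategyA G, playLength S₁ S₂

/-- `L(P_n)`, where `P_n` is the path of size `n`: it has `n` edges and `n + 1` vertices. -/
noncomputable def gameLengthPath (n : ℕ) : ℕ := gameLength (SimpleGraph.pathGraph (n + 1))

/-- `L(C_n)`, where `C_n` is the cycle of size `n`, with `n ≥ 3`. -/
noncomputable def gameLengthCycle (n : ℕ) : ℕ := gameLength (SimpleGraph.cycleGraph n)

end SymGame

/-! Edges are identified with cells, integers for the path and residues modulo `n` for the cycle, so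
that adjacent edges are neighbouring cells and a colour class is a union of runs of consecutive
cells. Preserving isomorphism forces ℬ to extend or join runs of the same lengths as 𝒜 did
(`Reply`); the upper bound uses only this necessary condition.

Upper bound. 𝒜 keeps the blue run lengths pairwise distinct by making each new block shorter than
all earlier ones. While he grows a block, ℬ must grow the block of his own first answer, because no
other blue run has the right length (`AWins.grow`); so a whole block acts as a single move. The weak
spot of ℬ is an unmatched gap: `h` free cells between red runs of lengths `s ≠ t`, without a blue
gap of the same data. If `h = 1`, 𝒜 fills it and ℬ has no answer. Otherwise 𝒜 splits the gap by a
short block. If ℬ answers inside the gap, his block is walled in by red and matches nothing; if he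
answers elsewhere and both parts have blue counterparts, these glue to a counterpart of the old gap
(`Gap.merge`). Hence some part is unmatched (`WinGap.step`). Halving needs about `log n` levels with
blocks of order `log n`, so `O(log² n)` rounds (`winGap_halving`).

It remains to create an unmatched gap. Next to a red run, 𝒜 builds a block at a chosen distance; ℬ
must copy it exactly next to the counterpart of that run or lose (`AWins.opening`), even if he puts
his block in the way (`Blocked.win`). Since `n` is odd, exact copying can be defeated. On the path 𝒜
starts in the middle; the counterpart of his first block lies in the other half with less room
around it, so the copy of a block reaching almost to the end of the path cannot be extended outwards
(`AWins.unmatch`). On the cycle 𝒜 builds two runs of different lengths separated by a hole of one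
cell. If the blue pair is a translate, the two arcs between the pairs have different lengths, and
the longer one plays the part of the half path (`Config.win_translate`). If it is a mirror image,
one arc has odd length, and its central cell is its own mirror image (`Config.win_mirror`).

Lower bound. ℬ maintains an involution exchanging red and blue cells that is a reflection on every
short block (`LocalReflection`). A new cell near a paired cell is answered by its reflection, any
other cell by its neighbour. Short distances between partners are odd, so that no cell is its own
image. Each round halves the radius, and isomorphism needs only radius one (`LocalReflection.step`,
`Board.edgeSetsIso_of_reflection`). On the path two virtual cells beyond the ends are paired in
advance, which keeps the answers on the board. -/

namespace SymGame

/-! ### Blocks and runs of cells along a line -/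

section Blocks

variable {G : Type*}

/-- The cells of a line with index in `[u, v)`. -/
def blk (f : ℤ → G) (u v : ℤ) : Set G := {x | ∃ i, u ≤ i ∧ i < v ∧ f i = x}

theorem mem_blk {f : ℤ → G} {u v i : ℤ} (h₁ : u ≤ i) (h₂ : i < v) : f i ∈ blk f u v :=
  ⟨i, h₁, h₂, rfl⟩

theorem blk_succ (f : ℤ → G) {u v : ℤ} (h : u ≤ v) : blk f u (v + 1) = insert (f v) (blk f u v) := by
  ext x
  simp only [blk, Set.mem_ofPred_eq, Set.mem_insert_iff]
  constructor
  · rintro ⟨i, h1, h2, rfl⟩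
    rcases eq_or_ne i v with rfl | hne
    · exact Or.inl rfl
    · exact Or.inr ⟨i, h1, by omega, rfl⟩
  · rintro (rfl | ⟨i, h1, h2, rfl⟩)
    · exact ⟨v, h, by omega, rfl⟩
    · exact ⟨i, h1, by omega, rfl⟩

theorem blk_one (f : ℤ → G) : blk f 0 1 = {f 0} := by
  ext x
  simp only [blk, Set.mem_ofPred_eq, Set.mem_singleton_iff]
  constructor
  · rintro ⟨i, h1, h2, rfl⟩
    rw [show i = 0 by omega]
  · rintro rfl
    exact ⟨0, le_rfl, by omega, rfl⟩

theorem blk_shift (f : ℤ → G) (j u v : ℤ) : blk (fun i => f (j + i)) u v = blk f (j + u) (j + v) := by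
  ext x
  constructor
  · rintro ⟨i, h1, h2, rfl⟩
    exact ⟨j + i, by omega, by omega, rfl⟩
  · rintro ⟨i, h1, h2, rfl⟩
    exact ⟨i - j, by omega, by omega, by simp⟩

theorem blk_flip (f : ℤ → G) (j u v : ℤ) :
    blk (fun i => f (j - i)) u v = blk f (j - v + 1) (j - u + 1) := by
  ext x
  constructor
  · rintro ⟨i, h1, h2, rfl⟩
    exact ⟨j - i, by omega, by omega, rfl⟩
  · rintro ⟨i, h1, h2, rfl⟩
    exact ⟨j - i, by omega, by omega, by simp⟩

/-- A maximal block `[u, v)` of consecutive cells of `X` on a line. -/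
structure Run (X : Set G) (f : ℤ → G) (u v : ℤ) : Prop where
  lt : u < v
  mem : ∀ i, u ≤ i → i < v → f i ∈ X
  left : f (u - 1) ∉ X
  right : f v ∉ X

theorem Run.shift {X : Set G} {f : ℤ → G} {u v : ℤ} (h : Run X f u v) (j : ℤ) :
    Run X (fun i => f (j + i)) (u - j) (v - j) where
  lt := by have := h.lt; omega
  mem i h1 h2 := h.mem _ (by omega) (by omega)
  left := by rw [show j + (u - j - 1) = u - 1 by ring]; exact h.left
  right := by rw [show j + (v - j) = v by ring]; exact h.right

theorem Run.flip {X : Set G} {f : ℤ → G} {u v : ℤ} (h : Run X f u v) (j : ℤ) :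
    Run X (fun i => f (j - i)) (j - v + 1) (j - u + 1) where
  lt := by have := h.lt; omega
  mem i h1 h2 := h.mem _ (by omega) (by omega)
  left := by rw [show j - (j - v + 1 - 1) = v by ring]; exact h.right
  right := by rw [show j - (j - u + 1) = u - 1 by ring]; exact h.left

end Blocks

/-! ### Lines in the ring of cells, common to path and cycle -/

section Cells

variable {G : Type*} [CommRing G]

/-- A unit-speed line in the ring of cells, traversed in one of the two directions. -/
def IsLine (f : ℤ → G) : Prop :=
  ∃ c δ : G, (δ = 1 ∨ δ = -1) ∧ ∀ i : ℤ, f i = c + i * δ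

theorem IsLine.shift {f : ℤ → G} (hf : IsLine f) (j : ℤ) : IsLine (fun i => f (j + i)) := by
  obtain ⟨c, δ, hδ, h⟩ := hf
  refine ⟨c + j * δ, δ, hδ, fun i => ?_⟩
  simp only [h]; push_cast; ring

theorem IsLine.flip {f : ℤ → G} (hf : IsLine f) (j : ℤ) : IsLine (fun i => f (j - i)) := by
  obtain ⟨c, δ, hδ, h⟩ := hf
  refine ⟨c + j * δ, -δ, ?_, fun i => ?_⟩
  · rcases hδ with h | h <;> simp [h]
  · simp only [h]; push_cast; ring

theorem isLine_add (c : G) : IsLine (fun i : ℤ => c + i) :=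
  ⟨c, 1, Or.inl rfl, fun i => by ring⟩

theorem isLine_sub (c : G) : IsLine (fun i : ℤ => c - i) :=
  ⟨c, -1, Or.inr rfl, fun i => by ring⟩

/-- Two lines through a common cell coincide up to orientation. -/
theorem IsLine.rel {f g : ℤ → G} (hf : IsLine f) (hg : IsLine g) {i j : ℤ} (h : f i = g j) :
    (∀ k, f (i + k) = g (j + k)) ∨ (∀ k, f (i + k) = g (j - k)) := by
  obtain ⟨c, δ, hδ, hc⟩ := hf
  obtain ⟨d, ε, hε, hd⟩ := hg
  rw [hc, hd] at h
  rcases hδ with rfl | rfl <;> rcases hε with rfl | rfl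
  · left; intro k; rw [hc, hd]; push_cast; linear_combination h
  · right; intro k; rw [hc, hd]; push_cast; linear_combination h
  · right; intro k; rw [hc, hd]; push_cast; linear_combination h
  · left; intro k; rw [hc, hd]; push_cast; linear_combination h

theorem IsLine.periodic {f : ℤ → G} (hf : IsLine f) {i j : ℤ} (h : f i = f j) (k : ℤ) :
    f (k + (j - i)) = f k := by
  obtain ⟨c, δ, hδ, hc⟩ := hf
  simp only [hc] at h ⊢
  push_cast
  linear_combination -h

theorem IsLine.neighbor {f : ℤ → G} (hf : IsLine f) (i : ℤ) :
    (f (i + 1) = f i + 1 ∧ f (i - 1) = f i - 1) ∨ (f (i + 1) = f i - 1 ∧ f (i - 1) = f i + 1) := by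
  obtain ⟨c, δ, hδ, hc⟩ := hf
  simp only [hc]
  rcases hδ with rfl | rfl
  · left; constructor <;> (push_cast; ring)
  · right; constructor <;> (push_cast; ring)

/-- A block of consecutive cells followed by a cell outside the set has no repetitions. -/
theorem IsLine.ne_of_lt {f : ℤ → G} (hf : IsLine f) {X : Set G} {u v : ℤ}
    (hX : ∀ i, u ≤ i → i < v → f i ∈ X) (hv : f v ∉ X) {i j : ℤ} (hij : i < j)
    (hu : u + j ≤ v + i) : f i ≠ f j := by
  intro h
  -- A repetition makes the line periodic with a period at most the length of the block, so the cell
  -- after the block would recur inside it.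
  apply hv
  have := hf.periodic h (v - (j - i))
  rw [sub_add_cancel] at this
  rw [this]
  exact hX _ (by omega) (by omega)

/-- A block of consecutive cells that meets an arc and avoids its two flanks stays in the arc. -/
theorem trap {f g : ℤ → G} (hf : IsLine f) (hg : IsLine g) {X : Set G} {u v p q i j : ℤ}
    (hX : ∀ k, u ≤ k → k < v → f k ∈ X) (hp : g p ∉ X) (hq : g q ∉ X)
    (hi : u ≤ i) (hi' : i < v) (hj : p < j) (hj' : j < q) (h : f i = g j) :
    ((∀ k, f (i + k) = g (j + k)) ∧ p < j + (u - i) ∧ j + (v - 1 - i) < q) ∨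
    ((∀ k, f (i + k) = g (j - k)) ∧ p < j - (v - 1 - i) ∧ j - (u - i) < q) := by
  rcases hf.rel hg h with hk | hk
  · left
    refine ⟨hk, ?_, ?_⟩
    · by_contra hc
      have := hk (p - j)
      rw [add_sub_cancel] at this
      exact hp (this ▸ hX _ (by omega) (by omega))
    · by_contra hc
      have := hk (q - j)
      rw [add_sub_cancel] at this
      exact hq (this ▸ hX _ (by omega) (by omega))
  · right
    refine ⟨hk, ?_, ?_⟩
    · by_contra hc
      have := hk (j - p)
      rw [sub_sub_cancel] at this
      exact hp (this ▸ hX _ (by omega) (by omega))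
    · by_contra hc
      have := hk (j - q)
      rw [sub_sub_cancel] at this
      exact hq (this ▸ hX _ (by omega) (by omega))

theorem trap_mem {f g : ℤ → G} (hf : IsLine f) (hg : IsLine g) {X : Set G} {u v p q i j : ℤ}
    (hX : ∀ k, u ≤ k → k < v → f k ∈ X) (hp : g p ∉ X) (hq : g q ∉ X)
    (hi : u ≤ i) (hi' : i < v) (hj : p < j) (hj' : j < q) (h : f i = g j)
    {k : ℤ} (hk : u ≤ k) (hk' : k < v) : ∃ l, p < l ∧ l < q ∧ f k = g l := by
  rcases trap hf hg hX hp hq hi hi' hj hj' h with ⟨h1, h2, h3⟩ | ⟨h1, h2, h3⟩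
  · refine ⟨j + (k - i), by omega, by omega, ?_⟩
    rw [← h1]; congr 1; ring
  · refine ⟨j - (k - i), by omega, by omega, ?_⟩
    rw [← h1]; congr 1; ring

/-- Two runs `[u, v)` and `[u', v')` of equal length consist of the same cells. -/
def Aligned (f : ℤ → G) (u : ℤ) (g : ℤ → G) (u' : ℤ) (n : ℤ) : Prop :=
  (∀ i, g (u' + i) = f (u + i)) ∨ (∀ i, g (u' + i) = f (u + n - 1 - i))

/-- Runs of the same set that share a cell coincide. -/
theorem Run.share {X : Set G} {f g : ℤ → G} (hf : IsLine f) (hg : IsLine g) {u v u' v' i j : ℤ}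
    (h : Run X f u v) (h' : Run X g u' v') (hi : u ≤ i) (hi' : i < v) (hj : u' ≤ j) (hj' : j < v')
    (e : g j = f i) : v' - u' = v - u ∧ Aligned f u g u' (v - u) := by
  have h1 := trap hg hf h'.mem h.left h.right hj hj' (by omega) hi' e
  have h2 := trap hf hg h.mem h'.left h'.right hi hi' (by omega) hj' e.symm
  rcases h1 with ⟨a, a1, a2⟩ | ⟨a, a1, a2⟩
  · rcases h2 with ⟨b, b1, b2⟩ | ⟨b, b1, b2⟩
    · refine ⟨by omega, Or.inl fun k => ?_⟩
      rw [show u' + k = j + (u' + k - j) by ring, a]; congr 1; omega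
    · have hs : v - u = v' - u' := by
        by_contra hne
        omega
      refine ⟨by omega, Or.inl fun k => ?_⟩
      rw [show u' + k = j + (u' + k - j) by ring, a]; congr 1; omega
  · rcases h2 with ⟨b, b1, b2⟩ | ⟨b, b1, b2⟩
    · have hs : v - u = v' - u' := by
        by_contra hne
        omega
      refine ⟨by omega, Or.inr fun k => ?_⟩
      rw [show u' + k = j + (u' + k - j) by ring, a]; congr 1; omega
    · refine ⟨by omega, Or.inr fun k => ?_⟩
      rw [show u' + k = j + (u' + k - j) by ring, a]; congr 1; omega

end Cells

end SymGame

namespace SymGame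

set_option linter.unusedSectionVars false

/-! ### The game on cells and the forced growth of blocks -/

section Game

variable {G : Type*} [CommRing G]

/-- The uncoloured cells of the board `F` when `R` is red and `B` is blue. -/
def free (F R B : Set G) : Set G := F \ (R ∪ B)

theorem mem_free {F R B : Set G} {x : G} : x ∈ free F R B ↔ x ∈ F ∧ x ∉ R ∧ x ∉ B := by
  simp [free]

/-- The cell `a` is flanked by maximal blocks of `X` of lengths `l` and `r`, in some order. -/
def Arms (X : Set G) (a : G) (l r : ℤ) : Prop :=
  ∃ f : ℤ → G, IsLine f ∧ f 0 = a ∧ (∀ i, 1 ≤ i → i ≤ r → f i ∈ X) ∧ f (r + 1) ∉ X ∧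
    (∀ i, 1 ≤ i → i ≤ l → f (-i) ∈ X) ∧ f (-l - 1) ∉ X

/-- The blue cell `b` is an admissible answer to the red cell `a`: the components that `b` extends
or joins have the same sizes as those that `a` extends or joins. -/
def Reply (R B : Set G) (a b : G) : Prop :=
  ∀ l r : ℤ, 0 ≤ l → 0 ≤ r → Arms R a l r → Arms B b l r

/-- The first player can reach, within `k` rounds, a position without an admissible answer. -/
def AWins (F : Set G) : ℕ → Set G → Set G → Prop
  | 0, _, _ => False
  | k + 1, R, B => ∃ a ∈ free F R B, ∀ b ∈ free F R B, b ≠ a → Reply R B a b →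
      AWins F k (insert a R) (insert b B)

theorem AWins.succ {F : Set G} {k : ℕ} : ∀ {R B : Set G}, AWins F k R B → AWins F (k + 1) R B := by
  induction k with
  | zero => intro R B h; exact h.elim
  | succ k ih =>
    rintro R B ⟨a, ha, h⟩
    exact ⟨a, ha, fun b hb hne hr => ih (h b hb hne hr)⟩

theorem AWins.mono {F : Set G} {k m : ℕ} {R B : Set G} (h : AWins F k R B) (hkm : k ≤ m) :
    AWins F m R B := by
  induction hkm with
  | refl => exact h
  | step _ ih => exact ih.succ

/-- Every run of `B` has more than `σ` cells, and runs of the same length coincide. -/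
structure Distinct (σ : ℤ) (B : Set G) : Prop where
  size : ∀ f u v, IsLine f → Run B f u v → σ < v - u
  uniq : ∀ f g u u' n, IsLine f → IsLine g → Run B f u (u + n) → Run B g u' (u' + n) →
    Aligned f u g u' n

theorem Distinct.mono {σ τ : ℤ} {B : Set G} (h : Distinct σ B) (hτ : τ ≤ σ) : Distinct τ B :=
  ⟨fun f u v hf hr => hτ.trans_lt (h.size f u v hf hr), h.uniq⟩

theorem distinct_empty (σ : ℤ) : Distinct σ (∅ : Set G) :=
  ⟨fun _ u _ _ hr => (hr.mem u le_rfl hr.lt).elim,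
    fun _ _ u _ _ _ _ hr _ => (hr.mem u le_rfl hr.lt).elim⟩

/-- A run after the addition of a new isolated block is either old or the new block. -/
theorem Run.of_union {B : Set G} {f g : ℤ → G} (hf : IsLine f) (hg : IsLine g) {u v q : ℤ}
    (hb : Run (B ∪ blk g 0 q) g 0 q) (h : Run (B ∪ blk g 0 q) f u v) :
    (Run B f u v ∧ ∀ i, u ≤ i → i < v → f i ∉ blk g 0 q) ∨ (v - u = q ∧ Aligned g 0 f u q) := by
  by_cases hex : ∃ i, u ≤ i ∧ i < v ∧ f i ∈ blk g 0 q
  · obtain ⟨i, h1, h2, j, h3, h4, e⟩ := hex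
    have := Run.share hg hf hb h h3 h4 h1 h2 e.symm
    rw [sub_zero] at this
    exact Or.inr this
  · push Not at hex
    refine Or.inl ⟨⟨h.lt, fun i h1 h2 => ?_, fun hc => h.left (Or.inl hc),
      fun hc => h.right (Or.inl hc)⟩, hex⟩
    exact (h.mem i h1 h2).resolve_right (hex i h1 h2)

/-- An isolated new block does not affect the old runs. -/
theorem Run.union {B : Set G} {f g : ℤ → G} (hf : IsLine f) (hg : IsLine g) {u v q : ℤ}
    (hb : Run (B ∪ blk g 0 q) g 0 q) (hd : ∀ i, 0 ≤ i → i < q → g i ∉ B) (h : Run B f u v) :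
    Run (B ∪ blk g 0 q) f u v := by
  have key : ∀ i j : ℤ, (f (i + 1) ∈ B ∨ f (i - 1) ∈ B) → 0 ≤ j → j < q → f i ≠ g j := by
    intro i j hB h1 h2 e
    have : f (i + 1) = g (j + 1) ∧ f (i - 1) = g (j - 1) ∨
        f (i + 1) = g (j - 1) ∧ f (i - 1) = g (j + 1) := by
      rcases hf.rel hg e with hk | hk
      · left; exact ⟨hk 1, by simpa [sub_eq_add_neg] using hk (-1)⟩
      · right; exact ⟨hk 1, by simpa [sub_eq_add_neg] using hk (-1)⟩
    have n1 : g (j + 1) ∉ B := by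
      rcases eq_or_ne (j + 1) q with h | h
      · rw [h]; exact fun hc => hb.right (Or.inl hc)
      · exact hd _ (by omega) (by omega)
    have n2 : g (j - 1) ∉ B := by
      rcases eq_or_ne j 0 with h | h
      · rw [h]; exact fun hc => hb.left (Or.inl hc)
      · exact hd _ (by omega) (by omega)
    rcases this with ⟨e1, e2⟩ | ⟨e1, e2⟩ <;> rw [e1, e2] at hB <;> tauto
  refine ⟨h.lt, fun i h1 h2 => Or.inl (h.mem i h1 h2), ?_, ?_⟩
  · rintro (hc | ⟨j, h1, h2, e⟩)
    · exact h.left hc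
    · exact key (u - 1) j (Or.inl (by rw [sub_add_cancel]; exact h.mem u le_rfl h.lt)) h1 h2 e.symm
  · rintro (hc | ⟨j, h1, h2, e⟩)
    · exact h.right hc
    · exact key v j (Or.inr (h.mem _ (by have := h.lt; omega) (by omega))) h1 h2 e.symm

theorem Aligned.symm {f g : ℤ → G} {u u' n : ℤ} (h : Aligned f u g u' n) : Aligned g u' f u n := by
  rcases h with h | h
  · exact Or.inl fun i => (h i).symm
  · right
    intro i
    have := h (n - 1 - i)
    rw [show u + n - 1 - (n - 1 - i) = u + i by ring] at this
    rw [← this]; congr 1; ring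

theorem Aligned.trans {f g k : ℤ → G} {u u' u'' n : ℤ} (h : Aligned f u g u' n)
    (h' : Aligned g u' k u'' n) : Aligned f u k u'' n := by
  have aux : ∀ i, u' + n - 1 - i = u' + (n - 1 - i) := fun i => by ring
  rcases h with h | h <;> rcases h' with h' | h'
  · exact Or.inl fun i => by rw [h', h]
  · exact Or.inr fun i => by rw [h', aux, h]; congr 1; ring
  · exact Or.inr fun i => by rw [h', h]
  · exact Or.inl fun i => by rw [h', aux, h]; congr 1; ring

/-- All old runs exceed `q`, so the new block is the only run of its length. This is why 𝒜 uses
blocks of decreasing sizes. -/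
theorem Distinct.union {B : Set G} {g : ℤ → G} (hg : IsLine g) {q : ℤ} (h : Distinct q B)
    (hb : Run (B ∪ blk g 0 q) g 0 q) : Distinct (q - 1) (B ∪ blk g 0 q) := by
  constructor
  · intro f u v hf hr
    rcases Run.of_union hf hg hb hr with ⟨h1, -⟩ | ⟨h1, -⟩
    · have := h.size f u v hf h1; omega
    · omega
  · intro f k u u' n hf hk hr hr'
    rcases Run.of_union hf hg hb hr with ⟨h1, -⟩ | ⟨h1, a1⟩ <;>
      rcases Run.of_union hk hg hb hr' with ⟨h2, -⟩ | ⟨h2, a2⟩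
    · exact h.uniq f k u u' n hf hk h1 h2
    · have := h.size f u _ hf h1; omega
    · have := h.size k u' _ hk h2; omega
    · have : n = q := by omega
      subst this
      exact a1.symm.trans a2

theorem Aligned.blk_eq {f g : ℤ → G} {u u' n : ℤ} (h : Aligned f u g u' n) :
    blk g u' (u' + n) = blk f u (u + n) := by
  ext x
  rcases h with h | h
  · constructor
    · rintro ⟨i, h1, h2, rfl⟩
      refine ⟨u + (i - u'), by omega, by omega, ?_⟩
      rw [← h]; congr 1; ring
    · rintro ⟨i, h1, h2, rfl⟩
      refine ⟨u' + (i - u), by omega, by omega, ?_⟩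
      rw [h]; congr 1; ring
  · constructor
    · rintro ⟨i, h1, h2, rfl⟩
      refine ⟨u + n - 1 - (i - u'), by omega, by omega, ?_⟩
      rw [← h]; congr 1; ring
    · rintro ⟨i, h1, h2, rfl⟩
      refine ⟨u' + (u + n - 1 - i), by omega, by omega, ?_⟩
      rw [h]; congr 1; ring

theorem union_insert_blk (R : Set G) (f : ℤ → G) {u v : ℤ} (h : u ≤ v) :
    insert (f v) (R ∪ blk f u v) = R ∪ blk f u (v + 1) := by
  rw [blk_succ f h, Set.union_insert]

/-- The first player extends a red block cell by cell to size `q`. The second player has to extend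
the block of his first answer `e` accordingly. -/
theorem AWins.grow {F R B : Set G} {f : ℤ → G} (hf : IsLine f) {q : ℤ} {e : G} {k : ℕ}
    (hB : Distinct q B) (hU : ∀ i, 0 ≤ i → i ≤ q → f i ∈ free F R B)
    (hinj : ∀ i j, -1 ≤ i → i < j → j ≤ q → (i, j) ≠ (-1, q) → f i ≠ f j) (hl : f (-1) ∉ R)
    (hsep : ∀ g j, IsLine g → j ≤ q → (∀ i, 0 ≤ i → i < j → g i ∈ free F R B ∧ g i ≠ f 0) →
      e ∈ blk g 0 j → ∀ i, 1 ≤ i → i ≤ q → f i ∉ blk g 0 j)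
    (H : ∀ g, IsLine g → Run (B ∪ blk g 0 q) g 0 q →
      (∀ i, 0 ≤ i → i < q → g i ∈ free F R B) → e ∈ blk g 0 q →
      (∀ i, 0 ≤ i → i ≤ q → f i ∉ blk g 0 q) → AWins F k (R ∪ blk f 0 q) (B ∪ blk g 0 q)) :
    ∀ (d : ℕ) (j : ℤ), j + d = q → 1 ≤ j → ∀ g, IsLine g → Run (B ∪ blk g 0 j) g 0 j →
      (∀ i, 0 ≤ i → i < j → g i ∈ free F R B ∧ g i ≠ f 0) → e ∈ blk g 0 j →
      AWins F (k + d) (R ∪ blk f 0 j) (B ∪ blk g 0 j) := by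
  intro d
  induction d with
  | zero =>
    intro j hj h1 g hg hr hgU he
    have : j = q := by simpa using hj
    subst this
    refine H g hg hr (fun i h1 h2 => (hgU i h1 h2).1) he fun i h1 h2 => ?_
    rcases eq_or_ne i 0 with rfl | h0
    · rintro ⟨i', h3, h4, e⟩
      exact (hgU i' h3 h4).2 e
    · exact hsep g j hg le_rfl hgU he i (by omega) h2
  | succ d ih =>
    intro j hj h1 g hg hr hgU he
    have hjq : j < q := by push_cast at hj; omega
    have hblk : ∀ i, -1 ≤ i → i ≤ q → (i < 0 ∨ j ≤ i) → (i ≠ q ∨ 0 ≤ i) → f i ∉ blk f 0 j := by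
      rintro i h2 h3 h4 h5 ⟨i', h6, h7, e'⟩
      rcases h4 with h4 | h4
      · exact hinj i i' h2 (by omega) (by omega) (by simp; omega) e'.symm
      · exact hinj i' i (by omega) (by omega) h3 (by simp; omega) e'
    have hfree : f j ∈ free F (R ∪ blk f 0 j) (B ∪ blk g 0 j) := by
      have := mem_free.1 (hU j (by omega) (by omega))
      refine mem_free.2 ⟨this.1, ?_, ?_⟩
      · rintro (h | h)
        · exact this.2.1 h
        · exact hblk j (by omega) (by omega) (Or.inr le_rfl) (Or.inr (by omega)) h
      · rintro (h | h)
        · exact this.2.2 h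
        · exact hsep g j hg hjq.le hgU he j h1 hjq.le h
    refine ⟨f j, hfree, fun b hb hne hrep => ?_⟩
    have harm : Arms (R ∪ blk f 0 j) (f j) j 0 := by
      refine ⟨fun i => f (j + i), hf.shift j, by simp, fun i _ _ => by omega, ?_, ?_, ?_⟩
      · rintro (h | h)
        · exact (mem_free.1 (hU (j + (0 + 1)) (by omega) (by omega))).2.1 h
        · exact hblk _ (by omega) (by omega) (Or.inr (by omega)) (Or.inr (by omega)) h
      · intro i h2 h3
        exact Or.inr ⟨j + -i, by omega, by omega, rfl⟩
      · show f (j + (-j - 1)) ∉ _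
        rw [show j + (-j - 1) = -1 by ring]
        rintro (h | h)
        · exact hl h
        · exact hblk _ (by omega) (by omega) (Or.inl (by omega)) (Or.inl (by omega)) h
    obtain ⟨m, hm, hm0, -, hm1, hm2, hm3⟩ := hrep j 0 (by omega) le_rfl harm
    have hbn := mem_free.1 hb
    have hrun : Run (B ∪ blk g 0 j) m (-j) 0 :=
      ⟨by omega, fun i h2 h3 => by simpa using hm2 (-i) (by omega) (by omega), hm3, hm0 ▸ hbn.2.2⟩
    -- Old runs have more than `q > j` cells, so the run extended by the answer can only be the new
    -- block.
    rcases Run.of_union hm hg hr hrun with ⟨h2, -⟩ | ⟨-, hal⟩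
    · have := hB.size m _ _ hm h2
      omega
    have hblkeq := hal.blk_eq
    rw [neg_add_cancel, zero_add] at hblkeq
    -- The answer may be at either end of the blue block; reparametrising makes the enlarged block
    -- `[0, j + 1)` again.
    set g' : ℤ → G := fun i => m (-j + i) with hg'
    have hg'l : IsLine g' := hm.shift (-j)
    have hg'b : blk g' 0 j = blk g 0 j := by
      rw [hg', blk_shift, add_zero, neg_add_cancel, hblkeq]
    have hg'j : g' j = b := by simp [hg', hm0]
    have hb' : insert b (B ∪ blk g 0 j) = B ∪ blk g' 0 (j + 1) := by
      rw [← hg'b, ← hg'j, union_insert_blk _ _ (by omega)]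
    rw [union_insert_blk _ _ (by omega), hb']
    have hmm : ∀ i, -j ≤ i → i < 0 → m i ∈ B ∪ blk g 0 j := hrun.mem
    have := ih (j + 1) (by push_cast at hj; omega) (by omega) g' hg'l ?_ ?_ ?_
    · exact this
    · rw [← hb']
      refine ⟨by omega, fun i h2 h3 => ?_, ?_, ?_⟩
      · rcases eq_or_ne i j with rfl | h4
        · exact Or.inl hg'j
        · exact Or.inr (hmm _ (by omega) (by omega))
      · rintro (h | h)
        · have h' : m (-j - 1) = m 0 := by rw [hm0, ← h]; simp only [hg']; congr 1
          have hp := hm.periodic h' (-j)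
          apply hm1
          rw [show (0 : ℤ) + 1 = -j + (0 - (-j - 1)) by ring, hp]
          exact hmm _ le_rfl (by omega)
        · exact hm3 (by simpa [hg', sub_eq_add_neg] using h)
      · have e1 : g' (j + 1) = m (0 + 1) := by simp only [hg']; congr 1; ring
        rw [e1]
        rintro (h | h)
        · have h' : m 0 = m 1 := by rw [hm0, ← h]; simp
          have hp := hm.periodic h' (-1)
          rw [show (-1 : ℤ) + (1 - 0) = 0 by ring, hm0] at hp
          exact hbn.2.2 (hp ▸ hmm _ (by omega) (by omega))
        · exact hm1 h
    · intro i h2 h3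
      rcases eq_or_ne i j with rfl | h4
      · rw [hg'j]
        refine ⟨mem_free.2 ⟨hbn.1, fun h => hbn.2.1 (Or.inl h), fun h => hbn.2.2 (Or.inl h)⟩, ?_⟩
        rintro rfl
        exact hbn.2.1 (Or.inr ⟨0, le_rfl, by omega, rfl⟩)
      · have : g' i ∈ blk g 0 j := hg'b ▸ mem_blk h2 (by omega)
        obtain ⟨i', h5, h6, e'⟩ := this
        rw [← e']
        exact hgU i' h5 h6
    · rw [blk_succ _ (by omega), hg'b]
      exact Or.inr he

end Game

end SymGame

namespace SymGame

set_option linter.unusedSectionVars false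

/-! ### Placing blocks; unmatched gaps -/

section Winning

variable {G : Type*} [CommRing G]

theorem arms_zero {X : Set G} {a : G} : Arms X a 0 0 ↔ a + 1 ∉ X ∧ a - 1 ∉ X := by
  constructor
  · rintro ⟨f, hf, rfl, -, h1, -, h2⟩
    have e := hf.neighbor 0
    rw [neg_zero] at h2
    rcases e with ⟨e1, e2⟩ | ⟨e1, e2⟩
    · rw [← e1, ← e2]; exact ⟨h1, h2⟩
    · rw [← e1, ← e2]; exact ⟨h2, h1⟩
  · rintro ⟨h1, h2⟩
    refine ⟨_, isLine_add a, by simp, fun i _ _ => by omega, by simpa using h1,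
      fun i _ _ => by omega, by simpa [sub_eq_add_neg] using h2⟩

theorem IsLine.not_mem_neighbors {f : ℤ → G} (hf : IsLine f) {X : Set G} {i : ℤ}
    (h1 : f (i + 1) ∉ X) (h2 : f (i - 1) ∉ X) : f i + 1 ∉ X ∧ f i - 1 ∉ X := by
  rcases hf.neighbor i with ⟨e1, e2⟩ | ⟨e1, e2⟩ <;> rw [← e1, ← e2]
  · exact ⟨h1, h2⟩
  · exact ⟨h2, h1⟩

/-- The first player colours a cell without red neighbours. -/
theorem AWins.place {F R B : Set G} {k : ℕ} {e : G} (he : e ∈ free F R B)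
    (h1 : e + 1 ∉ R) (h2 : e - 1 ∉ R)
    (H : ∀ e' ∈ free F R B, e' ≠ e → e' + 1 ∉ B → e' - 1 ∉ B →
      AWins F k (insert e R) (insert e' B)) : AWins F (k + 1) R B := by
  refine ⟨e, he, fun b hb hne hr => ?_⟩
  have := arms_zero.1 (hr 0 0 le_rfl le_rfl (arms_zero.2 ⟨h1, h2⟩))
  exact H b hb hne this.1 this.2

variable [Nontrivial G]

theorem run_singleton {B : Set G} {e : G} (h1 : e + 1 ∉ B) (h2 : e - 1 ∉ B) :
    Run (B ∪ blk (fun i : ℤ => e + i) 0 1) (fun i : ℤ => e + i) 0 1 := by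
  rw [blk_one]
  refine ⟨one_pos, fun i h3 h4 => ?_, ?_, ?_⟩
  · rw [show i = 0 by omega]; exact Or.inr rfl
  · rintro (h | h)
    · exact h2 (by simpa [sub_eq_add_neg] using h)
    · simp at h
  · rintro (h | h)
    · exact h1 (by simpa using h)
    · simp at h

/-- Growth of a new red block in a direction whose free cells are out of reach of the answer. -/
theorem AWins.grow_of_sep {F R B : Set G} {f : ℤ → G} (hf : IsLine f) {q : ℤ} {d : ℕ} {e : G} {k : ℕ}
    (hq : q = d + 1) (hB : Distinct q B) (hU : ∀ i, 0 ≤ i → i ≤ q → f i ∈ free F R B)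
    (hinj : ∀ i j, -1 ≤ i → i < j → j ≤ q → (i, j) ≠ (-1, q) → f i ≠ f j) (hl : f (-1) ∉ R)
    (he : e ∈ free F R B) (hne : e ≠ f 0) (he1 : e + 1 ∉ B) (he2 : e - 1 ∉ B)
    (hsep : ∀ g j, IsLine g → j ≤ q → (∀ i, 0 ≤ i → i < j → g i ∈ free F R B ∧ g i ≠ f 0) →
      e ∈ blk g 0 j → ∀ i, 1 ≤ i → i ≤ q → f i ∉ blk g 0 j)
    (H : ∀ g, IsLine g → Run (B ∪ blk g 0 q) g 0 q →
      (∀ i, 0 ≤ i → i < q → g i ∈ free F R B) → e ∈ blk g 0 q →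
      (∀ i, 0 ≤ i → i ≤ q → f i ∉ blk g 0 q) → AWins F k (R ∪ blk f 0 q) (B ∪ blk g 0 q)) :
    AWins F (k + d) (insert (f 0) R) (insert e B) := by
  have := AWins.grow hf hB hU hinj hl hsep H d 1 (by omega) le_rfl _ (isLine_add e)
    (run_singleton he1 he2) ?_ ?_
  · rw [blk_one, blk_one] at this
    simpa [Set.union_singleton] using this
  · intro i h1 h2
    rw [show i = 0 by omega]
    simpa using ⟨he, hne⟩
  · exact ⟨0, le_rfl, one_pos, by simp⟩

/-- Growth of a new red block into a free arc that does not contain the answer. -/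
theorem AWins.grow_arc {F R B : Set G} {f : ℤ → G} (hf : IsLine f) {q m : ℤ} {d : ℕ} {e : G} {k : ℕ}
    (hq : q = d + 1) (hqm : q < m) (hB : Distinct q B)
    (hU : ∀ i, 0 ≤ i → i < m → f i ∈ free F R B) (hm : f m ∉ free F R B) (hl : f (-1) ∉ R)
    (he : e ∈ free F R B) (hne : e ∉ blk f 0 m) (he1 : e + 1 ∉ B) (he2 : e - 1 ∉ B)
    (H : ∀ g, IsLine g → Run (B ∪ blk g 0 q) g 0 q →
      (∀ i, 0 ≤ i → i < q → g i ∈ free F R B) → e ∈ blk g 0 q →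
      (∀ i, 0 ≤ i → i < m → f i ∉ blk g 0 q) → AWins F k (R ∪ blk f 0 q) (B ∪ blk g 0 q)) :
    AWins F (k + d) (insert (f 0) R) (insert e B) := by
  -- The blue block avoids `f 0` and contains a cell outside the arc, so it cannot reach into the
  -- arc.
  have sep : ∀ g j, IsLine g → (∀ i, 0 ≤ i → i < j → g i ∈ free F R B ∧ g i ≠ f 0) →
      e ∈ blk g 0 j → ∀ i, 1 ≤ i → i < m → f i ∉ blk g 0 j := by
    rintro g j hg hgU ⟨i₀, h1, h2, rfl⟩ i h3 h4 ⟨i', h5, h6, e'⟩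
    obtain ⟨l, h7, h8, h9⟩ := trap_mem hg hf (X := {x | x ∈ free F R B ∧ x ≠ f 0}) hgU
      (p := 0) (q := m) (fun h => h.2 rfl) (fun h => hm h.1) h5 h6 (by omega) h4 e' h1 h2
    exact hne ⟨l, by omega, h8, h9.symm⟩
  refine AWins.grow_of_sep hf hq hB (fun i h1 h2 => hU i h1 (by omega)) ?_ hl he ?_ he1 he2
    (fun g j hg _ hgU hgj i h1 h2 => sep g j hg hgU hgj i h1 (by omega)) ?_
  · intro i j h1 h2 h3 _
    exact hf.ne_of_lt hU hm h2 (by omega)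
  · rintro rfl
    exact hne ⟨0, le_rfl, by omega, rfl⟩
  · intro g hg hr hgU hge hgf
    refine H g hg hr hgU hge fun i h1 h2 => ?_
    rcases eq_or_ne i 0 with rfl | h0
    · exact hgf 0 le_rfl (by omega)
    · refine sep g q hg (fun i' h3 h4 => ⟨hgU i' h3 h4, fun h => ?_⟩) hge i (by omega) h2
      exact hgf 0 le_rfl (by omega) ⟨i', h3, h4, h⟩

/-- Two runs of `X`, of lengths `s` and `t`, separated by exactly `h` cells, all in `U`. -/
def Gap (U X : Set G) (s h t : ℤ) : Prop :=
  ∃ f : ℤ → G, IsLine f ∧ Run X f (-s) 0 ∧ (∀ i, 0 ≤ i → i < h → f i ∈ U) ∧ Run X f h (h + t)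

theorem Gap.symm {U X : Set G} {s h t : ℤ} (H : Gap U X s h t) : Gap U X t h s := by
  obtain ⟨f, hf, h1, h2, h3⟩ := H
  refine ⟨fun i => f (h - 1 - i), hf.flip _, ?_, fun i h4 h5 => h2 _ (by omega) (by omega), ?_⟩
  · have := h3.flip (h - 1)
    convert this using 1 <;> ring
  · have := h1.flip (h - 1)
    convert this using 1 <;> ring

/-- A position in which some red gap has no blue counterpart of the same length. -/
structure Unmatched (F R B : Set G) (σ s h t : ℤ) : Prop where
  disj : Disjoint R B
  distinct : Distinct σ B
  left : σ < s
  right : σ < t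
  ne : s ≠ t
  red : Gap (free F R B) R s h t
  blue : ¬ Gap (free F R B) B s h t

/-- An unmatched gap of length one is closed at once. -/
theorem Unmatched.join {F R B : Set G} {σ s t : ℤ} (hσ : 0 ≤ σ) (H : Unmatched F R B σ s 1 t) :
    AWins F 1 R B := by
  obtain ⟨f, hf, h1, h2, h3⟩ := H.red
  refine ⟨f 0, h2 0 le_rfl one_pos, fun b hb hne hr => (H.blue ?_).elim⟩
  have hs := H.left
  have ht := H.right
  obtain ⟨g, hg, rfl, g1, g2, g3, g4⟩ := hr s t (by omega) (by omega)
    ⟨f, hf, rfl, fun i h4 h5 => h3.mem i h4 (by omega), by rw [add_comm]; exact h3.right,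
      fun i h4 h5 => h1.mem _ (by omega) (by omega), h1.left⟩
  have hb0 := (mem_free.1 hb).2.2
  refine ⟨g, hg, ⟨by omega, fun i h4 h5 => by simpa using g3 (-i) (by omega) (by omega), g4, hb0⟩,
    fun i h4 h5 => by rw [show i = 0 by omega]; exact hb,
    ⟨by omega, fun i h4 h5 => g1 i h4 (by omega), by simpa using hb0, by rw [add_comm]; exact g2⟩⟩

/-- The first player wins within `c` rounds from any position with an unmatched gap of length `h`,
provided that all block sizes exceed `σ`. -/
def WinGap (F : Set G) (σ h : ℤ) (c : ℕ) : Prop :=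
  ∀ R B : Set G, ∀ s t : ℤ, Unmatched F R B σ s h t → AWins F c R B

theorem WinGap.mono {F : Set G} {σ τ h : ℤ} {c d : ℕ} (H : WinGap F σ h c) (hσ : σ ≤ τ)
    (hc : c ≤ d) : WinGap F τ h d := fun R B s t hW =>
  (H R B s t ⟨hW.disj, hW.distinct.mono hσ, hσ.trans_lt hW.left, hσ.trans_lt hW.right, hW.ne,
    hW.red, hW.blue⟩).mono hc

end Winning

end SymGame

namespace SymGame

set_option linter.unusedSectionVars false

/-! ### Splitting and halving unmatched gaps -/

section Step

variable {G : Type*} [CommRing G]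

theorem mem_free_union {F R B Z Z' : Set G} {x : G} :
    x ∈ free F (R ∪ Z) (B ∪ Z') ↔ x ∈ free F R B ∧ x ∉ Z ∧ x ∉ Z' := by
  simp only [mem_free, Set.mem_union]
  tauto

/-- A block placed among cells outside `R` becomes a run. -/
theorem run_new {R : Set G} {f : ℤ → G} {q : ℤ} (hq : 0 < q)
    (hl : f (-1) ∉ R) (hr : f q ∉ R) (hl' : ∀ i, 0 ≤ i → i < q → f i ≠ f (-1))
    (hr' : ∀ i, 0 ≤ i → i < q → f i ≠ f q) : Run (R ∪ blk f 0 q) f 0 q := by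
  refine ⟨hq, fun i h1 h2 => Or.inr (mem_blk h1 h2), ?_, ?_⟩
  · rw [zero_sub]
    rintro (h | ⟨i, h1, h2, e⟩)
    · exact hl h
    · exact hl' i h1 h2 e
  · rintro (h | ⟨i, h1, h2, e⟩)
    · exact hr h
    · exact hr' i h1 h2 e

theorem disjoint_union_blk {F R B : Set G} {f g : ℤ → G} {u v u' v' : ℤ} (hd : Disjoint R B)
    (hf : ∀ i, u ≤ i → i < v → f i ∈ free F R B)
    (hg : ∀ i, u' ≤ i → i < v' → g i ∈ free F R B)
    (hfg : ∀ i, u ≤ i → i < v → f i ∉ blk g u' v') :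
    Disjoint (R ∪ blk f u v) (B ∪ blk g u' v') := by
  rw [Set.disjoint_left] at hd ⊢
  rintro x (hx | ⟨i, h1, h2, rfl⟩) (hy | hy)
  · exact hd hx hy
  · obtain ⟨j, h3, h4, rfl⟩ := hy
    exact (mem_free.1 (hg j h3 h4)).2.1 hx
  · exact (mem_free.1 (hf i h1 h2)).2.2 hy
  · exact hfg i h1 h2 hy

/-- A new blue block in an arc between red cells is not adjacent to any other blue block. -/
theorem not_gap_of_trapped {U₀ U R B : Set G} {f g : ℤ → G} (hf : IsLine f) (hg : IsLine g)
    {s h q p r j : ℤ} (hd : Disjoint R (B ∪ blk g 0 q)) (hUR : Disjoint R U)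
    (hU₀ : Disjoint U₀ B) (hp : f p ∈ R) (hr : f r ∈ R) (hpj : p < j) (hjr : j < r)
    (hj : f j ∈ blk g 0 q) (harc : ∀ i, p < i → i < r → f i ∈ U₀)
    (hb : Run (B ∪ blk g 0 q) g 0 q) (hD : Distinct (q - 1) (B ∪ blk g 0 q)) (hs : s ≠ q)
    (hh : 0 ≤ h) : ¬ Gap U (B ∪ blk g 0 q) s h q := by
  rintro ⟨m, hm, h1, h2, h3⟩
  have hal := hD.uniq m g h 0 q hm hg h3 (by rwa [zero_add])
  have hbe := hal.blk_eq
  rw [zero_add] at hbe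
  rw [hbe] at hj
  obtain ⟨i, h4, h5, e⟩ := hj
  have hlt := h1.lt
  obtain ⟨l, h6, h7, e'⟩ := trap_mem hm hf (X := U ∪ (B ∪ blk g 0 q)) (u := -s) (v := h + q)
    (fun k h6 h7 => by
      by_cases h8 : k < 0
      · exact Or.inr (h1.mem k h6 h8)
      · by_cases h9 : k < h
        · exact Or.inl (h2 k (by omega) h9)
        · exact Or.inr (h3.mem k (by omega) h7))
    (fun hc => hc.elim (Set.disjoint_left.1 hUR hp) (Set.disjoint_left.1 hd hp))
    (fun hc => hc.elim (Set.disjoint_left.1 hUR hr) (Set.disjoint_left.1 hd hr))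
    (by omega) h5 hpj hjr e (k := -1) (by omega) (by omega)
  -- The only blue cells of the arc are those of the new block; hence the run of length `s` would
  -- meet the block of length `q`, although `s ≠ q`.
  have hB : m (-1) ∈ blk g 0 q := by
    refine (h1.mem (-1) (by omega) (by omega)).resolve_left fun hc => ?_
    rw [e'] at hc
    exact Set.disjoint_left.1 hU₀ (harc l h6 h7) hc
  rcases Run.of_union hm hg hb h1 with ⟨-, h8⟩ | ⟨h8, -⟩
  · exact h8 (-1) (by omega) (by omega) hB
  · omega

/-- Two adjacent gaps around the new blue block come from one old gap. -/
theorem Gap.merge {U U' B : Set G} {g : ℤ → G} (hg : IsLine g) {s h₁ q h₂ t : ℤ}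
    (hb : Run (B ∪ blk g 0 q) g 0 q) (hD : Distinct (q - 1) (B ∪ blk g 0 q))
    (hgU : ∀ i, 0 ≤ i → i < q → g i ∈ U) (hU : U' ⊆ U) (hUB : Disjoint U' (B ∪ blk g 0 q))
    (hs : s ≠ q) (ht : t ≠ q) (hst : s ≠ t) (h1 : 0 ≤ h₁) (h2 : 0 ≤ h₂)
    (H₁ : Gap U' (B ∪ blk g 0 q) s h₁ q) (H₂ : Gap U' (B ∪ blk g 0 q) q h₂ t) :
    Gap U B s (h₁ + q + h₂) t := by
  obtain ⟨m, hm, m1, m2, m3⟩ := H₁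
  obtain ⟨n, hn, n1, n2, n3⟩ := H₂
  have hq := hb.lt
  have m1l := m1.lt
  have n3l := n3.lt
  have hdis := Set.disjoint_left.1 hUB
  rcases hD.uniq m n h₁ (-q) q hm hn m3 (by simpa using n1) with hal | hal
  · have e : ∀ i, n i = m (h₁ + q + i) := fun i => by
      have := hal (q + i)
      rw [show -q + (q + i) = i by ring] at this
      rw [this]; congr 1; ring
    refine ⟨m, hm, ?_, fun i h3 h4 => ?_, ?_⟩
    · rcases Run.of_union hm hg hb m1 with ⟨h, -⟩ | ⟨h, -⟩
      · exact h
      · omega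
    · by_cases h5 : i < h₁
      · exact hU (m2 i h3 h5)
      · by_cases h6 : i < h₁ + q
        · have hbe := (hD.uniq g m 0 h₁ q hg hm (by rwa [zero_add]) m3).blk_eq
          have : m i ∈ blk g 0 (0 + q) := hbe ▸ mem_blk (by omega) h6
          obtain ⟨j, h7, h8, e'⟩ := this
          rw [← e']
          exact hgU j h7 (by omega)
        · have := hU (n2 (i - (h₁ + q)) (by omega) (by omega))
          rw [e] at this
          convert this using 2
          ring
    · have h3 : Run B n h₂ (h₂ + t) := by
        rcases Run.of_union hn hg hb n3 with ⟨h, -⟩ | ⟨h, -⟩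
        · exact h
        · omega
      have h4 := h3.shift (-(h₁ + q))
      convert h4 using 1
      · funext i; rw [e]; congr 1; ring
      · ring
      · ring
  · have e : ∀ i, n i = m (h₁ - 1 - i) := fun i => by
      have := hal (q + i)
      rw [show -q + (q + i) = i by ring] at this
      rw [this]; congr 1; ring
    -- Both gaps would lie on the same side of the new block: either the shorter one ends inside the
    -- free cells of the longer one, or they end at the same run, contradicting `s ≠ t`.
    exfalso
    rcases lt_trichotomy h₂ h₁ with h3 | h3 | h3
    · have h4 := n3.mem h₂ le_rfl (by omega)
      rw [e] at h4
      exact hdis (m2 _ (by omega) (by omega)) h4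
    · have := Run.share hm hn m1 n3 (i := -1) (j := h₂) (by omega) (by omega) le_rfl (by omega)
        (by rw [e]; congr 1; omega)
      omega
    · have h4 := n2 h₁ (by omega) h3
      rw [e] at h4
      exact hdis h4 (m1.mem _ (by omega) (by omega))

variable [Nontrivial G]

theorem disjoint_free_left (F R B : Set G) : Disjoint R (free F R B) :=
  Set.disjoint_left.2 fun _ h h' => (mem_free.1 h').2.1 h

theorem disjoint_free_right (F R B : Set G) : Disjoint (free F R B) B :=
  Set.disjoint_left.2 fun _ h h' => (mem_free.1 h).2.2 h'

theorem free_union_subset (F R B Z Z' : Set G) : free F (R ∪ Z) (B ∪ Z') ⊆ free F R B :=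
  fun _ h => (mem_free_union.1 h).1

/-- The first player splits an unmatched gap by a new block. -/
theorem WinGap.step {F : Set G} {σ h L q q₁ h₂ : ℤ} {d d₁ c : ℕ} (hq : q = d + 1)
    (hq₁ : q₁ = d₁ + 1) (hh : h = L + q + h₂) (hqσ : q ≤ σ) (hL : 1 ≤ L) (hh₂ : 1 ≤ h₂)
    (h1 : q₁ ≤ q) (h2 : q₁ ≤ L) (W₁ : WinGap F (q₁ - 1) (L + 1 - q₁) c)
    (W₂ : WinGap F (q - 1) L c) (W₃ : WinGap F (q - 1) h₂ c) : WinGap F σ h (c + q.toNat) := by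
  intro R B s t H
  obtain ⟨f, hf, f1, f2, f3⟩ := H.red
  have hs := H.left
  have ht := H.right
  have hst := H.ne
  have hnR : ∀ i, 0 ≤ i → i < h → f i ∉ R := fun i h3 h4 => (mem_free.1 (f2 i h3 h4)).2.1
  have hpos : f (-1) ∈ R := f1.mem _ (by omega) (by omega)
  have hposr : f h ∈ R := f3.mem _ le_rfl (by omega)
  have hfh : f h ∉ free F R B := fun hc => (mem_free.1 hc).2.1 hposr
  have hf1 : f (-1) ∉ free F R B := fun hc => (mem_free.1 hc).2.1 hpos
  have hinj : ∀ i j, 0 ≤ i → i < j → j < h → f i ≠ f j := fun i j h3 h4 h5 =>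
    hf.ne_of_lt f2 hfh h4 (by omega)
  have hnb := hf.not_mem_neighbors (i := L) (hnR (L + 1) (by omega) (by omega))
    (hnR (L - 1) (by omega) (by omega))
  have hcost : c + q.toNat = c + d + 1 := by omega
  rw [hcost]
  refine AWins.place (f2 L (by omega) (by omega)) hnb.1 hnb.2 fun e he hne he1 he2 => ?_
  by_cases hright : e ∈ blk f (L + 1) h
  · -- the answer lies between the new cell and the run of length `t`
    obtain ⟨j, hj1, hj2, rfl⟩ := hright
    have := AWins.grow_arc (F := F) (R := R) (B := B) (f := fun i => f (L - i)) (hf.flip L)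
      (m := L + 1) (e := f j) (k := c) hq₁ (by omega) (H.distinct.mono (by omega))
      (fun i h3 h4 => f2 _ (by omega) (by omega)) (by
        show f (L - (L + 1)) ∉ _
        rwa [show L - (L + 1) = -1 by ring]) (hnR _ (by omega) (by omega)) he ?_ he1 he2 ?_
    · simp only [sub_zero] at this
      exact this.mono (by omega)
    · rintro ⟨i, h3, h4, e⟩
      exact hinj _ _ (by omega) (by omega) hj2 e
    · intro g hg hb hgU hge hgf
      have hD := (H.distinct.mono (show q₁ ≤ σ by omega)).union hg hb
      have hrun : Run (R ∪ blk (fun i => f (L - i)) 0 q₁) (fun i => f (L - i)) 0 q₁ :=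
        run_new (by omega) (hnR _ (by omega) (by omega)) (hnR _ (by omega) (by omega))
          (fun i h3 h4 => hinj _ _ (by omega) (by omega) (by omega))
          (fun i h3 h4 => (hinj _ _ (by omega) (by omega) (by omega)).symm)
      have hdis := disjoint_union_blk (u := 0) (v := q₁) (f := fun i => f (L - i)) H.disj
        (fun i h3 h4 => f2 _ (by omega) (by omega)) hgU (fun i h3 h4 => hgf i h3 (by omega))
      have hnotB : ∀ i, 0 ≤ i → i < q₁ → (fun i => f (L - i)) i ∉ R :=
        fun i h3 h4 => hnR _ (by omega) (by omega)
      -- The red block has been grown towards the run of length `s`, while the blue one is shut in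
      -- between the red cells `f L` and `f h` and has no other blue run beside it.
      refine W₁ _ _ s q₁ ⟨hdis, hD, by omega, by omega, by omega, ?_, ?_⟩
      · refine ⟨f, hf, Run.union hf (hf.flip L) hrun hnotB f1, fun i h3 h4 => ?_, ?_⟩
        · refine mem_free_union.2 ⟨f2 i h3 (by omega), ?_, ?_⟩
          · rintro ⟨i', h5, h6, e⟩
            exact hinj _ _ (by omega) (by omega) (by omega) e.symm
          · have := hgf (L - i) (by omega) (by omega)
            simpa using this
        · have := hrun.flip L
          convert this using 1
          · funext i; simp
          · ring
          · ring
      · exact not_gap_of_trapped hf hg hdis (disjoint_free_left _ _ _) (disjoint_free_right F R B)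
          (p := L) (r := h) (j := j) (Or.inr ⟨0, le_rfl, by omega, by simp⟩) (Or.inl hposr)
          (by omega) hj2 hge (fun i h3 h4 => f2 i (by omega) h4) hb hD (by omega) (by omega)
  · have := AWins.grow_arc (F := F) (R := R) (B := B) (f := fun i => f (L + i)) (hf.shift L)
      (m := h - L) (e := e) (k := c) hq (by omega) (H.distinct.mono hqσ)
      (fun i h3 h4 => f2 _ (by omega) (by omega)) (by
        show f (L + (h - L)) ∉ _
        rwa [show L + (h - L) = h by ring]) (hnR _ (by omega) (by omega)) he ?_ he1 he2 ?_
    · simpa using this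
    · rintro ⟨i, h3, h4, rfl⟩
      rcases eq_or_ne i 0 with rfl | h0
      · exact hne (by simp)
      · exact hright ⟨L + i, by omega, by omega, rfl⟩
    · intro g hg hb hgU hge hgf
      have hD := (H.distinct.mono hqσ).union hg hb
      have hrun : Run (R ∪ blk (fun i => f (L + i)) 0 q) (fun i => f (L + i)) 0 q :=
        run_new (by omega) (hnR _ (by omega) (by omega)) (hnR _ (by omega) (by omega))
          (fun i h3 h4 => (hinj _ _ (by omega) (by omega) (by omega)).symm)
          (fun i h3 h4 => hinj _ _ (by omega) (by omega) (by omega))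
      have hdis := disjoint_union_blk (u := 0) (v := q) (f := fun i => f (L + i)) H.disj
        (fun i h3 h4 => f2 _ (by omega) (by omega)) hgU (fun i h3 h4 => hgf i h3 (by omega))
      have hnotB : ∀ i, 0 ≤ i → i < q → (fun i => f (L + i)) i ∉ R :=
        fun i h3 h4 => hnR _ (by omega) (by omega)
      have red₂ : Gap (free F (R ∪ blk (fun i => f (L + i)) 0 q) (B ∪ blk g 0 q))
          (R ∪ blk (fun i => f (L + i)) 0 q) q h₂ t := by
        refine ⟨fun i => f (L + q + i), hf.shift _, ?_, fun i h3 h4 => ?_, ?_⟩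
        · have := hrun.shift q
          convert this using 1
          · funext i; congr 1; ring
          · ring
          · ring
        · refine mem_free_union.2 ⟨f2 _ (by omega) (by omega), ?_, ?_⟩
          · rintro ⟨i', h5, h6, e⟩
            exact hinj _ _ (by omega) (by omega) (by omega) e
          · have := hgf (q + i) (by omega) (by omega)
            simpa [add_assoc] using this
        · have := (Run.union hf (hf.shift L) hrun hnotB f3).shift (L + q)
          convert this using 1 <;> omega
      by_cases hleft : e ∈ blk f 0 L
      · obtain ⟨j, hj1, hj2, rfl⟩ := hleft
        refine W₃ _ _ q t ⟨hdis, hD, by omega, by omega, by omega, red₂, fun hc => ?_⟩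
        exact not_gap_of_trapped hf hg hdis (disjoint_free_left _ _ _) (disjoint_free_right F R B)
          (p := -1) (r := L) (j := j) (Or.inl hpos) (Or.inr ⟨0, le_rfl, by omega, by simp⟩)
          (by omega) hj2 hge (fun i h3 h4 => f2 i (by omega) (by omega)) hb hD (s := t) (by omega)
          (by omega) hc.symm
      · have hgL : ∀ i, 0 ≤ i → i < L → f i ∉ blk g 0 q := by
          rintro i h3 h4 ⟨i', h5, h6, e'⟩
          obtain ⟨i₀, h7, h8, rfl⟩ := hge
          obtain ⟨l, h9, h10, h11⟩ := trap_mem hg hf (u := 0) (v := q)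
            (X := {x | x ∈ free F R B ∧ x ≠ f L})
            (fun k h9 h10 => ⟨hgU k h9 h10, fun hc =>
              hgf 0 le_rfl (by omega) ⟨k, h9, h10, by simpa using hc⟩⟩)
            (p := -1) (q := L) (fun hc => hf1 hc.1) (fun hc => hc.2 rfl)
            h5 h6 (by omega) h4 e' h7 h8
          exact hleft ⟨l, by omega, h10, h11.symm⟩
        -- Now both parts of the red gap are free. If both had blue counterparts, `Gap.merge` would
        -- produce a counterpart of the old gap.
        by_cases hc : Gap (free F (R ∪ blk (fun i => f (L + i)) 0 q) (B ∪ blk g 0 q))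
            (B ∪ blk g 0 q) s L q
        · refine W₃ _ _ q t ⟨hdis, hD, by omega, by omega, by omega, red₂, fun hc' => ?_⟩
          refine H.blue ?_
          rw [hh]
          exact hc.merge hg hb hD hgU (free_union_subset _ _ _ _ _) (disjoint_free_right _ _ _)
            (by omega) (by omega) hst (by omega) (by omega) hc'
        · refine W₂ _ _ s q ⟨hdis, hD, by omega, by omega, by omega, ?_, hc⟩
          refine ⟨f, hf, Run.union hf (hf.shift L) hrun hnotB f1, fun i h3 h4 => ?_, ?_⟩
          · refine mem_free_union.2 ⟨f2 i h3 (by omega), ?_, hgL i h3 h4⟩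
            rintro ⟨i', h5, h6, e⟩
            exact hinj _ _ (by omega) (by omega) (by omega) e.symm
          · have := hrun.shift (-L)
            convert this using 1
            · funext i; simp
            · ring
            · ring

theorem winGap_one (F : Set G) {σ : ℤ} (hσ : 0 ≤ σ) : WinGap F σ 1 1 :=
  fun _ _ _ _ H => H.join hσ

/-- A block of size `h - 2` leaves a single free cell on either side, and `h - 2 ≤ σ` keeps it
shorter than all existing blocks. If the first answer falls to the right, the first cell itself
serves as the block (`q₁ = 1`) and is already at distance one from the left run. -/
theorem winGap_of_le (F : Set G) {σ h : ℤ} (h1 : 3 ≤ h) (h2 : h ≤ σ + 2) :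
    WinGap F σ h (h.toNat - 1) :=
  (WinGap.step (L := 1) (q := h - 2) (q₁ := 1) (h₂ := 1) (d := (h - 3).toNat) (d₁ := 0) (c := 1)
    (by omega) (by simp) (by ring) (by omega) le_rfl le_rfl (by omega) le_rfl
    (by simpa using winGap_one F le_rfl) (winGap_one F (by omega)) (winGap_one F (by omega))).mono
    le_rfl (by omega)

/-- A gap of two cells is left out here and below: it can be neither filled by one cell nor split by
a block that touches no run. -/
theorem winGap_small (F : Set G) {σ h : ℤ} (hσ : 0 ≤ σ) (h1 : h = 1 ∨ 3 ≤ h) (h2 : h ≤ σ + 2) :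
    WinGap F σ h (σ.toNat + 1) := by
  rcases h1 with rfl | h1
  · exact (winGap_one F hσ).mono le_rfl (by omega)
  · exact (winGap_of_le F h1 h2).mono le_rfl (by omega)

/-- One splitting with a block of size `q ≤ 4` leaves parts covered by `winGap_small` with `σ = q -
1`; the longest case is `13 = 4 + 4 + 5`. The choice `q₁ = L` reduces the gap of the leftward
alternative to one cell. The cost is at most `5 + 4`. -/
theorem winGap_base (F : Set G) {h : ℤ} (h1 : h = 1 ∨ 3 ≤ h) (h2 : h ≤ 13) :
    WinGap F 4 h 9 := by
  have key : ∀ L q h₂ : ℤ, (h = L + q + h₂ ∧ q ≤ 4 ∧ 1 ≤ L ∧ L ≤ q ∧ 1 ≤ h₂ ∧ L ≠ 2 ∧ h₂ ≠ 2 ∧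
      h₂ ≤ q + 1) → WinGap F 4 h 9 := by
    rintro L q h₂ ⟨e, a1, a3, a4, a5, a6, a7, a8⟩
    refine (WinGap.step (q₁ := L) (d := (q - 1).toNat) (d₁ := (L - 1).toNat) (c := 5) (by omega)
      (by omega) e a1 a3 a5 a4 le_rfl ?_ ?_ ?_).mono le_rfl (by omega)
    · rw [show L + 1 - L = 1 by ring]
      exact (winGap_one F (by omega)).mono le_rfl (by omega)
    · exact (winGap_small F (by omega) (by omega) (by omega)).mono le_rfl (by omega)
    · exact (winGap_small F (by omega) (by omega) (by omega)).mono le_rfl (by omega)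
  by_cases h3 : h ≤ 6
  · exact (winGap_small F (by omega) h1 (by omega)).mono le_rfl (by simp)
  by_cases h4 : h = 7
  · exact key 1 3 3 (by omega)
  by_cases h5 : h ≤ 10
  · exact key 1 4 (h - 5) (by omega)
  by_cases h6 : h ≤ 12
  · exact key 3 4 (h - 7) (by omega)
  · exact key 4 4 5 (by omega)

/-- Halving: an unmatched gap of length at most `13 * 2 ^ i` is won in quadratically many rounds. -/
theorem winGap_halving (F : Set G) (i : ℕ) : ∀ {h : ℤ}, (h = 1 ∨ 3 ≤ h) → h ≤ 13 * 2 ^ i →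
    WinGap F (i + 4) h ((i + 3) ^ 2) := by
  induction i with
  | zero =>
    intro h h1 h2
    simpa using winGap_base F h1 (by simpa using h2)
  | succ i ih =>
    intro h h1 h2
    by_cases h3 : h ≤ 13 * 2 ^ i
    · exact (ih h1 h3).mono (by push_cast; omega) (Nat.pow_le_pow_left (by omega) 2)
    have hi : (i : ℤ) + 1 ≤ 2 ^ i := by exact_mod_cast Nat.lt_two_pow_self
    rw [pow_succ] at h2
    -- This level uses a block of size `i + 5`, which is paid for by `(i + 4) ^ 2 - (i + 3) ^ 2 = 2
    -- * i + 7`.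
    have hc : (i + 3) ^ 2 + (i + 5 : ℤ).toNat ≤ (i + 1 + 3) ^ 2 := by
      have : (i + 5 : ℤ).toNat = i + 5 := by omega
      rw [this]; nlinarith
    generalize hp : (2 : ℤ) ^ i = p at *
    have hone : WinGap F (i + 5 - 1) 1 ((i + 3) ^ 2) :=
      (winGap_one F (by omega)).mono le_rfl (Nat.one_le_pow _ _ (by omega))
    have ih' : ∀ {h : ℤ}, 3 ≤ h → h ≤ 13 * p → WinGap F (i + 5 - 1) h ((i + 3) ^ 2) :=
      fun a b => (ih (Or.inr a) b).mono (by omega) le_rfl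
    -- With `q₁ = i + 5` the leftward alternative leaves a gap of `L - i - 4` cells, which is at
    -- least `3` exactly when `L ≥ i + 7`. The other case occurs only for `i = 0`; there `L = i + 5`
    -- makes that gap a single cell.
    by_cases h4 : (i : ℤ) + 7 ≤ (h - (i + 5)) / 2
    · refine (WinGap.step (L := (h - (i + 5)) / 2) (q := i + 5) (q₁ := i + 5)
        (h₂ := h - (i + 5) - (h - (i + 5)) / 2) (d := i + 4) (d₁ := i + 4) (c := (i + 3) ^ 2)
        (by push_cast; ring) (by push_cast; ring) (by ring) (by push_cast; omega) (by omega)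
        (by omega) le_rfl (by omega) (ih' (by omega) (by omega)) (ih' (by omega) (by omega))
        (ih' (by omega) (by omega))).mono le_rfl hc
    · refine (WinGap.step (L := i + 5) (q := i + 5) (q₁ := i + 5)
        (h₂ := h - 2 * (i + 5)) (d := i + 4) (d₁ := i + 4) (c := (i + 3) ^ 2)
        (by push_cast; ring) (by push_cast; ring) (by ring) (by push_cast; omega) (by omega)
        (by omega) le_rfl (by omega) ?_ (ih' (by omega) (by omega))
        (ih' (by omega) (by omega))).mono le_rfl hc
      rwa [show (i : ℤ) + 5 + 1 - (i + 5) = 1 by ring]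

end Step

end SymGame

namespace SymGame

set_option linter.unusedSectionVars false

/-! ### A blue block caught between two red runs -/

section Opening

variable {G : Type*} [CommRing G]

/-- If all blue blocks of size `k` are enclosed, the first player wins by extending a red block of
size `k`. -/
theorem AWins.stuck {F R B : Set G} {a : G} {k w : ℤ} (ha : a ∈ free F R B) (harm : Arms R a k w)
    (hk : 1 ≤ k) (hw : 0 ≤ w)
    (hB : ∀ g, IsLine g → Run B g (-k) 0 → g 0 ∉ free F R B ∨ g 0 = a) : AWins F 1 R B := by
  refine ⟨a, ha, fun b hb hne hr => ?_⟩
  obtain ⟨m, hm, rfl, -, -, h1, h2⟩ := hr k w (by omega) hw harm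
  rcases hB m hm ⟨by omega, fun i h3 h4 => by simpa using h1 (-i) (by omega) (by omega), h2,
    (mem_free.1 hb).2.2⟩ with h | h
  · exact (h hb).elim
  · exact (hne h).elim

theorem Aligned.end_eq {f m : ℤ → G} {p k : ℤ} (h : Aligned f p m (-k) k) :
    m 0 = f (p + k) ∨ m 0 = f (p - 1) := by
  rcases h with h | h
  · left
    have := h k
    rwa [neg_add_cancel] at this
  · right
    have := h k
    rw [neg_add_cancel] at this
    rw [this]; congr 1; ring

variable [Nontrivial G]

/-- An isolated cell creates only a run of length one, so longer runs are old. This is the reason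
for `2 ≤ k` in `AWins.finish`. -/
theorem Run.of_insert {B : Set G} {f : ℤ → G} (hf : IsLine f) {b : G} {u v : ℤ} (h1 : b + 1 ∉ B)
    (h2 : b - 1 ∉ B) (hr : Run (insert b B) f u v) (huv : 1 < v - u) : Run B f u v := by
  have e : insert b B = B ∪ blk (fun i : ℤ => b + i) 0 1 := by
    rw [blk_one]; simp [Set.union_singleton]
  rw [e] at hr
  rcases Run.of_union hf (isLine_add b) (run_singleton h1 h2) hr with ⟨h, -⟩ | ⟨h, -⟩
  · exact h
  · omega

/-- The block `[g, g + k)` is red, its blue counterpart `[p, p + k)` is closed on one side: the first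
player closes the other side and wins by extending his own block. -/
theorem AWins.finish {F R B : Set G} {f : ℤ → G} (hf : IsLine f) {p g k : ℤ} (hk : 2 ≤ k)
    (hpg : p + k ≤ g) (hv : Run R f g (g + k))
    (hB : ∀ m, IsLine m → Run B m (-k) 0 → Aligned f p m (-k) k)
    (hcl : f (p - 1) ∉ free F R B) (hpk : f (p + k - 1) ∈ B) (hpk' : f (p + k - 1) ∉ R)
    (hin : ∀ i, p + k ≤ i → i < g → f i ∈ free F R B) (hout : f (g + k) ∈ free F R B)
    (hout' : f (g + k + 1) ∉ R) (hout'' : p + k < g → f (g + k + 1) ≠ f (p + k))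
    (hinj : ∀ i j, p + k ≤ i → i < j → (j < g ∨ j = g + k) → (i < g) → f i ≠ f j) :
    AWins F 2 R B := by
  have arms_out : ∀ R' : Set G, (∀ i, g ≤ i → i < g + k → f i ∈ R') → f (g - 1) ∉ R' →
      f (g + k + 1) ∉ R' → Arms R' (f (g + k)) k 0 := by
    intro R' h1 h2 h3
    refine ⟨fun i => f (g + k + i), hf.shift _, by simp, fun i _ _ => by omega, by simpa using h3,
      fun i h4 h5 => h1 _ (by omega) (by omega), ?_⟩
    show f (g + k + (-k - 1)) ∉ R'
    rwa [show g + k + (-k - 1) = g - 1 by ring]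
  have arms_in : ∀ (R' : Set G) (w : ℤ), (∀ i, g ≤ i → i < g + k → f i ∈ R') → f (g + k) ∉ R' →
      (∀ i, 1 ≤ i → i ≤ w → f (g - 1 - i) ∈ R') → f (g - 1 - (w + 1)) ∉ R' →
      Arms R' (f (g - 1)) k w := by
    intro R' w h1 h2 h3 h4
    refine ⟨fun i => f (g - 1 - i), hf.flip _, by simp, h3, h4,
      fun i h4 h5 => h1 _ (by omega) (by omega), ?_⟩
    show f (g - 1 - (-k - 1)) ∉ R'
    rwa [show g - 1 - (-k - 1) = g + k by ring]
  have hgR : f g ∈ R := hv.mem g le_rfl (by omega)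
  -- If the blocks touch, the blue one is closed on both sides and an outward extension of the red
  -- one has no answer.
  rcases eq_or_lt_of_le hpg with h | h
  · refine AWins.mono (AWins.stuck hout (arms_out R hv.mem hv.left hout') (by omega) le_rfl
      fun m hm hr => Or.inl ?_) one_le_two
    rcases (hB m hm hr).end_eq with e | e <;> rw [e]
    · rw [h]; exact fun hc => (mem_free.1 hc).2.1 hgR
    · exact hcl
  -- If one free cell separates the blocks, taking it extends the red block and at the same time
  -- closes the blue one.
  rcases eq_or_lt_of_le (show p + k ≤ g - 1 by omega) with h' | h'
  · refine AWins.mono (AWins.stuck (hin (g - 1) (by omega) (by omega)) (arms_in R 0 hv.mem hv.right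
      (fun i _ _ => by omega) (by rw [← h']; simpa using hpk')) (by omega) le_rfl
      fun m hm hr => ?_) one_le_two
    rcases (hB m hm hr).end_eq with e | e <;> rw [e]
    · right; rw [h']
    · left; exact hcl
  have hz := hin (p + k) le_rfl h
  have hnb := hf.not_mem_neighbors (i := p + k)
    (fun hc => (mem_free.1 (hin (p + k + 1) (by omega) (by omega))).2.1 hc) hpk'
  refine AWins.place hz hnb.1 hnb.2 fun b hb hbne hb1 hb2 => ?_
  have hB' : ∀ m, IsLine m → Run (insert b B) m (-k) 0 →
      m 0 ∉ free F (insert (f (p + k)) R) (insert b B) := by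
    intro m hm hr hc
    rw [mem_free, Set.mem_insert_iff, Set.mem_insert_iff] at hc
    rcases (hB m hm (hr.of_insert hm hb1 hb2 (by omega))).end_eq with e | e
    · exact hc.2.1 (Or.inl e)
    · rw [e] at hc
      exact hcl (mem_free.2 ⟨hc.1, fun h => hc.2.1 (Or.inr h), fun h => hc.2.2 (Or.inr h)⟩)
  have hmem : ∀ i, g ≤ i → i < g + k → f i ∈ insert (f (p + k)) R :=
    fun i h1 h2 => Or.inr (hv.mem i h1 h2)
  have hg1 : f (g - 1) ∉ insert (f (p + k)) R := by
    rintro (h1 | h1)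
    · exact hinj _ _ le_rfl h' (Or.inl (by omega)) h h1.symm
    · exact hv.left h1
  have hgk : f (g + k) ∉ insert (f (p + k)) R := by
    rintro (h1 | h1)
    · exact hinj _ _ le_rfl (by omega) (Or.inr rfl) h h1.symm
    · exact hv.right h1
  -- The red block has two free ends and ℬ has had one move: if he took the outer end, the inner one
  -- is used.
  by_cases hbo : b = f (g + k)
  · have hfree : f (g - 1) ∈ free F (insert (f (p + k)) R) (insert b B) := by
      have := mem_free.1 (hin (g - 1) (by omega) (by omega))
      refine mem_free.2 ⟨this.1, hg1, ?_⟩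
      rintro (h1 | h1)
      · exact hinj (g - 1) (g + k) (by omega) (by omega) (Or.inr rfl) (by omega) (h1.trans hbo)
      · exact this.2.2 h1
    have hz1 : f (p + k - 1) ∉ insert (f (p + k)) R := by
      rintro (h1 | h1)
      · exact (mem_free.1 hz).2.2 (h1 ▸ hpk)
      · exact hpk' h1
    -- In this case the inward extension also joins the cell just played at `p + k`, so the second
    -- arm has length one.
    by_cases hw : g - 2 = p + k
    · refine AWins.stuck hfree (arms_in _ 1 hmem hgk (fun i h1 h2 => ?_) ?_) (by omega) zero_le_one
        fun m hm hr => Or.inl (hB' m hm hr)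
      · left; congr 1; omega
      · rwa [show g - 1 - (1 + 1) = p + k - 1 by omega]
    · refine AWins.stuck hfree (arms_in _ 0 hmem hgk (fun i h1 h2 => by omega) ?_) (by omega) le_rfl
        fun m hm hr => Or.inl (hB' m hm hr)
      rintro (h1 | h1)
      · exact hinj _ _ le_rfl (show p + k < g - 1 - (0 + 1) by omega) (Or.inl (by omega)) h h1.symm
      · exact (mem_free.1 (hin _ (by omega) (by omega))).2.1 h1
  · refine AWins.stuck (a := f (g + k)) ?_ (arms_out _ hmem hg1 ?_) (by omega) le_rfl
      fun m hm hr => Or.inl (hB' m hm hr)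
    · have := mem_free.1 hout
      refine mem_free.2 ⟨this.1, hgk, ?_⟩
      rintro (h1 | h1)
      · exact hbo h1.symm
      · exact this.2.2 h1
    · rintro (h1 | h1)
      · exact hout'' h h1
      · exact hout' h1

/-- The blue block `[p, p + k)` separates the red blocks `[-s, 0)` and `[g, g + k)`. -/
structure Blocked (F R B : Set G) (f : ℤ → G) (s k p g a : ℤ) : Prop where
  line : IsLine f
  disj : Disjoint R B
  distinct : Distinct (k - 1) B
  base : Run R f (-s) 0
  far : Run R f g (g + k)
  sep : Run B f p (p + k)
  hk : 2 ≤ k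
  hs : k < s
  hp : 0 ≤ p
  hpg : p + k ≤ g
  hga : g + k < a
  free₁ : ∀ i, 0 ≤ i → i < p → f i ∈ free F R B
  free₂ : ∀ i, p + k ≤ i → i < g → f i ∈ free F R B
  free₃ : ∀ i, g + k ≤ i → i < a → f i ∈ free F R B
  inj : ∀ i j, 0 ≤ i → i < j → j < a → f i ≠ f j
  blocked : f a ∉ free F R B
  blocked' : f a ∉ R
  -- Prevents ℬ from occupying `f (g + k)` while answering beside a blue run of length `s` that
  -- begins at `f a`: either there is no such run, or the cell is too far from it.
  wall : (∀ m, IsLine m → Run B m (-s) 0 → m (-1) ≠ f a) ∨ p < a - g - k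

namespace Blocked

variable {F R B : Set G} {f : ℤ → G} {s k p g a : ℤ}

/-- The neighbour in the blue run of length `s` would be a free cell, a cell of the red far block,
or a cell of the blue block of length `k < s`, each of which is absurd. -/
theorem end_ne_inner (H : Blocked F R B f s k p g a) {m : ℤ → G} (hm : IsLine m)
    (hr : Run B m (-s) 0) {l : ℤ} (h1 : p + k ≤ l) (h2 : l < g) : m 0 ≠ f l := by
  intro e
  have hs := H.hs
  have hk := H.hk
  have hmB := hr.mem (-1) (by omega) (by omega)
  have key : ∀ j, p + k - 1 ≤ j → j ≤ g → m (-1) ≠ f j := by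
    intro j h3 h4 e'
    rw [e'] at hmB
    rcases eq_or_lt_of_le h3 with h5 | h5
    · have := Run.share H.line hm H.sep hr (i := j) (j := -1) (by omega) (by omega) (by omega)
        (by omega) e'
      omega
    rcases eq_or_lt_of_le h4 with h6 | h6
    · exact Set.disjoint_left.1 H.disj (h6 ▸ H.far.mem g le_rfl (by omega)) hmB
    · exact (mem_free.1 (H.free₂ j (by omega) h6)).2.2 hmB
  rcases hm.rel H.line e with h | h
  · exact key (l - 1) (by omega) (by omega) (by simpa [sub_eq_add_neg] using h (-1))
  · exact key (l + 1) (by omega) (by omega) (by simpa using h (-1))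

/-- Following `m` from `f (g + k)` back to its blue run leads, in one direction, to the red far
block and, in the other, through free cells up to `f a`, where `wall` applies. -/
theorem end_ne_outer (H : Blocked F R B f s k p g a) {m : ℤ → G} (hm : IsLine m)
    (hr : Run B m (-s) 0) {n i : ℤ} (hn : n ≤ p) (hi : 0 ≤ i) (hin : i < n)
    (hU : ∀ j, 0 ≤ j → j < n → m j ∈ free F R B) :
    m i ≠ f (g + k) := by
  intro e
  have hs := H.hs
  have hk := H.hk
  have hga := H.hga
  have hmB := hr.mem (-1) (by omega) (by omega)
  have hgR : f (g + k - 1) ∈ R := H.far.mem _ (by omega) (by omega)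
  rcases trap hm H.line hU (p := g + k - 1) (q := a) (fun hc => (mem_free.1 hc).2.1 hgR) H.blocked hi
    hin (by omega) hga e with ⟨h1, h2, h3⟩ | ⟨h1, h2, h3⟩
  · have h4 := h1 (-1 - i)
    rw [show i + (-1 - i) = -1 by ring, show g + k + (-1 - i) = g + k - 1 by omega] at h4
    exact Set.disjoint_left.1 H.disj hgR (h4 ▸ hmB)
  · have h4 := h1 (-1 - i)
    rw [show i + (-1 - i) = -1 by ring] at h4
    rcases eq_or_lt_of_le (show g + k - (-1 - i) ≤ a by omega) with h5 | h5
    · rcases H.wall with hw | hw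
      · exact hw m hm hr (h5 ▸ h4)
      · omega
    · exact (mem_free.1 (H.free₃ _ (by omega) h5)).2.2 (h4 ▸ hmB)

/-- The reduction to `AWins.finish` after further play: the new red cells `Z` stay in the inner arc
and the blue block is closed at `p - 1`, while the new blue cells keep off the cells still needed
and create no run of length `k`. -/
theorem finish_of (H : Blocked F R B f s k p g a) {R' B' : Set G} {Z : Set G} (hR' : R' = R ∪ Z)
    (hRB : B ⊆ B') (hZ : ∀ x ∈ Z, ∃ i, 0 ≤ i ∧ i < p ∧ f i = x)
    (hB : ∀ m, IsLine m → Run B' m (-k) 0 → Run B m (-k) 0)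
    (hcl : f (p - 1) ∈ R') (hin : ∀ i, p + k ≤ i → i < g → f i ∉ B') (hout : f (g + k) ∉ B') :
    AWins F 2 R' B' := by
  have hk := H.hk
  have hpg := H.hpg
  have hga := H.hga
  have hp := H.hp
  have hZn : ∀ i, p ≤ i → i < a → f i ∉ Z := by
    intro i h1 h2 hc
    obtain ⟨j, h3, h4, e⟩ := hZ _ hc
    exact H.inj j i h3 (by omega) h2 e
  have hZa : f a ∉ Z := by
    intro hc
    obtain ⟨j, h3, h4, e⟩ := hZ _ hc
    exact H.blocked (e ▸ H.free₁ j h3 h4)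
  have hnR : ∀ {x}, x ∉ R → x ∉ Z → x ∉ R' := by
    intro x h1 h2 hc
    rw [hR'] at hc
    exact hc.elim h1 h2
  have hsepB : ∀ i, p ≤ i → i < p + k → f i ∉ R := fun i h1 h2 hc =>
    Set.disjoint_left.1 H.disj hc (H.sep.mem i h1 h2)
  have hg1R : f (g - 1) ∉ R := H.far.left
  have houtR : f (g + k + 1) ∉ R ∧ f (g + k + 1) ∉ Z := by
    rcases eq_or_lt_of_le (show g + k + 1 ≤ a by omega) with h | h
    · rw [h]; exact ⟨H.blocked', hZa⟩
    · exact ⟨(mem_free.1 (H.free₃ _ (by omega) h)).2.1, hZn _ (by omega) h⟩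
  refine AWins.finish H.line hk hpg (p := p) ⟨by omega, fun i h1 h2 => ?_, ?_, ?_⟩ ?_
    (fun hc => (mem_free.1 hc).2.1 hcl) (hRB (H.sep.mem _ (by omega) (by omega))) ?_ ?_ ?_ ?_ ?_ ?_
  · rw [hR']; exact Or.inl (H.far.mem i h1 h2)
  · exact hnR hg1R (hZn _ (by omega) (by omega))
  · exact hnR H.far.right (hZn _ (by omega) (by omega))
  · intro m hm hr
    have := H.distinct.uniq f m p (-k) k H.line hm H.sep (by simpa using hB m hm hr)
    exact this
  · exact hnR (hsepB _ (by omega) (by omega)) (hZn _ (by omega) (by omega))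
  · intro i h1 h2
    have := mem_free.1 (H.free₂ i h1 h2)
    exact mem_free.2 ⟨this.1, hnR this.2.1 (hZn _ (by omega) (by omega)), hin i h1 h2⟩
  · have := mem_free.1 (H.free₃ (g + k) le_rfl hga)
    exact mem_free.2 ⟨this.1, hnR this.2.1 (hZn _ (by omega) (by omega)), hout⟩
  · exact hnR houtR.1 houtR.2
  · intro h e
    rcases eq_or_lt_of_le (show g + k + 1 ≤ a by omega) with h' | h'
    · exact H.blocked (by rw [← h', e]; exact H.free₂ _ le_rfl h)
    · exact H.inj (p + k) (g + k + 1) (by omega) (by omega) h' e.symm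
  · intro i j h1 h2 h3 h4
    exact H.inj i j (by omega) h2 (by omega)

end Blocked

end Opening

end SymGame

namespace SymGame

set_option linter.unusedSectionVars false

/-! ### The opening: a block at a chosen distance from a red run -/

section Opening

variable {G : Type*} [CommRing G] [Nontrivial G]

/-- After an extension of a run by one cell, shorter runs are unaffected. -/
theorem Run.of_extend {B : Set G} {f m : ℤ → G} (hf : IsLine f) (hm : IsLine m) {s u v : ℤ}
    (hs : 1 ≤ s) (hr : Run B m (-s) 0) (h1 : m 1 ∉ B) (h : Run (insert (m 0) B) f u v)
    (huv : v - u ≠ s + 1) : Run B f u v ∧ ∀ i, u ≤ i → i < v → f i ≠ m 0 := by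
  have hr' : Run (insert (m 0) B) m (-s) 1 := by
    refine ⟨by omega, fun i h2 h3 => ?_, ?_, ?_⟩
    · rcases eq_or_ne i 0 with rfl | h0
      · exact Or.inl rfl
      · exact Or.inr (hr.mem i h2 (by omega))
    · rintro (hc | hc)
      · have := hm.periodic hc (-s)
        rw [show -s + (0 - (-s - 1)) = 1 by ring] at this
        exact h1 (this ▸ hr.mem _ le_rfl (by omega))
      · exact hr.left hc
    · rintro (hc | hc)
      · have := hm.periodic hc.symm (-1)
        rw [show (-1 : ℤ) + (1 - 0) = 0 by ring] at this
        exact hr.right (this ▸ hr.mem _ (by omega) (by omega))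
      · exact h1 hc
  have hne : ∀ i, u ≤ i → i < v → f i ≠ m 0 := by
    intro i h2 h3 e
    have := Run.share hm hf hr' h (i := 0) (by omega) (by omega) h2 h3 e
    omega
  exact ⟨⟨h.lt, fun i h2 h3 => (h.mem i h2 h3).resolve_left (hne i h2 h3),
    fun hc => h.left (Or.inr hc), fun hc => h.right (Or.inr hc)⟩, hne⟩

/-- It suffices to close the blue block at `p - 1` and then use `finish_of`. Nothing is to be done
if `p = 0`. If `p = 1`, the closing cell extends the base run, so the answer adjoins a blue run of
length `s`. If `p ≥ 2`, the closing cell is isolated; unless it is answered in the inner arc, it is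
grown towards the base run. The resulting gap either is unmatched and wins, or shows that the new
blue block lies beside a blue run of length `s`, hence away from the cells that `finish_of` needs.
-/
theorem Blocked.win {F R B : Set G} {f : ℤ → G} {s k p g a φ : ℤ} {c d : ℕ}
    (H : Blocked F R B f s k p g a) (hφ : φ = d + 1) (hφk : φ + 2 ≤ k)
    (hW : ∀ h, (h = 1 ∨ 3 ≤ h) → h ≤ a → WinGap F (φ - 1) h c) : AWins F (c + d + 5) R B := by
  have hk := H.hk
  have hs := H.hs
  have hpg := H.hpg
  have hga := H.hga
  have hp := H.hp
  have hpR : f p ∉ R := fun hc => Set.disjoint_left.1 H.disj hc (H.sep.mem p le_rfl (by omega))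
  rcases eq_or_lt_of_le hp with h0 | h0
  · refine (H.finish_of (Z := ∅) (by simp) le_rfl (by simp) (fun _ _ h => h) ?_ ?_ ?_).mono (by omega)
    · rw [← h0]; exact H.base.mem _ (by omega) (by omega)
    · exact fun i h1 h2 => (mem_free.1 (H.free₂ i h1 h2)).2.2
    · exact (mem_free.1 (H.free₃ _ le_rfl hga)).2.2
  rcases eq_or_lt_of_le (show 1 ≤ p by omega) with h1 | h1
  · refine AWins.mono (k := 2 + 1) ⟨f 0, H.free₁ 0 le_rfl h0, fun b hb hne hr => ?_⟩ (by omega)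
    obtain ⟨m, hm, rfl, -, m1, m2, m3⟩ := hr s 0 (by omega) le_rfl
      ⟨f, H.line, rfl, fun i _ _ => by omega, by rw [zero_add, h1]; exact hpR,
        fun i h2 h3 => H.base.mem _ (by omega) (by omega), H.base.left⟩
    rw [zero_add] at m1
    have hrm : Run B m (-s) 0 := ⟨by omega, fun i h3 h4 => by
      simpa using m2 (-i) (by omega) (by omega), m3, (mem_free.1 hb).2.2⟩
    refine H.finish_of (Z := {f 0}) (by simp [Set.union_singleton]) (Set.subset_insert _ _) ?_
      (fun m' hm' hr' => (Run.of_extend hm' hm (by omega) hrm m1 hr' (by omega)).1) ?_ ?_ ?_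
    · rintro x rfl
      exact ⟨0, le_rfl, h0, rfl⟩
    · left; congr 1; omega
    · rintro i h2 h3 (hc | hc)
      · exact H.end_ne_inner hm hrm h2 h3 hc.symm
      · exact (mem_free.1 (H.free₂ i h2 h3)).2.2 hc
    · rintro (hc | hc)
      · exact H.end_ne_outer hm hrm (n := 1) (i := 0) (by omega) le_rfl one_pos
          (fun j h2 h3 => by rw [show j = 0 by omega]; exact hb) hc.symm
      · exact (mem_free.1 (H.free₃ _ le_rfl hga)).2.2 hc
  have hnb := H.line.not_mem_neighbors (i := p - 1) (X := R) (by simpa using hpR)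
    (mem_free.1 (H.free₁ (p - 1 - 1) (by omega) (by omega))).2.1
  refine AWins.mono (k := c + d + 2 + 1 + 1) (AWins.place (H.free₁ (p - 1) (by omega) (by omega))
    hnb.1 hnb.2 fun b hb hne hb1 hb2 => ?_) (by omega)
  by_cases hbl : b ∈ blk f 0 (p - 1)
  · obtain ⟨j, h2, h3, rfl⟩ := hbl
    refine (H.finish_of (Z := {f (p - 1)}) (by simp [Set.union_singleton]) (Set.subset_insert _ _) ?_
      (fun m' hm' hr' => hr'.of_insert hm' hb1 hb2 (by omega)) (Or.inl rfl) ?_ ?_).mono (by omega)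
    · rintro x rfl
      exact ⟨p - 1, by omega, by omega, rfl⟩
    · rintro i h4 h5 (hc | hc)
      · exact H.inj j i h2 (by omega) (by omega) hc.symm
      · exact (mem_free.1 (H.free₂ i h4 h5)).2.2 hc
    · rintro (hc | hc)
      · exact H.inj j _ h2 (by omega) hga hc.symm
      · exact (mem_free.1 (H.free₃ _ le_rfl hga)).2.2 hc
  -- The remaining gap `p - q` has to be `1` or at least `3`, and `q ≤ φ + 1 < k` keeps the block
  -- lengths distinct.
  obtain ⟨q, d', hq, hqp, hqφ, hgap⟩ : ∃ (q : ℤ) (d' : ℕ), q = d' + 1 ∧ q < p ∧ q ≤ φ + 1 ∧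
      ((q = φ ∧ 3 ≤ p - q) ∨ p - q = 1) := by
    by_cases h2 : φ + 3 ≤ p
    · exact ⟨φ, d, hφ, by omega, by omega, Or.inl ⟨rfl, by omega⟩⟩
    · exact ⟨p - 1, (p - 2).toNat, by omega, by omega, by omega, Or.inr (by ring)⟩
  have hline := H.line.flip (p - 1)
  have hnR : ∀ i, 0 ≤ i → i < p → f i ∉ R := fun i h2 h3 => (mem_free.1 (H.free₁ i h2 h3)).2.1
  have hbase : f (-1) ∈ R := H.base.mem _ (by omega) (by omega)
  have := AWins.grow_arc (F := F) (R := R) (B := B) hline (m := p) (e := b) (k := c + 2) hq hqp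
    (H.distinct.mono (by omega)) (fun i h2 h3 => H.free₁ _ (by omega) (by omega)) (by
      show f (p - 1 - p) ∉ _
      rw [show p - 1 - p = -1 by ring]
      exact fun hc => (mem_free.1 hc).2.1 hbase) (by
      show f (p - 1 - -1) ∉ _
      rwa [show p - 1 - -1 = p by ring]) hb ?_ hb1 hb2 ?_
  · rw [sub_zero] at this
    exact this.mono (by omega)
  · rintro ⟨i, h2, h3, rfl⟩
    rcases eq_or_ne i 0 with rfl | h4
    · exact hne (by simp)
    · exact hbl ⟨p - 1 - i, by omega, by omega, rfl⟩
  intro m₀ hm₀ hb' hmU hme hmf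
  have hD := (H.distinct.mono (show q ≤ k - 1 by omega)).union hm₀ hb'
  have hinjp : ∀ i j, 0 ≤ i → i < j → j ≤ p → f i ≠ f j := fun i j h2 h3 h4 =>
    H.inj i j h2 h3 (by omega)
  have hrun : Run (R ∪ blk (fun i => f (p - 1 - i)) 0 q) (fun i => f (p - 1 - i)) 0 q := by
    refine run_new (by omega) ?_ (hnR _ (by omega) (by omega)) (fun i h3 h4 => ?_)
      (fun i h3 h4 => (hinjp _ _ (by omega) (by omega) (by omega)).symm)
    · show f (p - 1 - -1) ∉ _
      rwa [show p - 1 - -1 = p by ring]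
    · exact hinjp _ _ (by omega) (by omega) (by omega)
  have hdis := disjoint_union_blk (u := 0) (v := q) (f := fun i => f (p - 1 - i)) H.disj
    (fun i h3 h4 => H.free₁ _ (by omega) (by omega)) hmU (fun i h3 h4 => hmf i h3 (by omega))
  have hnotR : ∀ i, 0 ≤ i → i < q → (fun i => f (p - 1 - i)) i ∉ R :=
    fun i h3 h4 => hnR _ (by omega) (by omega)
  by_cases hG : Gap (free F (R ∪ blk (fun i => f (p - 1 - i)) 0 q) (B ∪ blk m₀ 0 q))
      (B ∪ blk m₀ 0 q) s (p - q) q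
  · obtain ⟨m, hm, m1, m2, m3⟩ := hG
    have hrm : Run B m (-s) 0 := by
      rcases Run.of_union hm hm₀ hb' m1 with ⟨h, -⟩ | ⟨h, -⟩
      · exact h
      · omega
    have hbe := (hD.uniq m m₀ (p - q) 0 q hm hm₀ m3 (by rwa [zero_add])).blk_eq
    rw [zero_add, sub_add_cancel] at hbe
    have hmU' : ∀ j, 0 ≤ j → j < p → m j ∈ free F R B := by
      intro j h2 h3
      by_cases h4 : j < p - q
      · exact free_union_subset _ _ _ _ _ (m2 j h2 h4)
      · have : m j ∈ blk m₀ 0 q := hbe ▸ mem_blk (by omega) h3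
        obtain ⟨i, h5, h6, e⟩ := this
        exact e ▸ hmU i h5 h6
    refine (H.finish_of rfl Set.subset_union_left ?_ ?_ ?_ ?_ ?_).mono (by omega)
    · rintro x ⟨i, h2, h3, rfl⟩
      exact ⟨p - 1 - i, by omega, by omega, rfl⟩
    · intro m' hm' hr'
      rcases Run.of_union hm' hm₀ hb' hr' with ⟨h, -⟩ | ⟨h, -⟩
      · exact h
      · omega
    · exact Or.inr ⟨0, le_rfl, by omega, by simp⟩
    · rintro i h2 h3 (hc | hc)
      · exact (mem_free.1 (H.free₂ i h2 h3)).2.2 hc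
      · rw [hbe] at hc
        obtain ⟨j, h4, h5, e⟩ := hc
        obtain ⟨l, h6, h7, e'⟩ := trap_mem hm H.line hmU' (p := p + k - 1) (q := g)
          (fun h => (mem_free.1 h).2.2 (H.sep.mem _ (by omega) (by omega)))
          (fun h => (mem_free.1 h).2.1 (H.far.mem _ le_rfl (by omega))) (by omega) h5 (by omega)
          h3 e (k := 0) le_rfl h0
        exact H.end_ne_inner hm hrm (by omega) h7 e'
    · rintro (hc | hc)
      · exact (mem_free.1 (H.free₃ _ le_rfl hga)).2.2 hc
      · rw [hbe] at hc
        obtain ⟨j, h4, h5, e⟩ := hc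
        exact H.end_ne_outer hm hrm le_rfl (by omega) h5 hmU' e
  · have hred : Gap (free F (R ∪ blk (fun i => f (p - 1 - i)) 0 q) (B ∪ blk m₀ 0 q))
        (R ∪ blk (fun i => f (p - 1 - i)) 0 q) s (p - q) q := by
      refine ⟨f, H.line, Run.union H.line hline hrun hnotR H.base, fun i h3 h4 => ?_, ?_⟩
      · refine mem_free_union.2 ⟨H.free₁ i h3 (by omega), ?_, ?_⟩
        · rintro ⟨i', h5, h6, e⟩
          exact hinjp _ _ (by omega) (by omega) (by omega) e.symm
        · have := hmf (p - 1 - i) (by omega) (by omega)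
          simpa using this
      · have := hrun.flip (p - 1)
        convert this using 1
        · funext i; simp
        · ring
        · ring
    have hU : Unmatched F _ _ (q - 1) s (p - q) q :=
      ⟨hdis, hD, by omega, by omega, by omega, hred, hG⟩
    rcases hgap with ⟨h2, h3⟩ | h2
    · rw [h2] at hU ⊢
      exact (hW (p - φ) (Or.inr (by omega)) (by omega) _ _ _ _ hU).mono (by omega)
    · rw [h2] at hU
      exact (hU.join (by omega)).mono (by omega)

/-- The opening: in a free arc next to a red run the first player builds a block of size `k`
starting at distance `g`. Either he wins, or the answer is an exact copy. -/
theorem AWins.opening {F R B : Set G} {f : ℤ → G} {s k g a φ : ℤ} {c c' d d' : ℕ}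
    (hf : IsLine f) (hd : Disjoint R B) (hD : Distinct k B) (hx : Run R f (-s) 0)
    (harc : ∀ i, 0 ≤ i → i < a → f i ∈ free F R B) (ha : f a ∉ free F R B) (ha' : f a ∉ R)
    (hk : k = d + 1) (hφ : φ = d' + 1) (hφk : φ + 2 ≤ k) (hs : k < s) (hkg : k + 2 ≤ g)
    (hga : g + k < a) (hag : a ≤ 2 * g + 1)
    (hwall : (∀ m, IsLine m → Run B m (-s) 0 → m (-1) ≠ f a) ∨ 2 * g < a)
    (hW : ∀ h, (h = 1 ∨ 3 ≤ h) → h ≤ a → WinGap F (φ - 1) h c)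
    (hM : ∀ m, IsLine m → Run (B ∪ blk m 0 k) m 0 k → (∀ i, 0 ≤ i → i < k → m i ∈ free F R B) →
      (∀ i, 0 ≤ i → i < a → f i ∉ blk m 0 k) →
      Gap (free F (R ∪ blk (fun i => f (g + i)) 0 k) (B ∪ blk m 0 k)) (B ∪ blk m 0 k) s g k →
      AWins F c' (R ∪ blk (fun i => f (g + i)) 0 k) (B ∪ blk m 0 k)) :
    AWins F (c + c' + d + d' + 6) R B := by
  have hnR : ∀ i, 0 ≤ i → i < a → f i ∉ R := fun i h2 h3 => (mem_free.1 (harc i h2 h3)).2.1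
  have hbase : f (-1) ∈ R := hx.mem _ (by omega) (by omega)
  have hinj : ∀ i j, 0 ≤ i → i < j → j < a → f i ≠ f j := fun i j h3 h4 h5 =>
    hf.ne_of_lt harc ha h4 (by omega)
  have hf1 : f (-1) ∉ free F R B := fun hc => (mem_free.1 hc).2.1 hbase
  have hnb := hf.not_mem_neighbors (i := g) (hnR (g + 1) (by omega) (by omega))
    (hnR (g - 1) (by omega) (by omega))
  refine AWins.mono (k := c + c' + d' + 5 + d + 1) (AWins.place (harc g (by omega) (by omega))
    hnb.1 hnb.2 fun e he hne he1 he2 => ?_) (by omega)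
  -- An answer beyond the first cell makes 𝒜 grow his block back towards the base run instead of
  -- away from it.
  by_cases hright : e ∈ blk f (g + 1) a
  · obtain ⟨j, hj1, hj2, rfl⟩ := hright
    have := AWins.grow_arc (F := F) (R := R) (B := B) (f := fun i => f (g - i)) (hf.flip g)
      (m := g + 1) (e := f j) (k := c) hk (by omega) hD
      (fun i h3 h4 => harc _ (by omega) (by omega)) (by
        show f (g - (g + 1)) ∉ _
        rwa [show g - (g + 1) = -1 by ring]) (hnR _ (by omega) (by omega)) he ?_ he1 he2 ?_
    · simp only [sub_zero] at this
      exact this.mono (by omega)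
    · rintro ⟨i, h3, h4, e⟩
      exact hinj _ _ (by omega) (by omega) hj2 e
    · intro m hm hb hmU hme hmf
      have hD' := hD.union hm hb
      have hrun : Run (R ∪ blk (fun i => f (g - i)) 0 k) (fun i => f (g - i)) 0 k :=
        run_new (by omega) (hnR _ (by omega) (by omega)) (hnR _ (by omega) (by omega))
          (fun i h3 h4 => hinj _ _ (by omega) (by omega) (by omega))
          (fun i h3 h4 => (hinj _ _ (by omega) (by omega) (by omega)).symm)
      have hdis := disjoint_union_blk (u := 0) (v := k) (f := fun i => f (g - i)) hd
        (fun i h3 h4 => harc _ (by omega) (by omega)) hmU (fun i h3 h4 => hmf i h3 (by omega))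
      have hnotR : ∀ i, 0 ≤ i → i < k → (fun i => f (g - i)) i ∉ R :=
        fun i h3 h4 => hnR _ (by omega) (by omega)
      refine hW (g + 1 - k) (by omega) (by omega) _ _ s k
        ⟨hdis, hD'.mono (by omega), by omega, by omega, by omega, ?_, ?_⟩
      · refine ⟨f, hf, Run.union hf (hf.flip g) hrun hnotR hx, fun i h3 h4 => ?_, ?_⟩
        · refine mem_free_union.2 ⟨harc i h3 (by omega), ?_, ?_⟩
          · rintro ⟨i', h5, h6, e⟩
            exact hinj _ _ (by omega) (by omega) (by omega) e.symm
          · have := hmf (g - i) (by omega) (by omega)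
            simpa using this
        · have := hrun.flip g
          convert this using 1
          · funext i; simp
          · ring
          · ring
      · rintro ⟨n, hn, n1, n2, n3⟩
        have hbe := (hD'.uniq n m (g + 1 - k) 0 k hn hm n3 (by rwa [zero_add])).blk_eq
        rw [zero_add] at hbe
        have hgm : f g ∉ blk m 0 k := by simpa using hmf 0 le_rfl (by omega)
        rw [hbe] at hme hgm
        obtain ⟨i₀, h3, h4, e⟩ := hme
        -- A blue counterpart of gap and block consists of `g + 1` consecutive cells strictly
        -- between `f g` and `f a`, where `a ≤ 2 * g + 1` leaves at most `g` cells.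
        have := trap hn hf (u := 0) (v := g + 1) (X := {x | x ∈ free F R B ∧ x ≠ f g})
          (fun i h5 h6 => by
            by_cases h7 : i < g + 1 - k
            · refine ⟨free_union_subset _ _ _ _ _ (n2 i h5 h7), fun h8 => ?_⟩
              refine (mem_free_union.1 (n2 i h5 h7)).2.1 ⟨0, le_rfl, by omega, ?_⟩
              rw [h8]; simp
            · have h8 : n i ∈ blk n (g + 1 - k) (g + 1 - k + k) := mem_blk (by omega) (by omega)
              refine ⟨?_, fun h9 => hgm (h9 ▸ h8)⟩
              rw [← hbe] at h8
              obtain ⟨i', h9, h10, e'⟩ := h8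
              exact e' ▸ hmU i' h9 h10) (p := g) (q := a) (fun h => h.2 rfl) (fun h => ha h.1)
          (by omega) (by omega) (by omega) hj2 e
        omega
  · have := AWins.grow_arc (F := F) (R := R) (B := B) (f := fun i => f (g + i)) (hf.shift g)
      (m := a - g) (e := e) (k := c + c' + d' + 5) hk (by omega) hD
      (fun i h3 h4 => harc _ (by omega) (by omega)) (by
        show f (g + (a - g)) ∉ _
        rwa [show g + (a - g) = a by ring]) (hnR _ (by omega) (by omega)) he ?_ he1 he2 ?_
    · simpa using this
    · rintro ⟨i, h3, h4, rfl⟩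
      rcases eq_or_ne i 0 with rfl | h0
      · exact hne (by simp)
      · exact hright ⟨g + i, by omega, by omega, rfl⟩
    · intro m hm hb hmU hme hmf
      have hD' := hD.union hm hb
      have hrun : Run (R ∪ blk (fun i => f (g + i)) 0 k) (fun i => f (g + i)) 0 k :=
        run_new (by omega) (hnR _ (by omega) (by omega)) (hnR _ (by omega) (by omega))
          (fun i h3 h4 => (hinj _ _ (by omega) (by omega) (by omega)).symm)
          (fun i h3 h4 => hinj _ _ (by omega) (by omega) (by omega))
      have hdis := disjoint_union_blk (u := 0) (v := k) (f := fun i => f (g + i)) hd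
        (fun i h3 h4 => harc _ (by omega) (by omega)) hmU (fun i h3 h4 => hmf i h3 (by omega))
      have hnotR : ∀ i, 0 ≤ i → i < k → (fun i => f (g + i)) i ∉ R :=
        fun i h3 h4 => hnR _ (by omega) (by omega)
      have hbase' := Run.union hf (hf.shift g) hrun hnotR hx
      have hmout : ∀ i, g ≤ i → i < a → f i ∉ blk m 0 k := fun i h3 h4 => by
        simpa using hmf (i - g) (by omega) (by omega)
      have hX : ∀ i, 0 ≤ i → i < k → m i ∈ {x | x ∈ free F R B ∧ x ≠ f g} := fun i h3 h4 =>
        ⟨hmU i h3 h4, fun h5 => hmout g le_rfl (by omega) ⟨i, h3, h4, h5⟩⟩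
      have hrun' : Run (R ∪ blk (fun i => f (g + i)) 0 k) f g (g + k) := by
        have := hrun.shift (-g)
        convert this using 1
        · funext i; simp
        · ring
        · ring
      have hfree' : ∀ i, 0 ≤ i → i < a → (i < g ∨ g + k ≤ i) → f i ∉ blk m 0 k →
          f i ∈ free F (R ∪ blk (fun i => f (g + i)) 0 k) (B ∪ blk m 0 k) := by
        intro i h3 h4 h5 h6
        refine mem_free_union.2 ⟨harc i h3 h4, ?_, h6⟩
        rintro ⟨i', h7, h8, e⟩
        rcases h5 with h5 | h5
        · exact hinj i (g + i') h3 (by omega) (by omega) e.symm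
        · exact hinj (g + i') i (by omega) (by omega) h4 e
      -- The blue block may stand between the base run and the new red block, so that the red gap is
      -- not free: the situation of `Blocked`.
      by_cases hblock : e ∈ blk f 0 g
      · obtain ⟨j, hj1, hj2, rfl⟩ := hblock
        obtain ⟨i₀, h3, h4, e'⟩ := hme
        obtain ⟨p, hp0, hpg, hal⟩ : ∃ p, 0 ≤ p ∧ p + k ≤ g ∧ Aligned f p m 0 k := by
          rcases trap hm hf hX (p := -1) (q := g) (fun h => hf1 h.1) (fun h => h.2 rfl) h3 h4
            (by omega) hj2 e' with ⟨h5, h6, h7⟩ | ⟨h5, h6, h7⟩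
          · refine ⟨j - i₀, by omega, by omega, Or.inl fun i => ?_⟩
            rw [show 0 + i = i₀ + (i - i₀) by ring, h5]; congr 1; ring
          · refine ⟨j - (k - 1 - i₀), by omega, by omega, Or.inr fun i => ?_⟩
            rw [show 0 + i = i₀ + (i - i₀) by ring, h5]; congr 1; ring
        have hbe := hal.blk_eq
        rw [zero_add] at hbe
        have hoff : ∀ i, 0 ≤ i → i < a → (i < p ∨ p + k ≤ i) → f i ∉ blk m 0 k := by
          intro i h5 h6 h7 hc
          rw [hbe] at hc
          obtain ⟨i', h8, h9, e⟩ := hc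
          rcases h7 with h7 | h7
          · exact hinj i i' h5 (by omega) (by omega) e.symm
          · exact hinj i' i (by omega) (by omega) h6 e
        have hsep : Run (B ∪ blk m 0 k) f p (p + k) := by
          refine ⟨by omega, fun i h5 h6 => Or.inr (hbe ▸ mem_blk h5 h6), ?_, ?_⟩
          · rcases hal with h | h
            · rw [show f (p - 1) = m (0 - 1) by
                have := h (-1); rw [show (0 : ℤ) - 1 = 0 + -1 by ring, this]; congr 1]
              exact hb.left
            · rw [show f (p - 1) = m k by
                have := h k; rw [zero_add] at this; rw [this]; congr 1; ring]
              exact hb.right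
          · rcases hal with h | h
            · rw [show f (p + k) = m k by have := h k; rw [zero_add] at this; rw [this]]
              exact hb.right
            · rw [show f (p + k) = m (0 - 1) by
                have := h (-1); rw [show (0 : ℤ) - 1 = 0 + -1 by ring, this]; congr 1; ring]
              exact hb.left
        refine (Blocked.win (φ := φ) (c := c) (d := d') (s := s) (k := k) (p := p) (g := g) (a := a)
          (f := f) ⟨hf, hdis, hD', hbase', hrun', hsep, by omega, hs, hp0, hpg, hga, ?_, ?_, ?_,
            hinj, ?_, ?_, ?_⟩ hφ hφk hW).mono (by omega)
        · exact fun i h5 h6 => hfree' i h5 (by omega) (Or.inl (by omega))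
            (hoff i h5 (by omega) (Or.inl h6))
        · exact fun i h5 h6 => hfree' i (by omega) (by omega) (Or.inl h6)
            (hoff i (by omega) (by omega) (Or.inr h5))
        · exact fun i h5 h6 => hfree' i (by omega) h6 (Or.inr h5) (hmout i (by omega) h6)
        · exact fun hc => ha (free_union_subset _ _ _ _ _ hc)
        · rintro (hc | ⟨i', h7, h8, e⟩)
          · exact ha' hc
          · exact ha (e ▸ harc (g + i') (by omega) (by omega))
        · rcases hwall with hw | hw
          · left
            intro n hn hr
            rcases Run.of_union hn hm hb hr with ⟨h, -⟩ | ⟨h, -⟩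
            · exact hw n hn h
            · omega
          · right; omega
      · have hmin : ∀ i, 0 ≤ i → i < g → f i ∉ blk m 0 k := by
          rintro i h3 h4 ⟨i', h5, h6, e'⟩
          obtain ⟨i₀, h7, h8, rfl⟩ := hme
          obtain ⟨l, h9, h10, h11⟩ := trap_mem hm hf hX (p := -1) (q := g) (fun h => hf1 h.1)
            (fun h => h.2 rfl) h5 h6 (by omega) h4 e' h7 h8
          exact hblock ⟨l, by omega, h10, h11.symm⟩
        -- The red gap is free; either ℬ has made an exact copy, or the gap is unmatched.
        by_cases hG : Gap (free F (R ∪ blk (fun i => f (g + i)) 0 k) (B ∪ blk m 0 k))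
            (B ∪ blk m 0 k) s g k
        · refine (hM m hm hb hmU (fun i h3 h4 => ?_) hG).mono (by omega)
          by_cases h5 : i < g
          · exact hmin i h3 h5
          · exact hmout i (by omega) h4
        · refine (hW g (by omega) (by omega) _ _ s k ⟨hdis, hD'.mono (by omega), by omega, by omega,
            by omega, ⟨f, hf, hbase', fun i h3 h4 => ?_, hrun'⟩, hG⟩).mono (by omega)
          exact hfree' i h3 (by omega) (Or.inl h4) (hmin i h3 h4)

end Opening

end SymGame

namespace SymGame

set_option linter.unusedSectionVars false

/-! ### Defeating the exact copy when the counterpart has less room -/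

section Tight

variable {G : Type*} [CommRing G] [Nontrivial G]

/-- The first player extends a matched block outwards, where the counterpart is closed. -/
theorem AWins.unmatch {F R B : Set G} {f m : ℤ → G} {s k g a σ : ℤ} {c : ℕ}
    (hf : IsLine f) (hd : Disjoint R B) (hD : Distinct (k + 1) B) (hx : Run R f (-s) 0)
    (harc : ∀ i, 0 ≤ i → i < a → f i ∈ free F R B) (ha : f a ∉ free F R B) (ha' : f a ∉ R)
    (hk : 1 ≤ k) (hs : k + 1 < s) (hg : 1 ≤ g) (hga : g + k + 1 = a) (hσ : σ ≤ k)
    (hW : WinGap F σ g c)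
    (hclosed : ∀ l, IsLine l → Run B l (-s) 0 → ∃ i, 0 ≤ i ∧ i < a ∧ l i ∉ free F R B)
    (hm : IsLine m) (hb : Run (B ∪ blk m 0 k) m 0 k) (hmU : ∀ i, 0 ≤ i → i < k → m i ∈ free F R B)
    (hmf : ∀ i, 0 ≤ i → i < a → f i ∉ blk m 0 k)
    (hG : Gap (free F (R ∪ blk (fun i => f (g + i)) 0 k) (B ∪ blk m 0 k)) (B ∪ blk m 0 k) s g k) :
    AWins F (c + 1) (R ∪ blk (fun i => f (g + i)) 0 k) (B ∪ blk m 0 k) := by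
  obtain ⟨l, hl, l1, l2, l3⟩ := hG
  have hnR : ∀ i, 0 ≤ i → i ≤ a → f i ∉ R := fun i h1 h2 => by
    rcases eq_or_lt_of_le h2 with rfl | h2
    · exact ha'
    · exact (mem_free.1 (harc i h1 h2)).2.1
  have hinj : ∀ i j, 0 ≤ i → i < j → j ≤ a → f i ≠ f j := fun i j h1 h2 h3 =>
    hf.ne_of_lt harc ha h2 (by omega)
  have hl0 : Run B l (-s) 0 := by
    rcases Run.of_union hl hm hb l1 with ⟨h, -⟩ | ⟨h, -⟩
    · exact h
    · omega
  have hD' := (hD.mono (show k ≤ k + 1 by omega)).union hm hb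
  have hbe := (hD'.uniq l m g 0 k hl hm l3 (by rwa [zero_add])).blk_eq
  rw [zero_add] at hbe
  -- The obstruction promised by `hclosed` is among the first `a = g + k + 1` cells along `l`, of
  -- which the first `g + k` are the gap and the block of the copy, all free before the block was
  -- built.
  have hlend : l (g + k) ∉ free F R B := by
    obtain ⟨i, h1, h2, h3⟩ := hclosed l hl hl0
    rcases lt_or_ge i g with h4 | h4
    · exact (h3 (free_union_subset _ _ _ _ _ (l2 i h1 h4))).elim
    rcases lt_or_ge i (g + k) with h5 | h5
    · have : l i ∈ blk m 0 k := hbe ▸ mem_blk h4 h5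
      obtain ⟨j, h6, h7, e⟩ := this
      exact (h3 (e ▸ hmU j h6 h7)).elim
    · rwa [show g + k = i by omega]
  set y : ℤ → G := fun i => f (g + i) with hy
  have hyl : IsLine y := hf.shift g
  have hrun : Run (R ∪ blk y 0 (k + 1)) y 0 (k + 1) :=
    run_new (by omega) (hnR _ (by omega) (by omega)) (hnR _ (by omega) (by omega))
      (fun i h1 h2 => (hinj _ _ (by omega) (by omega) (by omega)).symm)
      (fun i h1 h2 => hinj _ _ (by omega) (by omega) (by omega))
  have hyblk : ∀ i, 0 ≤ i → i ≤ a → (i < g ∨ g + k ≤ i) → f i ∉ blk y 0 k := by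
    rintro i h1 h2 h3 ⟨j, h4, h5, e⟩
    rcases h3 with h3 | h3
    · exact hinj i (g + j) h1 (by omega) (by omega) e.symm
    · exact hinj (g + j) i (by omega) (by omega) h2 e
  have hyR : ∀ i, 0 ≤ i → i ≤ a → (i < g ∨ g + k ≤ i) → f i ∉ R ∪ blk y 0 k := fun i h1 h2 h3 hc =>
    hc.elim (hnR i h1 h2) (hyblk i h1 h2 h3)
  have hfree : y k ∈ free F (R ∪ blk y 0 k) (B ∪ blk m 0 k) :=
    mem_free_union.2 ⟨harc _ (by omega) (by omega), hyblk _ (by omega) (by omega) (Or.inr le_rfl),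
      hmf _ (by omega) (by omega)⟩
  refine ⟨y k, hfree, fun b hbU hne hr => ?_⟩
  obtain ⟨n, hn, rfl, -, n1, n2, n3⟩ := hr k 0 (by omega) le_rfl ⟨fun i => f (g + k + i), hf.shift _,
    by simp [hy], fun i _ _ => by omega, hyR _ (by omega) (by omega) (Or.inr (by omega)),
    fun i h1 h2 => Or.inr ⟨k - i, by omega, by omega, by simp only [hy]; congr 1; ring⟩, by
      show f (g + k + (-k - 1)) ∉ _
      rw [show g + k + (-k - 1) = g - 1 by ring]
      exact hyR _ (by omega) (by omega) (Or.inl (by omega))⟩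
  have hnB := (mem_free.1 hbU).2.2
  have hrn : Run (B ∪ blk m 0 k) n (-k) 0 :=
    ⟨by omega, fun i h1 h2 => by simpa using n2 (-i) (by omega) (by omega), n3, hnB⟩
  -- The outer end of the copy being unavailable, ℬ must extend it inwards, which shortens his gap
  -- to `g - 1`.
  have hnl : ∀ i, n (-k + i) = l (g + k - 1 - i) := by
    rcases hD'.uniq l n g (-k) k hl hn l3 (by simpa using hrn) with h | h
    · have := h k
      rw [neg_add_cancel] at this
      exact (hlend (this ▸ free_union_subset _ _ _ _ _ hbU)).elim
    · exact h
  set z : ℤ → G := fun i => n (-k + i) with hz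
  have hzl : IsLine z := hn.shift (-k)
  have hzk : z k = n 0 := by simp [hz]
  have hzm : blk z 0 k = blk m 0 k := by
    rw [hbe]
    have : Aligned l g z 0 k := Or.inr fun i => by rw [zero_add]; exact hnl i
    simpa using this.blk_eq
  have hB2 : insert (n 0) (B ∪ blk m 0 k) = B ∪ blk z 0 (k + 1) := by
    rw [← hzm, ← hzk, union_insert_blk _ _ (by omega)]
  have hn1 : n 1 ∉ B ∪ blk m 0 k := by simpa using n1
  have hrz : Run (B ∪ blk z 0 (k + 1)) z 0 (k + 1) := by
    rw [← hB2]
    refine ⟨by omega, fun i h1 h2 => ?_, ?_, ?_⟩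
    · rcases eq_or_ne i k with rfl | h3
      · exact Or.inl hzk
      · exact Or.inr (hrn.mem _ (by omega) (by omega))
    · rw [show z (0 - 1) = n (-k - 1) by simp only [hz]; congr 1]
      rintro (hc | hc)
      · have := hn.periodic hc (-k)
        rw [show -k + (0 - (-k - 1)) = 1 by ring] at this
        exact hn1 (this ▸ hrn.mem _ le_rfl (by omega))
      · exact n3 hc
    · rw [show z (k + 1) = n 1 by simp only [hz]; congr 1; ring]
      rintro (hc | hc)
      · have := hn.periodic hc.symm (-1)
        rw [show (-1 : ℤ) + (1 - 0) = 0 by ring] at this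
        exact hnB (this ▸ hrn.mem _ (by omega) (by omega))
      · exact hn1 hc
  have hzU : ∀ i, 0 ≤ i → i < k + 1 → z i ∈ free F R B := by
    intro i h1 h2
    rcases eq_or_ne i k with rfl | h3
    · rw [hzk]; exact free_union_subset _ _ _ _ _ hbU
    · have : z i ∈ blk m 0 k := hzm ▸ mem_blk h1 (by omega)
      obtain ⟨j, h4, h5, e⟩ := this
      exact e ▸ hmU j h4 h5
  have hn0 : n 0 = l (g - 1) := by
    rw [← hzk]
    exact (hnl k).trans (by congr 1; ring)
  have hlg : l g ∈ blk m 0 k := hbe ▸ mem_blk le_rfl (by omega)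
  have hnf : ∀ i, 0 ≤ i → i < g → f i ≠ n 0 := by
    intro i h1 h2 e
    rw [hn0] at e
    have hbad : ∀ j, -1 ≤ j → j ≤ g → l g ≠ f j := by
      intro j h3 h4 e'
      rcases eq_or_lt_of_le h3 with rfl | h3
      · obtain ⟨j, h6, h7, e''⟩ := hlg
        rw [e'] at e''
        exact (mem_free.1 (hmU j h6 h7)).2.1 (e'' ▸ hx.mem _ (by omega) (by omega))
      · exact hmf j (by omega) (by omega) (e' ▸ hlg)
    rcases hl.rel hf e.symm with h | h
    · exact hbad (i + 1) (by omega) (by omega) (by rw [← h]; congr 1; ring)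
    · exact hbad (i - 1) (by omega) (by omega) (by rw [← h]; congr 1; ring)
  have hzf : ∀ i, 0 ≤ i → i < a → f i ≠ n 0 → f i ∉ blk z 0 (k + 1) := by
    intro i h1 h2 h3 hc
    rw [blk_succ _ (by omega), hzk, hzm] at hc
    exact hc.elim h3 (hmf i h1 h2)
  rw [union_insert_blk _ _ (by omega), hB2]
  refine hW _ _ s (k + 1) ⟨disjoint_union_blk hd (fun i h1 h2 => harc _ (by omega) (by omega)) hzU
    fun i h1 h2 => hzf _ (by omega) (by omega) ?_, (hD.union hzl hrz).mono (by omega), by omega, by omega,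
    by omega, ⟨f, hf, Run.union hf hyl hrun (fun i h1 h2 => hnR _ (by omega) (by omega)) hx,
      fun i h1 h2 => ?_, ?_⟩, ?_⟩
  · rcases eq_or_ne i k with rfl | h3
    · exact hne.symm
    · intro e
      exact (mem_free.1 hbU).2.1 (e ▸ Or.inr (mem_blk h1 (by omega)))
  · refine mem_free_union.2 ⟨harc i h1 (by omega), ?_, hzf i h1 (by omega) (hnf i h1 h2)⟩
    rintro ⟨j, h4, h5, e⟩
    exact hinj i (g + j) h1 (by omega) (by omega) e.symm
  · have := hrun.shift (-g)
    convert this using 1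
    · funext i; simp [hy]
    · ring
    · ring
  -- On its outer side the blue block is followed at once by a cell that is not free, and on its
  -- inner side a blue cell comes after `g - 1` free ones; neither side offers `g` free cells.
  · rintro ⟨u, hu, u1, u2, u3⟩
    have hpos := (hl0.mem (-1) (by omega) (by omega))
    rcases (hD.union hzl hrz).uniq u z g 0 (k + 1) hu hzl u3 (by rwa [zero_add]) with h | h
    · have h1 := h (-1)
      rw [zero_add, show z (-1) = l (g + k) from (hnl (-1)).trans (by congr 1; ring)] at h1
      exact hlend (h1 ▸ free_union_subset _ _ _ _ _ (u2 (g + -1) (by omega) (by omega)))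
    · have h1 := h (g + k)
      rw [zero_add, show z (g + k) = l (-1) from (hnl (g + k)).trans (by congr 1; ring),
        show g + (k + 1) - 1 - (g + k) = 0 by ring] at h1
      exact (mem_free.1 (u2 0 le_rfl (by omega))).2.2 (h1 ▸ Or.inl hpos)

/-- The opening in an arc whose length exceeds that of every free arc next to the counterpart of the
base run. -/
theorem AWins.opening_of_closed {F R B : Set G} {f : ℤ → G} {s k a φ : ℤ} {c d d' : ℕ}
    (hf : IsLine f) (hd : Disjoint R B) (hD : Distinct (k + 1) B) (hx : Run R f (-s) 0)
    (harc : ∀ i, 0 ≤ i → i < a → f i ∈ free F R B) (ha : f a ∉ free F R B) (ha' : f a ∉ R)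
    (hk : k = d + 1) (hφ : φ = d' + 1) (hφk : φ + 2 ≤ k) (hs : k + 1 < s) (hka : 2 * k + 3 ≤ a)
    (hwall : ∀ m, IsLine m → Run B m (-s) 0 → m (-1) ≠ f a)
    (hW : ∀ h, (h = 1 ∨ 3 ≤ h) → h ≤ a → WinGap F (φ - 1) h c)
    (hclosed : ∀ l, IsLine l → Run B l (-s) 0 → ∃ i, 0 ≤ i ∧ i < a ∧ l i ∉ free F R B) :
    AWins F (c + (c + 1) + d + d' + 6) R B :=
  -- The distance `a - 1 - k` leaves exactly one free cell beyond the block, reserved for the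
  -- extension in `AWins.unmatch`.
  AWins.opening hf hd (hD.mono (by omega)) hx harc ha ha' hk hφ hφk (by omega)
    (g := a - 1 - k) (by omega) (by omega) (by omega) (Or.inl hwall) hW
    fun _ hm hb hmU hmf hG => AWins.unmatch hf hd hD hx harc ha ha' (by omega) hs (by omega) (by ring)
      (by omega) (hW _ (by omega) (by omega)) hclosed hm hb hmU hmf hG

end Tight

end SymGame

namespace SymGame

set_option linter.unusedSectionVars false

/-! ### The first player's win on the path -/

section PathBoard

/-- The first player wins on a symmetric integer interval after the first answer has been given on one
side of the centre. -/
theorem awins_interval_aux {F : Set ℤ} {f : ℤ → ℤ} (hf : IsLine f) (hinj : Function.Injective f) {N : ℤ}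
    (hF : ∀ i, f i ∈ F ↔ -N ≤ i ∧ i ≤ N) (hsurj : Function.Surjective f) {I : ℕ}
    (hI : N ≤ 13 * 2 ^ I) (hN : 3 * I + 26 ≤ N) {j : ℤ} (hj : 1 ≤ j) (hjN : j ≤ N) :
    AWins F (2 * (I + 3) ^ 2 + 3 * I + 25) (insert (f 0) ∅) (insert (f (-j)) ∅) := by
  have hfr : ∀ x, x ∈ free F ∅ ∅ ↔ x ∈ F := fun x => by simp [mem_free]
  -- The halving lemma at level `I` needs block sizes above `I + 4`, hence `φ = I + 5`; then `φ + 2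
  -- ≤ k` and `k + 1 < s` give `k = I + 7` and `s = I + 9`.
  have := AWins.grow_arc (F := F) (R := ∅) (B := ∅) (f := f) hf (q := I + 9) (m := N + 1) (d := I + 8)
    (e := f (-j)) (k := 2 * (I + 3) ^ 2 + 2 * I + 17) (by push_cast; ring) (by omega) (distinct_empty _)
    (fun i h1 h2 => (hfr _).2 ((hF i).2 (by omega)))
    (fun hc => by have := (hF _).1 ((hfr _).1 hc); omega) (by simp)
    ((hfr _).2 ((hF _).2 (by omega))) ?_ (by simp) (by simp) ?_
  · exact this.mono (by omega)
  · rintro ⟨i, h1, h2, e⟩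
    have := hinj e
    omega
  intro g hg hb hgU _ hgf
  simp only [hfr] at hgU
  have hB : ∀ x ∈ (∅ ∪ blk g 0 (I + 9) : Set ℤ), ∃ p, 1 ≤ p ∧ p ≤ N ∧ x = f (-p) := by
    rintro x (hx | hx)
    · exact hx.elim
    obtain ⟨p, rfl⟩ := hsurj x
    have h1 : f p ∈ F := by
      obtain ⟨i, h1, h2, e⟩ := hx
      exact e ▸ hgU i h1 h2
    rw [hF] at h1
    refine ⟨-p, ?_, by omega, by simp⟩
    by_contra h2
    exact hgf p (by omega) (by omega) hx
  have hR : ∀ i, 0 ≤ i → i < (I : ℤ) + 9 → f i ∈ (∅ ∪ blk f 0 (I + 9) : Set ℤ) :=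
    fun i h1 h2 => Or.inr (mem_blk h1 h2)
  have hnR : ∀ i, i < 0 ∨ (I : ℤ) + 9 ≤ i → f i ∉ (∅ ∪ blk f 0 (I + 9) : Set ℤ) := by
    rintro i hi (hc | ⟨i', h1, h2, e⟩)
    · exact hc
    · have := hinj e
      omega
  refine (AWins.opening_of_closed (f := fun i => f (I + 9 + i)) (s := I + 9) (k := I + 7)
    (a := N + 1 - (I + 9)) (φ := I + 5) (c := (I + 3) ^ 2) (d := I + 6) (d' := I + 4) (hf.shift _)
    (disjoint_union_blk (F := F) disjoint_bot_left (fun i h1 h2 => (hfr _).2 ((hF i).2 (by omega)))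
      (fun i h1 h2 => (hfr _).2 (hgU i h1 h2)) fun i h1 h2 => hgf i h1 (by omega))
    (((distinct_empty _).union hg hb).mono (by omega)) ⟨by omega, fun i h1 h2 => hR _ (by omega) (by omega),
      hnR _ (by omega), hnR _ (by omega)⟩ ?_ ?_ (hnR _ (by omega)) (by push_cast; ring) (by push_cast; ring)
      (by omega) (by omega) (by omega) ?_ ?_ ?_).mono (by omega)
  · intro i h1 h2
    refine mem_free_union.2 ⟨(hfr _).2 ((hF _).2 (by omega)), ?_, hgf _ (by omega) (by omega)⟩
    exact fun hc => hnR (I + 9 + i) (by omega) (Or.inr hc)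
  · intro hc
    have := (hF _).1 (mem_free.1 hc).1
    omega
  · intro m hm hr e
    obtain ⟨p, h1, h2, h3⟩ := hB _ (hr.mem (-1) (by omega) (by omega))
    have := hinj (e.symm.trans h3)
    omega
  · intro h h1 h2
    have := winGap_halving F I h1 (by omega)
    exact this.mono (by omega) le_rfl
  -- The blue run of `I + 9` cells lies in the half of `N` cells opposite to the red one. Towards
  -- the centre one meets the red cell `f 0`, outwards one leaves the board, in either case after
  -- fewer than `a` cells.
  · intro l hl hr
    obtain ⟨p, h1, h2, h3⟩ := hB _ (hr.mem (-1) (by omega) (by omega))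
    obtain ⟨p', h4, h5, h6⟩ := hB _ (hr.mem (-(I + 9)) le_rfl (by omega))
    rcases hl.rel hf h3 with h | h
    · have e := h (1 - (I + 9))
      rw [show -1 + (1 - ((I : ℤ) + 9)) = -(I + 9) by ring, h6] at e
      have := hinj e
      refine ⟨p - 1, by omega, by omega, fun hc => (mem_free.1 hc).2.1 ?_⟩
      have e2 := h p
      rw [show -1 + p = p - 1 by ring, neg_add_cancel] at e2
      rw [e2]
      exact hR 0 le_rfl (by omega)
    · have e := h (1 - (I + 9))
      rw [show -1 + (1 - ((I : ℤ) + 9)) = -(I + 9) by ring, h6] at e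
      have := hinj e
      refine ⟨N - p, by omega, by omega, fun hc => ?_⟩
      have e2 := h (N - p + 1)
      rw [show -1 + (N - p + 1) = N - p by ring] at e2
      rw [e2] at hc
      have := (hF _).1 (mem_free.1 hc).1
      omega

/-- The first player wins on an interval of `2 N + 1` cells. -/
theorem awins_interval {N : ℤ} {I : ℕ} (hI : N ≤ 13 * 2 ^ I) (hN : 3 * I + 26 ≤ N) :
    AWins (Set.Ico 0 (2 * N + 1)) (2 * (I + 3) ^ 2 + 3 * I + 26) ∅ ∅ := by
  refine AWins.place (e := N) (k := 2 * (I + 3) ^ 2 + 3 * I + 25)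
    (by simp only [mem_free, Set.mem_Ico]; simp; omega) (by simp) (by simp) fun e he hne _ _ => ?_
  have h1 : 0 ≤ e ∧ e < 2 * N + 1 := (mem_free.1 he).1
  rcases lt_or_gt_of_ne hne with h | h
  · have := awins_interval_aux (F := Set.Ico 0 (2 * N + 1)) (f := fun i => N + i) (N := N)
      (by simpa using isLine_add N)
      (fun i j h => by simpa using h) (fun i => by rw [Set.mem_Ico]; omega)
      (fun i => ⟨i - N, by simp⟩) hI hN (j := N - e) (by omega) (by omega)
    simpa using this
  · have := awins_interval_aux (F := Set.Ico 0 (2 * N + 1)) (f := fun i => N - i) (N := N)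
      (by simpa using isLine_sub N)
      (fun i j h => by simpa using h) (fun i => by rw [Set.mem_Ico]; omega)
      (fun i => ⟨N - i, by simp⟩) hI hN (j := e - N) (by omega) (by omega)
    simpa using this

end PathBoard

end SymGame

namespace SymGame

set_option linter.unusedSectionVars false

/-! ### Odd arcs between a red run and its mirror image -/

section Mirror

variable {G : Type*} [CommRing G] [Nontrivial G]

/-- A short arc of odd length between a red run and its mirror image: the first player extends his run
into the arc. -/
theorem AWins.squeeze {F : Set G} {f : ℤ → G} (hf : IsLine f) {g : ℕ} : ∀ {R B : Set G} {j s : ℤ},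
    1 ≤ s → Run R f (j - s) j → (∀ i, j ≤ i → i ≤ j + 2 * g → f i ∈ free F R B) →
    Run B f (j + 2 * g + 1) (j + 2 * g + 1 + s) → f (j + 2 * g + 1) ∉ R →
    f (j + 2 * g + 1 + s + 1) ∈ B →
    (∀ m u v, IsLine m → Run B m u v → s ≤ v - u → v - u = s ∧ Aligned f (j + 2 * g + 1) m u s) →
    AWins F (g + 1) R B := by
  induction g with
  | zero =>
    intro R B j s hs hx harc hy hyR hyy hB
    simp only [Nat.cast_zero, mul_zero, add_zero] at harc hy hyR hyy hB
    refine ⟨f j, harc j le_rfl le_rfl, fun b hb hne hr => ?_⟩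
    obtain ⟨m, hm, rfl, -, m1, m2, m3⟩ := hr s 0 (by omega) le_rfl ⟨fun i => f (j + i), hf.shift j,
      by simp, fun i _ _ => by omega, by simpa using hyR,
      fun i h1 h2 => hx.mem _ (by omega) (by omega), by
        show f (j + (-s - 1)) ∉ R
        rw [show j + (-s - 1) = j - s - 1 by ring]; exact hx.left⟩
    have hrm : Run B m (-s) 0 := ⟨by omega, fun i h3 h4 => by
      simpa using m2 (-i) (by omega) (by omega), m3, (mem_free.1 hb).2.2⟩
    -- At its far end the mirror run is separated by one cell from another blue cell, so an
    -- extension there would also join. Hence ℬ must extend into the arc, and here the only cell of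
    -- the arc has just been taken.
    rcases (hB m _ _ hm hrm (by omega)).2 with h | h
    · have := h (s + 1)
      rw [show -s + (s + 1) = 0 + 1 by ring, show j + 1 + (s + 1) = j + 1 + s + 1 by ring] at this
      exact (m1 (this ▸ hyy)).elim
    · have := h s
      rw [neg_add_cancel, show j + 1 + s - 1 - s = j by ring] at this
      exact (hne this).elim
  | succ g ih =>
    intro R B j s hs hx harc hy hyR hyy hB
    push_cast at harc hy hyR hyy hB
    have hnR : ∀ i, j ≤ i → i ≤ j + 2 * (g + 1) → f i ∉ R := fun i h1 h2 =>
      (mem_free.1 (harc i h1 h2)).2.1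
    have hyB : f (j + 2 * (g + 1) + 1) ∉ free F R B := fun hc =>
      (mem_free.1 hc).2.2 (hy.mem _ le_rfl (by omega))
    have hinj : ∀ i i', j ≤ i → i < i' → i' ≤ j + 2 * (g + 1) → f i ≠ f i' := fun i i' h1 h2 h3 =>
      hf.ne_of_lt (X := free F R B) (u := j) (v := j + 2 * (g + 1) + 1)
        (fun i h1 h2 => harc i h1 (by omega)) hyB h2 (by omega)
    refine ⟨f j, harc j le_rfl (by omega), fun b hb hne hr => ?_⟩
    obtain ⟨m, hm, rfl, -, m1, m2, m3⟩ := hr s 0 (by omega) le_rfl ⟨fun i => f (j + i), hf.shift j,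
      by simp, fun i _ _ => by omega, hnR _ (by omega) (by omega),
      fun i h1 h2 => hx.mem _ (by omega) (by omega), by
        show f (j + (-s - 1)) ∉ R
        rw [show j + (-s - 1) = j - s - 1 by ring]; exact hx.left⟩
    rw [zero_add] at m1
    have hrm : Run B m (-s) 0 := ⟨by omega, fun i h3 h4 => by
      simpa using m2 (-i) (by omega) (by omega), m3, (mem_free.1 hb).2.2⟩
    have hal : ∀ i, m i = f (j + 2 * (g + 1) - i) := by
      rcases (hB m _ _ hm hrm (by omega)).2 with h | h
      · have := h (s + 1)
        rw [show -s + (s + 1) = 1 by ring,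
          show j + 2 * ((g : ℤ) + 1) + 1 + (s + 1) = j + 2 * (g + 1) + 1 + s + 1 by ring] at this
        exact (m1 (this ▸ hyy)).elim
      · intro i
        have := h (s + i)
        rw [show -s + (s + i) = i by ring] at this
        rw [this]; congr 1; ring
    have hm0 : m 0 = f (j + 2 * (g + 1)) := by simpa using hal 0
    have hrun' : Run (insert (m 0) B) f (j + 2 * (g + 1)) (j + 2 * (g + 1) + 1 + s) := by
      refine ⟨by omega, fun i h1 h2 => ?_, ?_, ?_⟩
      · rcases eq_or_lt_of_le h1 with h3 | h3
        · left; rw [hm0, h3]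
        · exact Or.inr (hy.mem i (by omega) h2)
      · rintro (hc | hc)
        · rw [hm0] at hc
          exact hinj _ _ (by omega) (by omega) (by omega) hc
        · exact (mem_free.1 (harc (j + 2 * (g + 1) - 1) (by omega) (by omega))).2.2 hc
      · rintro (hc | hc)
        · rw [hm0] at hc
          have h2 := hal (-1 - s)
          rw [show j + 2 * ((g : ℤ) + 1) - (-1 - s) = j + 2 * (g + 1) + 1 + s by ring, hc, ← hm0] at h2
          have h3 := hm.periodic h2 (-s)
          rw [show -s + (0 - (-1 - s)) = 1 by ring] at h3
          exact m1 (h3 ▸ hrm.mem _ le_rfl (by omega))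
        · exact hy.right hc
    have := ih (R := insert (f j) R) (B := insert (m 0) B) (j := j + 1) (s := s + 1) (by omega)
      ⟨by omega, fun i h1 h2 => ?_, ?_, ?_⟩ ?_ ?_ ?_ ?_ ?_
    · exact this
    · rcases eq_or_ne i j with rfl | h3
      · exact Or.inl rfl
      · exact Or.inr (hx.mem i (by omega) (by omega))
    · rw [show j + 1 - (s + 1) - 1 = j - s - 1 by ring]
      rintro (hc | hc)
      · have := hf.periodic hc (j - s)
        rw [show j - s + (j - (j - s - 1)) = j + 1 by ring] at this
        exact hnR (j + 1) (by omega) (by omega) (this ▸ hx.mem _ le_rfl (by omega))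
      · exact hx.left hc
    · rintro (hc | hc)
      · exact hinj j (j + 1) le_rfl (by omega) (by omega) hc.symm
      · exact hnR (j + 1) (by omega) (by omega) hc
    · intro i h1 h2
      have := mem_free.1 (harc i (by omega) (by omega))
      refine mem_free.2 ⟨this.1, ?_, ?_⟩
      · rintro (hc | hc)
        · exact hinj j i le_rfl (by omega) (by omega) hc.symm
        · exact this.2.1 hc
      · rintro (hc | hc)
        · exact hinj i _ (by omega) (by omega) le_rfl (hc.trans hm0)
        · exact this.2.2 hc
    · convert hrun' using 1 <;> ring
    · rw [show j + 1 + 2 * (g : ℤ) + 1 = j + 2 * (g + 1) by ring]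
      rintro (hc | hc)
      · exact hinj j _ le_rfl (by omega) le_rfl hc.symm
      · exact hnR _ (by omega) le_rfl hc
    · rw [show j + 1 + 2 * (g : ℤ) + 1 + (s + 1) + 1 = j + 2 * (g + 1) + 1 + s + 1 by ring]
      exact Or.inr hyy
    · intro l u v hl hr hsv
      have hex : ∃ i, u ≤ i ∧ i < v ∧ l i = m 0 := by
        by_contra hc
        push Not at hc
        have := hB l u v hl ⟨hr.lt, fun i h1 h2 => (hr.mem i h1 h2).resolve_left (hc i h1 h2),
          fun h => hr.left (Or.inr h), fun h => hr.right (Or.inr h)⟩ (by omega)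
        omega
      obtain ⟨i, h1, h2, e⟩ := hex
      have := Run.share hf hl hrun' hr (i := j + 2 * (g + 1)) le_rfl (by omega) h1 h2 (e.trans hm0)
      rw [show j + 2 * ((g : ℤ) + 1) + 1 + s - (j + 2 * (g + 1)) = s + 1 by ring] at this
      rwa [show j + 1 + 2 * (g : ℤ) + 1 = j + 2 * (g + 1) by ring]

/-- The opening in the middle of a long arc of odd length between a red run and its mirror image. -/
theorem AWins.opening_odd {F R B : Set G} {f : ℤ → G} {s k g φ : ℤ} {c d d' : ℕ}
    (hf : IsLine f) (hd : Disjoint R B) (hD : Distinct k B) (hx : Run R f (-s) 0)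
    (harc : ∀ i, 0 ≤ i → i < 2 * g + 1 → f i ∈ free F R B) (hy : Run B f (2 * g + 1) (2 * g + 1 + s))
    (hyy : f (2 * g + 1 + s + 1) ∈ B)
    (hk : k = d + 1) (hφ : φ = d' + 1) (hφk : φ + 2 ≤ k) (hs : k < s) (hkg : k + 2 ≤ g)
    (hW : ∀ h, (h = 1 ∨ 3 ≤ h) → h ≤ 2 * g + 1 → WinGap F (φ - 1) h c) :
    AWins F (c + d + d' + 6) R B := by
  have hyB := hy.mem _ le_rfl (by omega)
  refine AWins.mono (AWins.opening hf hd hD hx harc (fun hc => (mem_free.1 hc).2.2 hyB)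
    (fun hc => Set.disjoint_left.1 hd hc hyB) hk hφ hφk hs hkg (by omega) le_rfl (Or.inr (by omega)) hW
    (c' := 0) ?_) (by omega)
  rintro m hm hb hmU hmf ⟨l, hl, l1, l2, l3⟩
  have hl0 : Run B l (-s) 0 := by
    rcases Run.of_union hl hm hb l1 with ⟨h, -⟩ | ⟨h, -⟩
    · exact h
    · omega
  rcases hD.uniq f l (2 * g + 1) (-s) s hf hl hy (by simpa using hl0) with h | h
  · have := h (s + 1)
    rw [show -s + (s + 1) = 1 by ring, show 2 * g + 1 + (s + 1) = 2 * g + 1 + s + 1 by ring] at this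
    exact ((mem_free.1 (l2 1 (by omega) (by omega))).2.2 (Or.inl (this ▸ hyy))).elim
  -- The reflected copy of the block would begin at the centre `f g` of the arc, which is the first
  -- cell of the red block.
  · have := h (s + g)
    rw [show -s + (s + g) = g by ring, show 2 * g + 1 + s - 1 - (s + g) = g by ring] at this
    have h1 := l3.mem g le_rfl (by omega)
    rw [this] at h1
    rcases h1 with h1 | h1
    · exact ((mem_free.1 (harc g (by omega) (by omega))).2.2 h1).elim
    · exact (hmf g (by omega) (by omega) h1).elim

end Mirror

end SymGame

namespace SymGame

set_option linter.unusedSectionVars false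

/-! ### Two pairs of runs on the cycle -/

section CycleBoard

variable {n : ℕ}

theorem IsLine.eq_iff {f : ℤ → ZMod n} (hf : IsLine f) {i j : ℤ} : f i = f j ↔ (n : ℤ) ∣ i - j := by
  obtain ⟨c, δ, hδ, hc⟩ := hf
  rw [hc, hc, ← ZMod.intCast_zmod_eq_zero_iff_dvd (i - j) n]
  push_cast
  rcases hδ with rfl | rfl
  · constructor <;> intro h <;> linear_combination h
  · constructor <;> intro h <;> linear_combination -h

theorem IsLine.add_period {f : ℤ → ZMod n} (hf : IsLine f) (i : ℤ) : f (i + n) = f i :=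
  hf.eq_iff.2 (by simp)

theorem IsLine.inj_of_lt {f : ℤ → ZMod n} (hf : IsLine f) {i j : ℤ} (h : f i = f j) (hi : 0 ≤ i) (hi' : i < n)
    (hj : 0 ≤ j) (hj' : j < n) : i = j := by
  obtain ⟨t, ht⟩ := hf.eq_iff.1 h
  have h1 : t < 1 := by
    by_contra hc
    nlinarith
  have h2 : -1 < t := by
    by_contra hc
    nlinarith
  rw [show t = 0 by omega] at ht
  omega

theorem IsLine.mem_blk_iff {f : ℤ → ZMod n} (hf : IsLine f) {i u v : ℤ} (hi : 0 ≤ i) (hi' : i < n)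
    (hu : 0 ≤ u) (hv : v ≤ n) : f i ∈ blk f u v ↔ u ≤ i ∧ i < v := by
  constructor
  · rintro ⟨j, h1, h2, e⟩
    have := hf.inj_of_lt e (by omega) (by omega) hi hi'
    omega
  · rintro ⟨h1, h2⟩
    exact mem_blk h1 h2

theorem IsLine.exists_index [NeZero n] {f : ℤ → ZMod n} (hf : IsLine f) (x : ZMod n) :
    ∃ i : ℤ, 0 ≤ i ∧ i < n ∧ f i = x := by
  have hn : (0 : ℤ) < n := by exact_mod_cast Nat.pos_of_ne_zero (NeZero.ne n)
  obtain ⟨c, δ, hδ, hc⟩ := hf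
  -- Since `δ * δ = 1`, multiplication by `δ` solves `c + i * δ = x`.
  refine ⟨(((x - c) * δ).val : ℤ), by positivity, by exact_mod_cast ZMod.val_lt _, ?_⟩
  rw [hc]
  rw [Int.cast_natCast, ZMod.natCast_zmod_val]
  rcases hδ with rfl | rfl <;> ring

/-- The red runs `[0, P)` and `[P + 1, P + 1 + Q)` and the blue runs `[u, u + P')` and
`[u + P' + 1, u + P' + 1 + Q')` on a cycle. -/
structure Config (R B : Set (ZMod n)) (f : ℤ → ZMod n) (P Q u P' Q' : ℤ) : Prop where
  line : IsLine f
  hP : 1 ≤ P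
  hQ : 1 ≤ Q
  hP' : 1 ≤ P'
  hQ' : 1 ≤ Q'
  sum : P + Q = P' + Q'
  le : P + 1 + Q ≤ u
  le' : u + P' + 1 + Q' ≤ n
  red : ∀ i : ℤ, 0 ≤ i → i < n → (f i ∈ R ↔ i < P ∨ (P < i ∧ i < P + 1 + Q))
  blue : ∀ i : ℤ, 0 ≤ i → i < n →
    (f i ∈ B ↔ (u ≤ i ∧ i < u + P') ∨ (u + P' < i ∧ i < u + P' + 1 + Q'))

namespace Config

variable {R B : Set (ZMod n)} {f : ℤ → ZMod n} {P Q u P' Q' : ℤ}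

/-- Reversing the cycle about the red pair interchanges the two long arcs, so that statements about
one arc apply to the other. -/
theorem flip (H : Config R B f P Q u P' Q') :
    Config R B (fun i => f (P + Q - i)) Q P (n - u) Q' P' := by
  obtain ⟨hf, hP, hQ, hP', hQ', hs, hl, hl', hr, hb⟩ := H
  have key : ∀ i : ℤ, 0 ≤ i → i < n → ∃ j : ℤ, 0 ≤ j ∧ j < n ∧ f (P + Q - i) = f j ∧
      (j = P + Q - i ∨ j = P + Q - i + n) := by
    intro i h1 h2
    by_cases h : i ≤ P + Q
    · exact ⟨_, by omega, by omega, rfl, Or.inl rfl⟩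
    · exact ⟨P + Q - i + n, by omega, by omega, (hf.add_period _).symm, Or.inr rfl⟩
  refine ⟨hf.flip _, hQ, hP, hQ', hP', by omega, by omega, by omega, fun i h1 h2 => ?_,
    fun i h1 h2 => ?_⟩ <;> obtain ⟨j, h3, h4, e, h5⟩ := key i h1 h2
  · rw [e, hr j h3 h4]; omega
  · rw [e, hb j h3 h4]; omega

theorem disjoint [NeZero n] (H : Config R B f P Q u P' Q') : Disjoint R B := by
  rw [Set.disjoint_left]
  intro x hR hB
  obtain ⟨i, h1, h2, rfl⟩ := H.line.exists_index x
  rw [H.red i h1 h2] at hR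
  rw [H.blue i h1 h2] at hB
  have := H.le
  have := H.hP
  have := H.hQ
  have := H.hP'
  omega

theorem mem_free (H : Config R B f P Q u P' Q') {i : ℤ} (h1 : P + 1 + Q ≤ i) (h2 : i < u) :
    f i ∈ free Set.univ R B := by
  have := H.le
  have := H.le'
  have := H.hP
  have := H.hQ
  have := H.hP'
  have := H.hQ'
  rw [SymGame.mem_free, H.red i (by omega) (by omega), H.blue i (by omega) (by omega)]
  exact ⟨trivial, by omega, by omega⟩

theorem run_red (H : Config R B f P Q u P' Q') :
    Run R (fun i => f (P + 1 + Q + i)) (-Q) 0 := by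
  have := H.le
  have := H.le'
  have := H.hP
  have := H.hQ
  have := H.hP'
  have := H.hQ'
  refine ⟨by omega, fun i h1 h2 => ?_, ?_, ?_⟩
  · exact (H.red _ (by omega) (by omega)).2 (by omega)
  · exact fun h => by have := (H.red _ (by omega) (by omega)).1 h; omega
  · exact fun h => by have := (H.red _ (by omega) (by omega)).1 h; omega

theorem run_blue_left (H : Config R B f P Q u P' Q') : Run B f u (u + P') := by
  have := H.le
  have := H.le'
  have := H.hP
  have := H.hQ
  have := H.hP'
  have := H.hQ'
  refine ⟨by omega, fun i h1 h2 => ?_, ?_, ?_⟩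
  · exact (H.blue _ (by omega) (by omega)).2 (by omega)
  · exact fun h => by have := (H.blue _ (by omega) (by omega)).1 h; omega
  · exact fun h => by have := (H.blue _ (by omega) (by omega)).1 h; omega

theorem run_blue_right (H : Config R B f P Q u P' Q') : Run B f (u + P' + 1) (u + P' + 1 + Q') := by
  have := H.le
  have := H.le'
  have := H.hP
  have := H.hQ
  have := H.hP'
  have := H.hQ'
  refine ⟨by omega, fun i h1 h2 => ?_, ?_, ?_⟩
  · exact (H.blue _ (by omega) (by omega)).2 (by omega)
  · exact fun h => by have := (H.blue _ (by omega) (by omega)).1 h; omega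
  · rcases eq_or_lt_of_le H.le' with h1 | h1
    · rw [h1, show (n : ℤ) = 0 + n by ring, H.line.add_period]
      exact fun h => by have := (H.blue _ (by omega) (by omega)).1 h; omega
    · exact fun h => by have := (H.blue _ (by omega) (by omega)).1 h; omega

/-- A run of `B` is one of the two blue runs. -/
theorem aligned [NeZero n] (H : Config R B f P Q u P' Q') {m : ℤ → ZMod n} (hm : IsLine m) {a b : ℤ}
    (hr : Run B m a b) : (b - a = P' ∧ Aligned f u m a P') ∨
      (b - a = Q' ∧ Aligned f (u + P' + 1) m a Q') := by
  obtain ⟨i, h1, h2, e⟩ := H.line.exists_index (m a)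
  have hB := hr.mem a le_rfl hr.lt
  rw [← e, H.blue i h1 h2] at hB
  rcases hB with ⟨h3, h4⟩ | ⟨h3, h4⟩
  · left
    have := Run.share H.line hm H.run_blue_left hr h3 h4 le_rfl hr.lt e.symm
    simpa using this
  · right
    have := Run.share H.line hm H.run_blue_right hr (by omega) h4 le_rfl hr.lt e.symm
    simpa using this

variable [NeZero n] [Nontrivial (ZMod n)]

/-- The blue pair of runs is a translate of the red pair, and the arc from the second red run to the
first blue run is longer than the opposite one. -/
theorem win_translate {k φ : ℤ} {c d d' : ℕ} (H : Config R B f P Q u P Q) (hD : Distinct (k + 1) B)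
    (hPQ : P ≠ Q) (hk : k = d + 1) (hφ : φ = d' + 1) (hφk : φ + 2 ≤ k) (hs : k + 1 < Q)
    (hlt : n < 2 * u) (hka : 2 * k + 3 ≤ u - (P + 1 + Q))
    (hW : ∀ h : ℤ, (h = 1 ∨ 3 ≤ h) → h ≤ n → WinGap (Set.univ : Set (ZMod n)) (φ - 1) h c) :
    AWins Set.univ (c + (c + 1) + d + d' + 6) R B := by
  have h1 := H.le
  have h2 := H.le'
  have h3 := H.hP
  have h4 := H.hQ
  have huB : f u ∈ B := (H.blue u (by omega) (by omega)).2 (by omega)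
  have key : ∀ m, IsLine m → Run B m (-Q) 0 → Aligned f (u + P + 1) m (-Q) Q := by
    intro m hm hr
    rcases H.aligned hm hr with h | h
    · omega
    · exact h.2
  refine AWins.opening_of_closed (a := u - (P + 1 + Q)) (H.line.shift (P + 1 + Q)) H.disjoint hD
    H.run_red (fun i h1 h2 => H.mem_free (by omega) (by omega)) ?_ ?_ hk hφ hφk hs hka ?_
    (fun h h1 h2 => hW h h1 (by omega)) ?_
  · rw [add_sub_cancel]
    exact fun h => (SymGame.mem_free.1 h).2.2 huB
  · rw [add_sub_cancel]
    exact fun h => Set.disjoint_left.1 H.disjoint h huB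
  · intro m hm hr e
    rw [add_sub_cancel] at e
    have := Run.share H.line hm H.run_blue_left hr (i := u) (j := -1) le_rfl (by omega) (by omega)
      (by omega) e
    omega
  · intro l hl hr
    -- Outwards the counterpart of the second red run has `n - (u + P + 1 + Q)` free cells, fewer
    -- than the arc in use because `n < 2 * u`; inwards it has only the hole of one cell.
    rcases key l hl hr with h | h
    · refine ⟨n - (u + P + 1 + Q), by omega, by omega, fun hc => (SymGame.mem_free.1 hc).2.1 ?_⟩
      have := h (Q + (n - (u + P + 1 + Q)))
      rw [show -Q + (Q + (n - (u + P + 1 + Q))) = n - (u + P + 1 + Q) by ring,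
        show u + P + 1 + (Q + (n - (u + P + 1 + Q))) = 0 + n by ring, H.line.add_period] at this
      rw [this]
      exact (H.red 0 le_rfl (by omega)).2 (by omega)
    · refine ⟨1, by omega, by omega, fun hc => (SymGame.mem_free.1 hc).2.2 ?_⟩
      have := h (Q + 1)
      rw [show -Q + (Q + 1) = 1 by ring, show u + P + 1 + Q - 1 - (Q + 1) = u + P - 1 by ring] at this
      rw [this]
      exact (H.blue _ (by omega) (by omega)).2 (by omega)

/-- The blue pair of runs is a mirror image of the red pair, and the arc between the second red run and
the first blue run has odd length. -/
theorem win_mirror {k φ : ℤ} {c d d' : ℕ} (H : Config R B f P Q u Q P) (hD : Distinct k B)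
    (hk : k = d + 1) (hφ : φ = d' + 1) (hφk : φ + 2 ≤ k) (hs : k < Q)
    {g : ℕ} (hg : u - (P + 1 + Q) = 2 * g + 1) (hkg : P < Q ∨ k + 2 ≤ g)
    (hW : ∀ h : ℤ, (h = 1 ∨ 3 ≤ h) → h ≤ n → WinGap (Set.univ : Set (ZMod n)) (φ - 1) h c) :
    AWins Set.univ (c + d + d' + 6) R B := by
  have h1 := H.le
  have h2 := H.le'
  have h3 := H.hP
  have h4 := H.hQ
  have hyy : f (u + Q + 1) ∈ B := (H.blue _ (by omega) (by omega)).2 (by omega)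
  have hy : Run B (fun i => f (P + 1 + Q + i)) (2 * g + 1) (2 * g + 1 + Q) := by
    have := H.run_blue_left.shift (P + 1 + Q)
    convert this using 1 <;> omega
  have hu : P + 1 + Q + (2 * g + 1) = u := by omega
  -- A long arc allows the central opening. A short one is squeezed, which needs `P < Q` so that a
  -- blue run of length at least `Q` is unique.
  by_cases hkg' : k + 2 ≤ g
  · refine AWins.opening_odd (g := g) (H.line.shift (P + 1 + Q)) H.disjoint hD H.run_red
      (fun i h1 h2 => H.mem_free (by omega) (by omega)) hy ?_ hk hφ hφk hs hkg'
      (fun h h1 h2 => hW h h1 (by omega))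
    show f (P + 1 + Q + (2 * g + 1 + Q + 1)) ∈ B
    rwa [show P + 1 + Q + (2 * g + 1 + Q + 1) = u + Q + 1 by omega]
  · have hPQ : P < Q := by omega
    refine (AWins.squeeze (F := Set.univ) (H.line.shift (P + 1 + Q)) (g := g) (j := 0) (s := Q) (R := R)
      (B := B) (by omega) (by simpa using H.run_red) (fun i h1 h2 => H.mem_free (by omega) (by omega))
      (by simpa using hy) ?_ ?_ ?_).mono (by omega)
    · show f (P + 1 + Q + (0 + 2 * g + 1)) ∉ R
      rw [show P + 1 + Q + (0 + 2 * (g : ℤ) + 1) = u by omega]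
      exact fun h => Set.disjoint_left.1 H.disjoint h ((H.blue u (by omega) (by omega)).2 (by omega))
    · show f (P + 1 + Q + (0 + 2 * g + 1 + Q + 1)) ∈ B
      rwa [show P + 1 + Q + (0 + 2 * (g : ℤ) + 1 + Q + 1) = u + Q + 1 by omega]
    · intro m a b hm hr hab
      rcases H.aligned hm hr with ⟨h5, h⟩ | ⟨h5, -⟩
      · refine ⟨h5, ?_⟩
        rcases h with h | h
        · left
          intro i
          rw [h i]; congr 1; omega
        · right
          intro i
          rw [h i]; congr 1; omega
      · omega

end Config

end CycleBoard

end SymGame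

namespace SymGame

set_option linter.unusedSectionVars false

/-! ### The first player's win on the cycle -/

section CyclePlay

/-- Allows a blue block known only up to reparametrisation to be written as an interval of the
reference line `f`, once it is caught between two cells outside `X`. -/
theorem exists_aligned {G : Type*} [CommRing G] {f g : ℤ → G} (hf : IsLine f) (hg : IsLine g) {X : Set G}
    {q p r t : ℤ} (hX : ∀ i, 0 ≤ i → i < q → g i ∈ X) (hp : f p ∉ X) (hr : f r ∉ X) (hpt : p < t)
    (htr : t < r) (ht : f t ∈ blk g 0 q) :
    ∃ u, p < u ∧ u + q ≤ r ∧ u ≤ t ∧ t < u + q ∧ Aligned f u g 0 q := by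
  obtain ⟨i, h1, h2, e⟩ := ht
  rcases trap hg hf hX hp hr h1 h2 hpt htr e with ⟨h, h3, h4⟩ | ⟨h, h3, h4⟩
  · refine ⟨t - i, by omega, by omega, by omega, by omega, Or.inl fun l => ?_⟩
    rw [show 0 + l = i + (l - i) by ring, h]; congr 1; ring
  · refine ⟨t - (q - 1 - i), by omega, by omega, by omega, by omega, Or.inr fun l => ?_⟩
    rw [show 0 + l = i + (l - i) by ring, h]; congr 1; ring

/-- The possible positions of a block at distance one from a run. -/
theorem Gap.one_cases {G : Type*} [CommRing G] {U B : Set G} {f z : ℤ → G} (hf : IsLine f)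
    (hz : IsLine z) {σ τ u s t : ℤ} (hB : Distinct σ B) (hr : Run B f u (u + s))
    (hb : Run (B ∪ blk z 0 t) z 0 t) (hD : Distinct τ (B ∪ blk z 0 t)) (hst : s ≠ t)
    (hG : Gap U (B ∪ blk z 0 t) s 1 t) :
    (f (u + s) ∈ U ∧ blk z 0 t = blk f (u + s + 1) (u + s + 1 + t)) ∨
      (f (u - 1) ∈ U ∧ blk z 0 t = blk f (u - 1 - t) (u - 1)) := by
  obtain ⟨l, hl, l1, l2, l3⟩ := hG
  have hbe := (hD.uniq l z 1 0 t hl hz l3 (by rwa [zero_add])).blk_eq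
  rw [zero_add] at hbe
  have h0 := l2 0 le_rfl one_pos
  have hl0 : Run B l (-s) (-s + s) := by
    rw [neg_add_cancel]
    rcases Run.of_union hl hz hb l1 with ⟨h, -⟩ | ⟨h, -⟩
    · exact h
    · omega
  rcases hB.uniq f l u (-s) s hf hl hr hl0 with h | h
  · left
    have e : l = fun i => f (u + s + i) := by
      funext i
      have := h (s + i)
      rw [show -s + (s + i) = i by ring] at this
      rw [this]; congr 1; ring
    rw [hbe]
    rw [e] at h0
    refine ⟨by simpa using h0, ?_⟩
    rw [e, blk_shift]; congr 1; ring
  · right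
    have e : l = fun i => f (u - 1 - i) := by
      funext i
      have := h (s + i)
      rw [show -s + (s + i) = i by ring] at this
      rw [this]; congr 1; ring
    rw [hbe]
    rw [e] at h0
    refine ⟨by simpa using h0, ?_⟩
    rw [e, blk_flip]; congr 1 <;> ring

variable {n : ℕ} [NeZero n] [Nontrivial (ZMod n)]

/-- The first player wins on an odd cycle once both players have built one run of the same size. -/
theorem awins_cycle_of_runs {f : ℤ → ZMod n} (hf : IsLine f) {I : ℕ} {K u : ℤ} (hn : Odd n)
    (hI : (n : ℤ) ≤ 13 * 2 ^ I) (hK : K = I + 10) (hKu : 10 * (I : ℤ) + 100 ≤ u) (hun : u + K ≤ n)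
    (hD : Distinct (K - 1) (blk f u (u + K))) :
    AWins Set.univ (2 * (I + 3) ^ 2 + 3 * I + 26) (blk f 0 K) (blk f u (u + K)) := by
  set R := blk f 0 K with hRdef
  set B := blk f u (u + K) with hBdef
  have hR : ∀ i : ℤ, 0 ≤ i → i < n → (f i ∈ R ↔ i < K) := fun i h1 h2 => by
    rw [hf.mem_blk_iff h1 h2 le_rfl (by omega)]; omega
  have hB : ∀ i : ℤ, 0 ≤ i → i < n → (f i ∈ B ↔ u ≤ i ∧ i < u + K) := fun i h1 h2 =>
    hf.mem_blk_iff h1 h2 (by omega) (by omega)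
  have hfree : ∀ i : ℤ, K ≤ i → i < u → f i ∈ free Set.univ R B := fun i h1 h2 => by
    rw [mem_free, hR i (by omega) (by omega), hB i (by omega) (by omega)]
    exact ⟨trivial, by omega, by omega⟩
  have hnfR : ∀ i : ℤ, 0 ≤ i → i < K → f i ∉ free Set.univ R B := fun i h1 h2 hc =>
    (mem_free.1 hc).2.1 ((hR i h1 (by omega)).2 h2)
  have hnfB : ∀ i : ℤ, u ≤ i → i < u + K → f i ∉ free Set.univ R B := fun i h1 h2 hc =>
    (mem_free.1 hc).2.2 ((hB i (by omega) (by omega)).2 ⟨h1, h2⟩)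
  have hfn : f n = f 0 := by simpa using hf.add_period 0
  have hdisj : Disjoint R B := by
    rw [Set.disjoint_left]
    rintro x ⟨i, h1, h2, rfl⟩ h
    rw [hB i h1 (by omega)] at h
    omega
  have hrunB : Run B f u (u + K) := by
    refine ⟨by omega, fun i h1 h2 => mem_blk h1 h2, ?_, ?_⟩
    · rw [hB _ (by omega) (by omega)]; omega
    · rcases eq_or_lt_of_le hun with h | h
      · rw [h, hfn, hB _ le_rfl (by omega)]; omega
      · rw [hB _ (by omega) (by omega)]; omega
  have hinj : ∀ i j : ℤ, 0 ≤ i → i < j → j < n → f i ≠ f j := fun i j h1 h2 h3 e => by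
    have := hf.inj_of_lt e h1 (by omega) (by omega) h3
    omega
  -- The second red block leaves the hole `f K` next to the first one.
  set y : ℤ → ZMod n := fun i => f (K + 1 + i) with hy
  have hyl : IsLine y := hf.shift _
  have hy0 : y 0 = f (K + 1) := by simp [hy]
  have hyrun : ∀ t, 1 ≤ t → t ≤ K → Run (R ∪ blk y 0 t) y 0 t := by
    intro t h1 h2
    refine run_new (by omega) ?_ ?_ ?_ ?_
    · exact (mem_free.1 (hfree _ (by omega) (by omega))).2.1
    · exact (mem_free.1 (hfree _ (by omega) (by omega))).2.1
    · exact fun i h3 h4 => (hinj _ _ (by omega) (by omega) (by omega)).symm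
    · exact fun i h3 h4 => hinj _ _ (by omega) (by omega) (by omega)
  have hjoin : ∀ t z, 1 ≤ t → t ≤ K - 1 → IsLine z → Run (B ∪ blk z 0 t) z 0 t →
      (∀ i, 0 ≤ i → i < t → z i ∈ free Set.univ R B) → (∀ i, 0 ≤ i → i ≤ t → f (K + i) ∉ blk z 0 t) →
      ¬ Gap (free Set.univ (R ∪ blk y 0 t) (B ∪ blk z 0 t)) (B ∪ blk z 0 t) K 1 t →
      AWins Set.univ 1 (R ∪ blk y 0 t) (B ∪ blk z 0 t) := by
    intro t z h1 h2 hz hb hzU hzf hG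
    refine Unmatched.join (σ := t - 1) (s := K) (t := t) (by omega)
      ⟨disjoint_union_blk hdisj (fun i h3 h4 => hfree _ (by omega) (by omega)) hzU fun i h3 h4 => ?_,
        (hD.mono (by omega)).union hz hb, by omega, by omega, by omega,
        ⟨fun i => f (K + i), hf.shift _, ?_, fun i h3 h4 => ?_, ?_⟩, hG⟩
    · have := hzf (1 + i) (by omega) (by omega)
      rwa [← add_assoc] at this
    · refine Run.union (hf.shift _) hyl (hyrun t h1 (by omega))
        (fun i h3 h4 => (mem_free.1 (hfree _ (by omega) (by omega))).2.1) ⟨by omega,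
          fun i h3 h4 => mem_blk (by omega) (by omega), ?_,
          (mem_free.1 (hfree (K + 0) (by omega) (by omega))).2.1⟩
      show f (K + (-K - 1)) ∉ R
      rw [show K + (-K - 1) = -1 by ring, ← hf.add_period, hR _ (by omega) (by omega)]
      omega
    · rw [show i = 0 by omega]
      refine mem_free_union.2 ⟨hfree _ (by omega) (by omega), ?_, hzf 0 le_rfl (by omega)⟩
      rintro ⟨j, h5, h6, e⟩
      exact hinj _ _ (by omega) (by omega) (by omega) e.symm
    · have := (hyrun t h1 (by omega)).shift (-1)
      convert this using 1
      · funext i; simp only [hy]; congr 1; ring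
      · ring
      · ring
  have hnb := hf.not_mem_neighbors (i := K + 1) (X := R) (mem_free.1 (hfree _ (by omega) (by omega))).2.1
    (mem_free.1 (hfree _ (by omega) (by omega))).2.1
  refine AWins.mono (k := 2 * (I + 3) ^ 2 + 2 * I + 17 + (I + 8) + 1)
    (AWins.place (hfree (K + 1) (by omega) (by omega)) hnb.1 hnb.2 fun e he hne he1 he2 => ?_) (by omega)
  have hsingle : insert e B = B ∪ blk (fun i : ℤ => e + i) 0 1 := by
    rw [blk_one]; simp [Set.union_singleton]
  have hrs := run_singleton he1 he2
  -- An answer in the hole is a blue run of length one with red cells on both sides; extending the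
  -- red singleton then has no answer.
  by_cases hK0 : e = f K
  · refine AWins.mono (AWins.stuck (a := f (K + 2)) (k := 1) (w := 0) ?_ ⟨fun i => f (K + 2 + i),
      hf.shift _, by simp, fun i _ _ => by omega, ?_, fun i h1 h2 => Or.inl ?_, ?_⟩ le_rfl le_rfl ?_)
      (by omega)
    · have := mem_free.1 (hfree (K + 2) (by omega) (by omega))
      refine mem_free.2 ⟨trivial, ?_, ?_⟩
      · rintro (h | h)
        · exact hinj _ _ (by omega) (by omega) (by omega) h.symm
        · exact this.2.1 h
      · rintro (h | h)
        · exact hinj _ _ (by omega) (by omega) (by omega) (h.trans hK0).symm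
        · exact this.2.2 h
    · rintro (h | h)
      · exact hinj _ _ (by omega) (by omega) (by omega) h.symm
      · exact (mem_free.1 (hfree _ (by omega) (by omega))).2.1 h
    · show f (K + 2 + -i) = f (K + 1)
      congr 1; omega
    · rintro (h | h)
      · exact hinj _ _ (by omega) (by omega) (by omega) h
      · exact (mem_free.1 (hfree _ (by omega) (by omega))).2.1 h
    · intro g hg hr
      left
      rw [hsingle] at hr
      rcases Run.of_union hg (isLine_add e) hrs hr with ⟨h, -⟩ | ⟨-, h⟩
      · have := hD.size g _ _ hg h
        omega
      · have hge : g (-1) = f K := by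
          rw [← hK0]
          rcases h with h | h <;> simpa using h 0
        intro hc
        rcases hg.rel hf hge with h | h
        · have := h 1
          rw [neg_add_cancel] at this
          exact (mem_free.1 hc).2.1 (Or.inl this)
        · have := h 1
          rw [neg_add_cancel] at this
          exact (mem_free.1 hc).2.1 (Or.inr (this ▸ (hR _ (by omega) (by omega)).2 (by omega)))
  -- These are the two cells at distance one from the blue run. Any other answer leaves the red gap
  -- of length one unmatched, and it is closed at once.
  by_cases hcase : e = f (u - 2) ∨ e = f (u + K + 1)
  · have hlast : e = f (u + K + 1) → u + K + 1 < n := by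
      rintro rfl
      by_contra hc
      refine hnfR (u + K + 1 - n) (by omega) (by omega) ?_
      rwa [← hf.add_period, sub_add_cancel]
    have := AWins.grow_of_sep (F := Set.univ) (R := R) (B := B) (f := y) hyl (q := K - 1) (d := I + 8)
      (e := e) (k := 2 * (I + 3) ^ 2 + 2 * I + 17) (by rw [hK]; push_cast; ring) hD
      (fun i h1 h2 => hfree _ (by omega) (by omega))
      (fun i j h1 h2 h3 _ => hinj _ _ (by omega) (by omega) (by omega))
      (mem_free.1 (hfree _ (by omega) (by omega))).2.1 he (by rwa [hy0]) he1 he2 ?_ ?_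
    · rwa [hy0] at this
    · rintro g j hg hj hgU hge i h1 h2 hc
      rw [hy0] at hgU
      have hX : ∀ i, 0 ≤ i → i < j → g i ∈ {x | x ∈ free Set.univ R B ∧ x ≠ f (K + 1)} := hgU
      rcases hcase with rfl | rfl
      · obtain ⟨v, h3, h4, h5, h6, hal⟩ := exists_aligned hf hg hX (p := K + 1) (r := u)
          (fun h => h.2 rfl) (fun h => hnfB u le_rfl (by omega) h.1) (by omega) (by omega) hge
        have hbe := hal.blk_eq
        rw [zero_add] at hbe
        rw [hbe, hf.mem_blk_iff (by omega) (by omega) (by omega) (by omega)] at hc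
        omega
      · have := hlast rfl
        obtain ⟨v, h3, h4, h5, h6, hal⟩ := exists_aligned hf hg hX (p := u + K - 1) (r := n)
          (fun h => hnfB _ (by omega) (by omega) h.1)
          (fun h => hnfR 0 le_rfl (by omega) (hfn ▸ h.1)) (by omega) this hge
        have hbe := hal.blk_eq
        rw [zero_add] at hbe
        rw [hbe, hf.mem_blk_iff (by omega) (by omega) (by omega) (by omega)] at hc
        omega
    · intro z hz hb hzU hze hzf
      have hzK : f K ∉ blk z 0 (K - 1) := by
        intro hc
        obtain ⟨v, h3, h4, -⟩ := exists_aligned hf hz (X := {x | x ∈ free Set.univ R B ∧ x ≠ y 0})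
          (fun i h1 h2 => ⟨hzU i h1 h2, fun h => hzf 0 le_rfl (by omega) ⟨i, h1, h2, h⟩⟩)
          (p := K - 1) (r := K + 1) (fun h => hnfR _ (by omega) (by omega) h.1)
          (fun h => h.2 hy0.symm) (by omega) (by omega) hc
        omega
      have hD' := (hD.union hz hb)
      by_cases hG : Gap (free Set.univ (R ∪ blk y 0 (K - 1)) (B ∪ blk z 0 (K - 1)))
          (B ∪ blk z 0 (K - 1)) K 1 (K - 1)
      · have hyb : blk y 0 (K - 1) = blk f (K + 1) (K + 1 + (K - 1)) := by
          rw [hy, blk_shift]; congr 1; ring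
        have hW : ∀ h : ℤ, (h = 1 ∨ 3 ≤ h) → h ≤ n →
            WinGap (Set.univ : Set (ZMod n)) ((I + 5 : ℤ) - 1) h ((I + 3) ^ 2) := fun h h1 h2 =>
          (winGap_halving _ I h1 (h2.trans hI)).mono (by omega) le_rfl
        rcases hG.one_cases hf hz hD hrunB hb hD' (by omega) with ⟨h0, h1⟩ | ⟨h0, h1⟩
        · have h0' := free_union_subset _ _ _ _ _ h0
          have hun' : u + K < n := by
            rcases eq_or_lt_of_le hun with h | h
            · rw [h, hfn] at h0'
              exact (hnfR 0 le_rfl (by omega) h0').elim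
            · exact h
          have hle : u + K + 1 + (K - 1) ≤ n := by
            by_contra hc
            have : f n ∈ blk z 0 (K - 1) := h1 ▸ mem_blk (by omega) (by omega)
            obtain ⟨i, h2, h3, e⟩ := this
            exact hnfR 0 le_rfl (by omega) (hfn ▸ e ▸ hzU i h2 h3)
          have H : Config (R ∪ blk y 0 (K - 1)) (B ∪ blk z 0 (K - 1)) f K (K - 1) u K (K - 1) := by
            refine ⟨hf, by omega, by omega, by omega, by omega, by omega, by omega, by omega,
              fun i h2 h3 => ?_, fun i h2 h3 => ?_⟩
            · rw [Set.mem_union, hR i h2 h3, hyb, hf.mem_blk_iff h2 h3 (by omega) (by omega)]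
              omega
            · rw [Set.mem_union, hB i h2 h3, h1, hf.mem_blk_iff h2 h3 (by omega) (by omega)]
              omega
          obtain ⟨w, hw⟩ := hn
          -- The arcs between the pairs have lengths `u - 2 * K` and `n - u - 2 * K`, which differ
          -- since `n` is odd; the longer one is used.
          by_cases h2 : (n : ℤ) < 2 * u
          · exact (H.win_translate (k := I + 7) (φ := I + 5) (c := (I + 3) ^ 2) (d := I + 6) (d' := I + 4)
              (hD'.mono (by omega)) (by omega) (by push_cast; ring) (by push_cast; ring) (by omega)
              (by omega) h2 (by omega) hW).mono (by omega)
          · exact (H.flip.win_translate (k := I + 7) (φ := I + 5) (c := (I + 3) ^ 2) (d := I + 6)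
              (d' := I + 4) (hD'.mono (by omega)) (by omega) (by push_cast; ring) (by push_cast; ring)
              (by omega) (by omega) (by omega) (by omega) hW).mono (by omega)
        · have H : Config (R ∪ blk y 0 (K - 1)) (B ∪ blk z 0 (K - 1)) f K (K - 1) (u - 1 - (K - 1))
              (K - 1) K := by
            refine ⟨hf, by omega, by omega, by omega, by omega, by omega, by omega, by omega,
              fun i h2 h3 => ?_, fun i h2 h3 => ?_⟩
            · rw [Set.mem_union, hR i h2 h3, hyb, hf.mem_blk_iff h2 h3 (by omega) (by omega)]
              omega
            · rw [Set.mem_union, hB i h2 h3, h1, hf.mem_blk_iff h2 h3 (by omega) (by omega)]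
              omega
          obtain ⟨w, hw⟩ := hn
          -- The two arcs have total length `n - 4 * K`, which is odd, so exactly one of them is
          -- odd. The first is always long; the second may be short, but after the flip it adjoins
          -- the longer run, as the squeeze requires.
          rcases Int.even_or_odd' (u - 1 - (K - 1) - (K + 1 + (K - 1))) with ⟨g, hg | hg⟩
          · exact (H.flip.win_mirror (k := I + 7) (φ := I + 5) (c := (I + 3) ^ 2) (d := I + 6)
              (d' := I + 4) (hD'.mono (by omega)) (by push_cast; ring) (by push_cast; ring)
              (by omega) (by omega) (g := (w - (u - 1 - (K - 1)) + g).toNat) (by omega)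
              (Or.inl (by omega)) hW).mono (by omega)
          · exact (H.win_mirror (k := I + 7) (φ := I + 5) (c := (I + 3) ^ 2) (d := I + 6)
              (d' := I + 4) (hD'.mono (by omega)) (by push_cast; ring) (by push_cast; ring)
              (by omega) (by omega) (g := g.toNat) (by omega) (Or.inr (by omega)) hW).mono (by omega)
      · refine (hjoin (K - 1) z (by omega) le_rfl hz hb hzU (fun i h1 h2 => ?_) hG).mono (by omega)
        rcases eq_or_ne i 0 with rfl | h3
        · simpa using hzK
        · have := hzf (i - 1) (by omega) (by omega)
          rwa [show y (i - 1) = f (K + i) by simp only [hy]; congr 1; ring] at this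
  · have := hjoin 1 (fun i : ℤ => e + i) le_rfl (by omega) (isLine_add e) hrs ?_ ?_ ?_
    · rw [hsingle, ← hy0]
      have hs : insert (y 0) R = R ∪ blk y 0 1 := by rw [blk_one]; simp [Set.union_singleton]
      rw [hs]
      exact this.mono (by omega)
    · intro i h1 h2
      rw [show i = 0 by omega]
      simpa using he
    · intro i h1 h2
      rw [blk_one]
      rcases eq_or_ne i 0 with rfl | h3
      · simpa using fun h => hK0 h.symm
      · rw [show i = 1 by omega]
        simpa using fun h => hne h.symm
    · intro hG
      have hD1 : Distinct (1 - 1) (B ∪ blk (fun i : ℤ => e + i) 0 1) :=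
        (hD.mono (by omega)).union (isLine_add e) hrs
      have heb : e ∈ blk (fun i : ℤ => e + i) 0 1 := by rw [blk_one]; simp
      apply hcase
      rcases hG.one_cases hf (isLine_add e) hD hrunB hrs hD1 (by omega) with ⟨-, h⟩ | ⟨-, h⟩
      · right
        rw [h] at heb
        obtain ⟨i, h1, h2, h3⟩ := heb
        rw [← h3]; congr 1; omega
      · left
        rw [h] at heb
        obtain ⟨i, h1, h2, h3⟩ := heb
        rw [← h3]; congr 1; omega

/-- The first answer is in the second half of the cycle as seen from `f 0`, so growth in the
positive direction is undisturbed, and the blue block starts far enough ahead to leave a long arc.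
-/
theorem awins_cycle_aux {f : ℤ → ZMod n} (hf : IsLine f) {I : ℕ} (hn : Odd n)
    (hI : (n : ℤ) ≤ 13 * 2 ^ I) (hN : 30 * I + 300 ≤ n) {t : ℤ} (ht : n < 2 * t) (htn : t < n) :
    AWins Set.univ (2 * (I + 3) ^ 2 + 4 * I + 35) (insert (f 0) ∅) (insert (f t) ∅) := by
  have hfr : ∀ x, x ∈ free (Set.univ : Set (ZMod n)) ∅ ∅ := fun x => by simp [mem_free]
  have hfn : f n = f 0 := by simpa using hf.add_period 0
  have near : ∀ g (j : ℤ), IsLine g → j ≤ I + 10 → (∀ i, 0 ≤ i → i < j → g i ≠ f 0) →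
      f t ∈ blk g 0 j → ∃ u, 0 < u ∧ u + j ≤ n ∧ u ≤ t ∧ t < u + j ∧ Aligned f u g 0 j := by
    intro g j hg hj hgU hge
    exact exists_aligned hf hg (X := {x | x ≠ f 0}) hgU (p := 0) (r := n) (fun h => h rfl)
      (fun h => h hfn) (by omega) htn hge
  have := AWins.grow_of_sep (F := Set.univ) (R := ∅) (B := ∅) (f := f) hf (q := I + 10) (d := I + 9)
    (e := f t) (k := 2 * (I + 3) ^ 2 + 3 * I + 26) (by push_cast; ring) (distinct_empty _)
    (fun i _ _ => hfr _) (fun i j h1 h2 h3 _ e => ?_) (by simp) (hfr _) (fun e => ?_) (by simp) (by simp)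
    ?_ ?_
  · exact this.mono (by omega)
  · rw [eq_comm, hf.eq_iff] at e
    have := Int.le_of_dvd (by omega) e
    omega
  · have := hf.inj_of_lt e (by omega) htn le_rfl (by omega)
    omega
  · intro g j hg hj hgU hge i h1 h2 hc
    obtain ⟨u, h3, h4, h5, h6, hal⟩ := near g j hg hj (fun i h1 h2 => (hgU i h1 h2).2) hge
    have hbe := hal.blk_eq
    rw [zero_add] at hbe
    rw [hbe, hf.mem_blk_iff (by omega) (by omega) (by omega) (by omega)] at hc
    omega
  · intro g hg hb _ hge hgf
    obtain ⟨u, h3, h4, h5, h6, hal⟩ := near g (I + 10) hg le_rfl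
      (fun i h1 h2 h => hgf 0 le_rfl (by omega) ⟨i, h1, h2, h⟩) hge
    have hbe := hal.blk_eq
    rw [zero_add] at hbe
    have hD := (distinct_empty (G := ZMod n) (I + 10)).union hg hb
    rw [hbe, Set.empty_union] at hD ⊢
    rw [Set.empty_union]
    exact awins_cycle_of_runs hf hn hI rfl (by omega) h4 hD

/-- The first player wins on a long odd cycle. -/
theorem awins_cycle {I : ℕ} (hn : Odd n) (hI : (n : ℤ) ≤ 13 * 2 ^ I) (hN : 30 * I + 300 ≤ n) :
    AWins (Set.univ : Set (ZMod n)) (2 * (I + 3) ^ 2 + 4 * I + 36) ∅ ∅ := by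
  refine AWins.place (e := 0) (k := 2 * (I + 3) ^ 2 + 4 * I + 35) (by simp [mem_free]) (by simp)
    (by simp) fun e _ hne _ _ => ?_
  obtain ⟨i, h1, h2, rfl⟩ := (isLine_add (0 : ZMod n)).exists_index e
  have h0 : i ≠ 0 := by
    rintro rfl
    simp at hne
  obtain ⟨w, hw⟩ := hn
  -- Oddness of `n` excludes `n = 2 * i`, so one of the two orientations puts the answer in the
  -- second half.
  by_cases h3 : (n : ℤ) < 2 * i
  · have := awins_cycle_aux (isLine_add (0 : ZMod n)) ⟨w, hw⟩ hI hN h3 h2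
    simpa using this
  · have := awins_cycle_aux (isLine_sub (0 : ZMod n)) ⟨w, hw⟩ hI hN (t := n - i) (by omega) (by omega)
    simpa using this

end CyclePlay

end SymGame

namespace SymGame

set_option linter.unusedSectionVars false

/-! ### From rules of play to strategies and the length of the game -/

section Strategies

variable {E : Type*}

theorem exists_fresh [Finite E] {l l' : List E} (h : l.length + l'.length < Nat.card E) :
    ∃ e, e ∉ l ∧ e ∉ l' := by
  classical
  have := Fintype.ofFinite E
  by_contra hc
  push Not at hc
  have h1 : (Finset.univ : Finset E) ⊆ (l ++ l').toFinset := fun e _ => by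
    simp only [List.mem_toFinset, List.mem_append]
    exact or_iff_not_imp_left.2 (hc e)
  have h2 := Finset.card_le_card h1
  have h3 := (l ++ l').toFinset_card_le
  rw [List.length_append] at h3
  rw [Finset.card_univ, ← Nat.card_eq_fintype_card] at h2
  omega

open Classical in
/-- An element satisfying `p`, or else an element outside the two lists, if there is one. -/
noncomputable def pick [Nonempty E] (p : E → Prop) (l l' : List E) : E :=
  if h : ∃ e, (e ∉ l ∧ e ∉ l') ∧ p e then h.choose
  else if h : ∃ e, e ∉ l ∧ e ∉ l' then h.choose else Classical.arbitrary E

theorem pick_fresh [Finite E] [Nonempty E] (p : E → Prop) {l l' : List E}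
    (h : l.length + l'.length < Nat.card E) : pick p l l' ∉ l ∧ pick p l l' ∉ l' := by
  unfold pick
  split_ifs with h1 h2
  · exact h1.choose_spec.1
  · exact h2.choose_spec
  · exact (h2 (exists_fresh h)).elim

theorem pick_spec [Nonempty E] {p : E → Prop} {l l' : List E} {e : E} (h : e ∉ l ∧ e ∉ l') (he : p e) :
    p (pick p l l') := by
  have h1 : ∃ e, (e ∉ l ∧ e ∉ l') ∧ p e := ⟨e, h, he⟩
  unfold pick
  rw [dif_pos h1]
  exact h1.choose_spec.2

/-- The moves of the first player, latest first, before his answer to the moves `bs` of the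
opponent, latest first, if he follows the rule `p`. -/
noncomputable def histA [Nonempty E] (p : List E → List E → E → Prop) : List E → List E
  | [] => []
  | _ :: bs => pick (p (histA p bs) bs) (histA p bs) bs :: histA p bs

/-- The moves of the second player, latest first, in answer to the moves of the opponent. -/
noncomputable def histB [Nonempty E] (p : List E → List E → E → Prop) : List E → List E
  | [] => []
  | a :: as => pick (p (a :: as) (histB p as)) (a :: as) (histB p as) :: histB p as

theorem length_histA [Nonempty E] (p : List E → List E → E → Prop) (bs : List E) :
    (histA p bs).length = bs.length := by
  induction bs with
  | nil => rfl
  | cons b bs ih => simp [histA, ih]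

theorem length_histB [Nonempty E] (p : List E → List E → E → Prop) (as : List E) :
    (histB p as).length = as.length := by
  induction as with
  | nil => rfl
  | cons a as ih => simp [histB, ih]

theorem mem_histA [Nonempty E] (p : List E → List E → E → Prop) {bs bs' : List E} (h : bs' <:+ bs)
    (hne : bs' ≠ bs) : pick (p (histA p bs') bs') (histA p bs') bs' ∈ histA p bs := by
  induction bs with
  | nil => exact (hne (List.suffix_nil.1 h)).elim
  | cons b bs ih =>
    rcases List.suffix_cons_iff.1 h with h1 | h1
    · exact (hne h1).elim
    · by_cases h2 : bs' = bs
      · subst h2; exact List.mem_cons_self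
      · exact List.mem_cons_of_mem _ (ih h1 h2)

theorem histB_suffix [Nonempty E] (p : List E → List E → E → Prop) {as as' : List E} (h : as' <:+ as) :
    histB p as' <:+ histB p as := by
  induction as with
  | nil => rw [List.suffix_nil.1 h]
  | cons a as ih =>
    rcases List.suffix_cons_iff.1 h with h1 | h1
    · rw [h1]
    · exact (ih h1).trans (List.suffix_cons _ _)

variable {V : Type*} {G : SimpleGraph V} [Finite G.edgeSet] [Nonempty G.edgeSet]

/-- The strategy of the first player that follows a rule as long as possible. -/
noncomputable def StrategyA.ofRule (p : List G.edgeSet → List G.edgeSet → G.edgeSet → Prop) :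
    StrategyA G where
  move l := pick (p (histA p l.reverse) l.reverse) (histA p l.reverse) l.reverse
  notMem_of_nodup l _ hl := by
    have := (pick_fresh (p (histA p l.reverse) l.reverse) (l := histA p l.reverse) (l' := l.reverse)
      (by rw [length_histA, List.length_reverse, ← two_mul]; exact hl)).2
    rwa [List.mem_reverse] at this
  ne_of_prefix l _ hl l' hl' hne h := by
    have := (pick_fresh (p (histA p l.reverse) l.reverse) (l := histA p l.reverse) (l' := l.reverse)
      (by rw [length_histA, List.length_reverse, ← two_mul]; exact hl)).1
    rw [h] at this
    exact this (mem_histA p (List.reverse_suffix.2 hl') (by simpa using hne))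

/-- The strategy of the second player that follows a rule as long as possible. -/
noncomputable def StrategyB.ofRule (p : List G.edgeSet → List G.edgeSet → G.edgeSet → Prop) :
    StrategyB G where
  move l := pick (p l.reverse (histB p l.reverse.tail)) l.reverse (histB p l.reverse.tail)
  notMem_of_nodup l _ h0 hl := by
    have h1 : 0 < l.length := List.length_pos_iff.2 h0
    have := (pick_fresh (p l.reverse (histB p l.reverse.tail)) (l := l.reverse)
      (l' := histB p l.reverse.tail)
      (by rw [length_histB, List.length_tail, List.length_reverse]; unfold size at hl; omega)).1
    rwa [List.mem_reverse] at this
  ne_of_prefix l _ h0 hl l' h0' hl' hne h := by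
    have h1 : 0 < l.length := List.length_pos_iff.2 h0
    have := (pick_fresh (p l.reverse (histB p l.reverse.tail)) (l := l.reverse)
      (l' := histB p l.reverse.tail)
      (by rw [length_histB, List.length_tail, List.length_reverse]; unfold size at hl; omega)).2
    rw [h] at this
    apply this
    have h2 : l'.reverse <:+ l.reverse := List.reverse_suffix.2 hl'
    have h3 : l'.reverse ≠ l.reverse := by simpa using hne
    obtain ⟨a, as, e⟩ : ∃ a as, l.reverse = a :: as :=
      List.exists_cons_of_ne_nil (by simpa using h0)
    obtain ⟨a', as', e'⟩ : ∃ a as, l'.reverse = a :: as :=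
      List.exists_cons_of_ne_nil (by simpa using h0')
    rw [e, e'] at h2 h3
    rcases List.suffix_cons_iff.1 h2 with h4 | h4
    · exact (h3 h4).elim
    · rw [e, e', List.tail_cons, List.tail_cons]
      exact (histB_suffix p h4).mem List.mem_cons_self

theorem StrategyA.ofRule_move (p : List G.edgeSet → List G.edgeSet → G.edgeSet → Prop)
    (l : List G.edgeSet) : (StrategyA.ofRule p).move l =
      pick (p (histA p l.reverse) l.reverse) (histA p l.reverse) l.reverse := rfl

theorem StrategyB.ofRule_move (p : List G.edgeSet → List G.edgeSet → G.edgeSet → Prop)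
    (l : List G.edgeSet) : (StrategyB.ofRule p).move l =
      pick (p l.reverse (histB p l.reverse.tail)) l.reverse (histB p l.reverse.tail) := rfl

instance : Nonempty (StrategyA G) := ⟨StrategyA.ofRule fun _ _ _ => True⟩

/-- A strategy sees only the opponent's moves; this confirms that the history it reconstructs is the
actual one. Lists are reversed because the reconstruction recurses from the latest move. -/
theorem play_ofRule_left (p : List G.edgeSet → List G.edgeSet → G.edgeSet → Prop) (S : StrategyB G)
    (i : ℕ) : histA p (play (StrategyA.ofRule p) S i).2.reverse =
      (play (StrategyA.ofRule p) S i).1.reverse := by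
  induction i with
  | zero => rfl
  | succ i ih =>
    simp only [play, List.reverse_append, List.reverse_cons, List.reverse_nil, List.nil_append,
      List.cons_append, histA]
    rw [StrategyA.ofRule_move, ih]

theorem play_ofRule_right (p : List G.edgeSet → List G.edgeSet → G.edgeSet → Prop) (S : StrategyA G)
    (i : ℕ) : histB p (play S (StrategyB.ofRule p) i).1.reverse =
      (play S (StrategyB.ofRule p) i).2.reverse := by
  induction i with
  | zero => rfl
  | succ i ih =>
    simp only [play, List.reverse_append, List.reverse_cons, List.reverse_nil, List.nil_append,
      List.cons_append, histB]
    rw [StrategyB.ofRule_move, List.reverse_append, List.reverse_singleton, List.singleton_append,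
      List.tail_cons, ih]

/-- The edges coloured during the first rounds are distinct. -/
structure Legal (S₁ : StrategyA G) (S₂ : StrategyB G) (i : ℕ) : Prop where
  length₁ : (play S₁ S₂ i).1.length = i
  length₂ : (play S₁ S₂ i).2.length = i
  nodup₁ : (play S₁ S₂ i).1.Nodup
  nodup₂ : (play S₁ S₂ i).2.Nodup
  move₁ : ∀ x ∈ (play S₁ S₂ i).1, ∃ l, l <+: (play S₁ S₂ i).2 ∧ l ≠ (play S₁ S₂ i).2 ∧ x = S₁.move l
  move₂ : ∀ x ∈ (play S₁ S₂ i).2, ∃ l, l ≠ [] ∧ l <+: (play S₁ S₂ i).1 ∧ x = S₂.move l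

namespace Legal

variable {S₁ : StrategyA G} {S₂ : StrategyB G} {i : ℕ}

theorem move_left (H : Legal S₁ S₂ i) (hi : 2 * (i + 1) ≤ size G) :
    S₁.move (play S₁ S₂ i).2 ∉ (play S₁ S₂ i).1 ∧ S₁.move (play S₁ S₂ i).2 ∉ (play S₁ S₂ i).2 := by
  have hl : 2 * (play S₁ S₂ i).2.length < size G := by rw [H.length₂]; omega
  refine ⟨fun h => ?_, S₁.notMem_of_nodup _ H.nodup₂ hl⟩
  obtain ⟨l, h1, h2, h3⟩ := H.move₁ _ h
  exact S₁.ne_of_prefix _ H.nodup₂ hl l h1 h2 h3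

theorem nodup_left (H : Legal S₁ S₂ i) (hi : 2 * (i + 1) ≤ size G) :
    (play S₁ S₂ (i + 1)).1.Nodup := by
  simp only [play]
  rw [List.nodup_append]
  refine ⟨H.nodup₁, List.nodup_singleton _, ?_⟩
  rintro a ha b hb rfl
  rw [List.mem_singleton] at hb
  exact (H.move_left hi).1 (hb ▸ ha)

theorem move_right (H : Legal S₁ S₂ i) (hi : 2 * (i + 1) ≤ size G) :
    S₂.move (play S₁ S₂ (i + 1)).1 ∉ (play S₁ S₂ (i + 1)).1 ∧
      S₂.move (play S₁ S₂ (i + 1)).1 ∉ (play S₁ S₂ i).2 := by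
  have hne : (play S₁ S₂ (i + 1)).1 ≠ [] := by simp [play]
  have hlen : (play S₁ S₂ (i + 1)).1.length = i + 1 := by simp [play, H.length₁]
  have hl : 2 * (play S₁ S₂ (i + 1)).1.length ≤ size G := by rw [hlen]; exact hi
  refine ⟨S₂.notMem_of_nodup _ (H.nodup_left hi) hne hl, fun h => ?_⟩
  obtain ⟨l, h1, h2, h3⟩ := H.move₂ _ h
  refine S₂.ne_of_prefix _ (H.nodup_left hi) hne hl l h1 (h2.trans (List.prefix_append _ _)) ?_ h3
  rintro rfl
  have := h2.length_le
  rw [hlen, H.length₁] at this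
  omega

theorem succ (H : Legal S₁ S₂ i) (hi : 2 * (i + 1) ≤ size G) : Legal S₁ S₂ (i + 1) := by
  have h2 := H.move_right hi
  refine ⟨by simp [play, H.length₁], by simp [play, H.length₂], H.nodup_left hi, ?_, ?_, ?_⟩
  · rw [play, List.nodup_append]
    refine ⟨H.nodup₂, List.nodup_singleton _, ?_⟩
    rintro a ha b hb rfl
    rw [List.mem_singleton] at hb
    exact h2.2 (hb ▸ ha)
  · intro x hx
    simp only [play, List.mem_append, List.mem_singleton] at hx
    rcases hx with hx | rfl
    · obtain ⟨l, h3, h4, h5⟩ := H.move₁ x hx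
      refine ⟨l, h3.trans (List.prefix_append _ _), ?_, h5⟩
      rintro rfl
      have := h3.length_le
      simp [play] at this
    · refine ⟨_, List.prefix_append _ _, ?_, rfl⟩
      simp [play]
  · intro x hx
    simp only [play, List.mem_append, List.mem_singleton] at hx
    rcases hx with hx | rfl
    · obtain ⟨l, h3, h4, h5⟩ := H.move₂ x hx
      exact ⟨l, h3, h4.trans (List.prefix_append _ _), h5⟩
    · exact ⟨(play S₁ S₂ (i + 1)).1, by simp [play], List.prefix_rfl, rfl⟩

end Legal

theorem legal (S₁ : StrategyA G) (S₂ : StrategyB G) {i : ℕ} (hi : 2 * i ≤ size G) : Legal S₁ S₂ i := by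
  induction i with
  | zero => constructor <;> simp [play]
  | succ i ih => exact (ih (by omega)).succ hi

theorem playLength_le (S₁ : StrategyA G) (S₂ : StrategyB G) : 2 * playLength S₁ S₂ ≤ size G := by
  have : playLength S₁ S₂ ≤ size G / 2 := csSup_le' fun k hk => by have := hk.1; omega
  omega

theorem le_playLength {S₁ : StrategyA G} {S₂ : StrategyB G} {k : ℕ} (hk : 2 * k ≤ size G)
    (h : ∀ i ≤ k, EdgeSetsIso (red S₁ S₂ i) (blue S₁ S₂ i)) : k ≤ playLength S₁ S₂ :=
  le_csSup ⟨size G, fun k hk => by have := hk.1; omega⟩ ⟨hk, h⟩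

/-- The set of the edges in a list. -/
def edges (l : List G.edgeSet) : Set (Sym2 V) := {e | ∃ x ∈ l, (x : Sym2 V) = e}

theorem edges_reverse (l : List G.edgeSet) : edges l.reverse = edges l := by
  simp [edges]

/-- The first player stops the game by a rule that maintains an invariant. -/
theorem gameLength_lt {T : ℕ} (P : List G.edgeSet → List G.edgeSet → Prop) (h0 : P [] [])
    (hstep : ∀ as bs, P as bs → as.length < T → EdgeSetsIso (edges as) (edges bs) →
      ∃ a, a ∉ as ∧ a ∉ bs ∧ ∀ b, b ∉ a :: as → b ∉ bs →
        EdgeSetsIso (edges (a :: as)) (edges (b :: bs)) → P (a :: as) (b :: bs))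
    (hend : ∀ as bs, P as bs → as.length < T) : gameLength G < T := by
  have hT : 0 < T := hend _ _ h0
  suffices h : gameLength G ≤ T - 1 by omega
  refine ciSup_le' fun S₂ => ?_
  -- A move is good if every answer preserving isomorphism restores the invariant.
  set rule : List G.edgeSet → List G.edgeSet → G.edgeSet → Prop := fun as bs a =>
    ∀ b, b ∉ a :: as → b ∉ bs → EdgeSetsIso (edges (a :: as)) (edges (b :: bs)) →
      P (a :: as) (b :: bs) with hrule
  refine (ciInf_le (OrderBot.bddBelow _) (StrategyA.ofRule rule)).trans ?_
  set S₁ := StrategyA.ofRule rule with hS₁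
  refine csSup_le' ?_
  rintro k ⟨hk, hiso⟩
  have key : ∀ i ≤ k, P (play S₁ S₂ i).1.reverse (play S₁ S₂ i).2.reverse := by
    intro i
    induction i with
    | zero => intro _; exact h0
    | succ i ih =>
      intro hi
      have hP := ih (by omega)
      have hiso' : ∀ j ≤ k, EdgeSetsIso (edges (play S₁ S₂ j).1.reverse)
          (edges (play S₁ S₂ j).2.reverse) := fun j hj => by
        rw [edges_reverse, edges_reverse]; exact hiso j hj
      obtain ⟨a, ha, ha', hr⟩ := hstep _ _ hP (hend _ _ hP) (hiso' i (by omega))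
      have hmove : S₁.move (play S₁ S₂ i).2 = pick (rule (play S₁ S₂ i).1.reverse
          (play S₁ S₂ i).2.reverse) (play S₁ S₂ i).1.reverse (play S₁ S₂ i).2.reverse := by
        rw [hS₁, StrategyA.ofRule_move, play_ofRule_left]
      have hspec : rule (play S₁ S₂ i).1.reverse (play S₁ S₂ i).2.reverse
          (S₁.move (play S₁ S₂ i).2) := by
        rw [hmove]
        exact pick_spec ⟨ha, ha'⟩ hr
      have hl := (legal S₁ S₂ (i := i) (by omega)).move_right (by omega)
      have e1 : (play S₁ S₂ (i + 1)).1.reverse =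
          S₁.move (play S₁ S₂ i).2 :: (play S₁ S₂ i).1.reverse := by simp [play]
      have e2 : (play S₁ S₂ (i + 1)).2.reverse =
          S₂.move (play S₁ S₂ (i + 1)).1 :: (play S₁ S₂ i).2.reverse := by simp [play]
      have hi' := hiso' (i + 1) hi
      rw [e1, e2] at hi' ⊢
      refine hspec _ ?_ ?_ hi'
      · rw [← e1, List.mem_reverse]; exact hl.1
      · rw [List.mem_reverse]; exact hl.2
  have := hend _ _ (key k le_rfl)
  rw [List.length_reverse, (legal S₁ S₂ hk).length₁] at this
  omega

/-- The second player prolongs the game by a rule that maintains an invariant. -/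
theorem le_gameLength {k : ℕ} (hk : 2 * k ≤ size G) (P : List G.edgeSet → List G.edgeSet → Prop)
    (h0 : P [] [])
    (hstep : ∀ as bs a, P as bs → as.length < k → as.length = bs.length → a ∉ as → a ∉ bs →
      ∃ b, b ∉ a :: as ∧ b ∉ bs ∧ P (a :: as) (b :: bs))
    (hiso : ∀ as bs, P as bs → EdgeSetsIso (edges as) (edges bs)) : k ≤ gameLength G := by
  set rule : List G.edgeSet → List G.edgeSet → G.edgeSet → Prop := fun as bs b =>
    P as (b :: bs) with hrule
  set S₂ := StrategyB.ofRule rule with hS₂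
  have hbdd : BddAbove (Set.range fun S₂ : StrategyB G => ⨅ S₁ : StrategyA G, playLength S₁ S₂) := by
    refine ⟨size G, ?_⟩
    rintro _ ⟨S, rfl⟩
    have S₁ : StrategyA G := Classical.arbitrary _
    refine (ciInf_le (OrderBot.bddBelow _) S₁).trans ?_
    have := playLength_le S₁ S
    omega
  refine le_ciSup_of_le hbdd S₂ (le_ciInf fun S₁ => ?_)
  have key : ∀ i ≤ k, P (play S₁ S₂ i).1.reverse (play S₁ S₂ i).2.reverse := by
    intro i
    induction i with
    | zero => intro _; exact h0
    | succ i ih =>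
      intro hi
      have hP := ih (by omega)
      have hL := legal S₁ S₂ (i := i) (by omega)
      have hl := hL.move_left (by omega)
      have e1 : (play S₁ S₂ (i + 1)).1.reverse =
          S₁.move (play S₁ S₂ i).2 :: (play S₁ S₂ i).1.reverse := by simp [play]
      have e2 : (play S₁ S₂ (i + 1)).2.reverse =
          S₂.move (play S₁ S₂ (i + 1)).1 :: (play S₁ S₂ i).2.reverse := by simp [play]
      obtain ⟨b, hb, hb', hPb⟩ := hstep _ _ (S₁.move (play S₁ S₂ i).2) hP
        (by rw [List.length_reverse, hL.length₁]; omega)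
        (by rw [List.length_reverse, List.length_reverse, hL.length₁, hL.length₂])
        (by rw [List.mem_reverse]; exact hl.1) (by rw [List.mem_reverse]; exact hl.2)
      have hmove : S₂.move (play S₁ S₂ (i + 1)).1 = pick (rule (play S₁ S₂ (i + 1)).1.reverse
          (play S₁ S₂ i).2.reverse) (play S₁ S₂ (i + 1)).1.reverse (play S₁ S₂ i).2.reverse := by
        rw [hS₂, StrategyB.ofRule_move, ← hS₂, e1, List.tail_cons, hS₂, play_ofRule_right]
      rw [e2, hmove, e1]
      exact pick_spec (p := rule (S₁.move (play S₁ S₂ i).2 :: (play S₁ S₂ i).1.reverse)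
        (play S₁ S₂ i).2.reverse) ⟨hb, hb'⟩ hPb
  refine le_playLength hk fun i hi => ?_
  have := hiso _ _ (key i hi)
  rwa [edges_reverse, edges_reverse] at this

end Strategies

end SymGame

namespace SymGame

set_option linter.unusedSectionVars false

/-! ### Isomorphism invariants: counting non-backtracking walks -/

section Walks

variable {V W : Type*}

/-- The dart from `u` to `w` starts a non-backtracking walk with `j + 1` edges. -/
def Extends (H : SimpleGraph V) : ℕ → V → V → Prop
  | 0, u, w => H.Adj u w
  | j + 1, u, w => H.Adj u w ∧ ∃ x, x ≠ u ∧ Extends H j w x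

theorem Extends.adj {H : SimpleGraph V} {j : ℕ} {u w : V} (h : Extends H j u w) : H.Adj u w := by
  cases j with
  | zero => exact h
  | succ j => exact h.1

theorem Extends.map {H : SimpleGraph V} {H' : SimpleGraph W} (φ : H ↪g H') {j : ℕ} {u w : V}
    (h : Extends H j u w) : Extends H' j (φ u) (φ w) := by
  induction j generalizing u w with
  | zero => exact φ.map_adj_iff.2 h
  | succ j ih =>
    obtain ⟨h1, x, h2, h3⟩ := h
    exact ⟨φ.map_adj_iff.2 h1, φ x, φ.injective.ne h2, ih h3⟩

/-- The number of darts that start a non-backtracking walk with `j + 1` edges. -/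
noncomputable def dartCount (H : SimpleGraph V) (j : ℕ) : ℕ :=
  {p : V × V | Extends H j p.1 p.2}.ncard

theorem dartCount_eq_of_iso {H : SimpleGraph V} {H' : SimpleGraph W} (φ : H ≃g H') (j : ℕ) :
    dartCount H j = dartCount H' j := by
  refine Set.ncard_congr (fun p _ => (φ p.1, φ p.2)) (fun p hp => Extends.map φ.toEmbedding hp) ?_ ?_
  · rintro ⟨u, w⟩ ⟨u', w'⟩ _ _ h
    simpa using h
  · rintro ⟨u, w⟩ h
    refine ⟨(φ.symm u, φ.symm w), Extends.map φ.symm.toEmbedding h, by simp⟩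

/-- Vertices outside the support lie on no dart, so passing to the subgraph without isolated
vertices changes no count. -/
theorem dartCount_edgeSubgraph (s : Set (Sym2 V)) (j : ℕ) :
    dartCount (edgeSubgraph s) j = dartCount (SimpleGraph.fromEdgeSet s) j := by
  have key : ∀ j (u w : (SimpleGraph.fromEdgeSet s).support),
      Extends (SimpleGraph.fromEdgeSet s) j u w → Extends (edgeSubgraph s) j u w := by
    intro j
    induction j with
    | zero => exact fun u w h => h
    | succ j ih =>
      rintro u w ⟨h1, x, h2, h3⟩
      exact ⟨h1, ⟨x, ⟨w, h3.adj.symm⟩⟩, fun h => h2 (congrArg Subtype.val h), ih _ _ h3⟩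
  refine Set.ncard_congr (fun p _ => ((p.1 : V), (p.2 : V)))
    (fun p hp => Extends.map (SimpleGraph.Embedding.induce _) hp) ?_ ?_
  · rintro ⟨u, w⟩ ⟨u', w'⟩ _ _ h
    simpa [Subtype.ext_iff] using h
  · rintro ⟨u, w⟩ h
    exact ⟨(⟨u, ⟨w, h.adj⟩⟩, ⟨w, ⟨u, h.adj.symm⟩⟩), key j _ _ h, rfl⟩

theorem EdgeSetsIso.dartCount_eq {s t : Set (Sym2 V)} (h : EdgeSetsIso s t) (j : ℕ) :
    dartCount (SimpleGraph.fromEdgeSet s) j = dartCount (SimpleGraph.fromEdgeSet t) j := by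
  obtain ⟨φ⟩ := h
  rw [← dartCount_edgeSubgraph, ← dartCount_edgeSubgraph]
  exact dartCount_eq_of_iso φ j

variable {G : Type*} [CommRing G]

/-- The starting points of the blocks of `j + 1` consecutive cells of `X`. -/
def windows (X : Set G) (j : ℕ) : Set G := {p | ∀ i : ℕ, i ≤ j → p + i ∈ X}

theorem mem_windows_succ {X : Set G} {j : ℕ} {p : G} :
    p ∈ windows X (j + 1) ↔ p ∈ X ∧ p + 1 ∈ windows X j := by
  constructor
  · intro h
    refine ⟨by simpa using h 0 (by omega), fun i hi => ?_⟩
    have := h (i + 1) (by omega)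
    push_cast at this
    rwa [add_assoc, add_comm (1 : G)]
  · rintro ⟨h1, h2⟩ i hi
    cases i with
    | zero => simpa using h1
    | succ i =>
      have := h2 i (by omega)
      push_cast
      rwa [add_assoc, add_comm (1 : G)] at this

/-- The vertices of the graph `H` sit at positions in `G` so that its edges join consecutive
positions; `X` is the set of the left endpoints of the edges. -/
structure Placed (H : SimpleGraph V) (pos : V → G) (X : Set G) : Prop where
  two_ne : (2 : G) ≠ 0
  inj : Function.Injective pos
  adj : ∀ x y, H.Adj x y ↔ (pos y = pos x + 1 ∧ pos x ∈ X) ∨ (pos x = pos y + 1 ∧ pos y ∈ X)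
  exists_pos : ∀ c ∈ X, ∃ x y, pos x = c ∧ pos y = c + 1

namespace Placed

variable {H : SimpleGraph V} {pos : V → G} {X : Set G}

/-- Reversal of the positions reduces leftward walks to rightward ones. The edge between `c` and `c
+ 1` becomes the one between `-c - 1` and `-c`, hence the shift by one. -/
theorem neg (h : Placed H pos X) : Placed H (fun v => -pos v) {c | -c - 1 ∈ X} := by
  have aux : ∀ p q : G, (q = p + 1 ∧ p ∈ X) ↔ (-p = -q + 1 ∧ - -q - 1 ∈ X) := by
    intro p q
    constructor
    · rintro ⟨rfl, h1⟩
      exact ⟨by ring, by simpa using h1⟩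
    · rintro ⟨h1, h2⟩
      have e : q = p + 1 := by linear_combination h1
      subst e
      exact ⟨rfl, by simpa using h2⟩
  refine ⟨h.two_ne, fun x y e => h.inj (neg_injective e), fun x y => ?_, fun c hc => ?_⟩
  · rw [h.adj, or_comm]
    exact or_congr (aux _ _) (aux _ _)
  · obtain ⟨x, y, h1, h2⟩ := h.exists_pos _ hc
    exact ⟨y, x, by rw [h2]; ring, by rw [h1]; ring⟩

/-- A walk without backtracking keeps its direction, so it exists exactly if all the cells ahead
belong to `X`. The hypothesis `2 ≠ 0` distinguishes the two directions. -/
theorem extends_right (h : Placed H pos X) {j : ℕ} {u w : V} (e : pos w = pos u + 1) :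
    Extends H j u w ↔ pos u ∈ windows X j := by
  have hne : ∀ x : G, x ≠ x + 1 + 1 := fun x hx => h.two_ne (by linear_combination -hx)
  have hadj : ∀ {u w}, pos w = pos u + 1 → (H.Adj u w ↔ pos u ∈ X) := by
    intro u w e
    rw [h.adj]
    constructor
    · rintro (h1 | h1)
      · exact h1.2
      · exact (hne _ (e ▸ h1.1)).elim
    · exact fun h1 => Or.inl ⟨e, h1⟩
  induction j generalizing u w with
  | zero =>
    rw [Extends, hadj e]
    constructor
    · intro h1 i hi
      rw [Nat.le_zero.1 hi]; simpa using h1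
    · intro h1
      simpa using h1 0 le_rfl
  | succ j ih =>
    rw [mem_windows_succ, Extends, hadj e, ← e]
    refine and_congr_right fun _ => ⟨?_, fun h1 => ?_⟩
    · rintro ⟨x, h1, h2⟩
      rcases (h.adj _ _).1 h2.adj with h3 | h3
      · exact (ih h3.1).1 h2
      · exact (h1 (h.inj (add_right_cancel (h3.1.symm.trans e)))).elim
    · obtain ⟨w', x, h2, h3⟩ := h.exists_pos _ (by simpa using h1 0 (by omega))
      refine ⟨x, ?_, (ih h3).2 h1⟩
      rintro rfl
      rw [e] at h3
      exact hne _ h3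

theorem extends_left (h : Placed H pos X) {j : ℕ} {u w : V} (e : pos u = pos w + 1) :
    Extends H j u w ↔ pos w - j ∈ windows X j := by
  rw [h.neg.extends_right (u := u) (w := w) (by rw [e]; ring)]
  constructor
  · intro h1 i hi
    have := h1 (j - i) (by omega)
    simp only [Set.mem_ofPred_eq, e] at this
    rw [Nat.cast_sub hi] at this
    convert this using 1; ring
  · intro h1 i hi
    have := h1 (j - i) (by omega)
    rw [Nat.cast_sub hi] at this
    simp only [Set.mem_ofPred_eq, e]
    convert this using 1; ring

/-- Each block of `j + 1` cells carries two walks, one from either end. -/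
theorem dartCount_eq [Finite V] (h : Placed H pos X) (j : ℕ) :
    dartCount H j = 2 * (windows X j).ncard := by
  have hsplit : {p : V × V | Extends H j p.1 p.2} =
      {p | pos p.2 = pos p.1 + 1 ∧ pos p.1 ∈ windows X j} ∪
      {p | pos p.1 = pos p.2 + 1 ∧ pos p.2 - j ∈ windows X j} := by
    ext ⟨u, w⟩
    simp only [Set.mem_ofPred_eq, Set.mem_union]
    constructor
    · intro h1
      rcases (h.adj _ _).1 h1.adj with h2 | h2
      · exact Or.inl ⟨h2.1, (h.extends_right h2.1).1 h1⟩
      · exact Or.inr ⟨h2.1, (h.extends_left h2.1).1 h1⟩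
    · rintro (h1 | h1)
      · exact (h.extends_right h1.1).2 h1.2
      · exact (h.extends_left h1.1).2 h1.2
  rw [dartCount, hsplit, Set.ncard_union_eq, two_mul]
  · congr 1
    · refine Set.ncard_congr (fun p _ => pos p.1) (fun p hp => hp.2) ?_ ?_
      · rintro ⟨u, w⟩ ⟨u', w'⟩ h1 h2 e
        have e' : pos w = pos w' := by rw [h1.1, h2.1]; exact congrArg (· + 1) e
        exact Prod.ext (h.inj e) (h.inj e')
      · intro c hc
        obtain ⟨x, y, h1, h2⟩ := h.exists_pos c (by simpa using hc 0 (by omega))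
        exact ⟨(x, y), ⟨by rw [h2, h1], by rwa [h1]⟩, h1⟩
    · refine Set.ncard_congr (fun p _ => pos p.2 - j) (fun p hp => hp.2) ?_ ?_
      · rintro ⟨u, w⟩ ⟨u', w'⟩ h1 h2 e
        have e1 : pos w = pos w' := sub_left_injective e
        have e' : pos u = pos u' := by rw [h1.1, h2.1]; exact congrArg (· + 1) e1
        rw [h.inj e1, h.inj e']
      · intro c hc
        obtain ⟨x, y, h1, h2⟩ := h.exists_pos (c + j) (hc j le_rfl)
        exact ⟨(y, x), ⟨by rw [h2, h1], by rw [h1]; simpa using hc⟩, by rw [h1]; ring⟩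
  · rw [Set.disjoint_left]
    rintro ⟨u, w⟩ h1 h2
    exact h.two_ne (by linear_combination -h1.1 - h2.1)

end Placed

end Walks

end SymGame

namespace SymGame

set_option linter.unusedSectionVars false

/-! ### Isomorphism forces an admissible answer -/

section Counting

variable {G : Type*} [CommRing G]

/-- Maximal blocks of `X` of lengths `l` and `r` to the left and to the right of `a`. -/
structure Flanks (X : Set G) (a : G) (l r : ℕ) : Prop where
  left : ∀ i : ℕ, 1 ≤ i → i ≤ l → a - i ∈ X
  right : ∀ i : ℕ, 1 ≤ i → i ≤ r → a + i ∈ X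
  left_end : a - (l + 1 : ℕ) ∉ X
  right_end : a + (r + 1 : ℕ) ∉ X

theorem Flanks.arms {X : Set G} {a : G} {l r : ℕ} (h : Flanks X a l r) : Arms X a l r := by
  refine ⟨_, isLine_add a, by simp, fun i h1 h2 => ?_, ?_, fun i h1 h2 => ?_, ?_⟩
  · have := h.right i.toNat (by omega) (by omega)
    rwa [← Int.cast_natCast, show ((i.toNat : ℕ) : ℤ) = i by omega] at this
  · have := h.right_end
    rwa [← Int.cast_natCast, Nat.cast_succ] at this
  · have := h.left i.toNat (by omega) (by omega)
    rw [← Int.cast_natCast, show ((i.toNat : ℕ) : ℤ) = i by omega] at this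
    simpa [sub_eq_add_neg] using this
  · have := h.left_end
    convert this using 2
    push_cast
    ring

theorem Arms.symm {X : Set G} {a : G} {l r : ℤ} (h : Arms X a l r) : Arms X a r l := by
  obtain ⟨f, hf, h0, h1, h2, h3, h4⟩ := h
  refine ⟨fun i => f (0 - i), hf.flip 0, by simpa using h0, fun i h5 h6 => ?_, ?_, fun i h5 h6 => ?_, ?_⟩
  · simpa using h3 i h5 h6
  · show f (0 - (l + 1)) ∉ X
    rwa [show 0 - (l + 1) = -l - 1 by ring]
  · simpa using h1 i h5 h6
  · show f (0 - (-r - 1)) ∉ X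
    rwa [show 0 - (-r - 1) = r + 1 by ring]

theorem Arms.flanks {X : Set G} {a : G} {l r : ℕ} (h : Arms X a l r) :
    Flanks X a l r ∨ Flanks X a r l := by
  obtain ⟨f, ⟨c, δ, hδ, hf⟩, h0, h1, h2, h3, h4⟩ := h
  have hc : c = a := by rw [← h0, hf]; simp
  subst hc
  rcases hδ with rfl | rfl
  · left
    refine ⟨fun i h5 h6 => ?_, fun i h5 h6 => ?_, ?_, ?_⟩
    · have := h3 i (by omega) (by omega)
      rw [hf] at this
      convert this using 1; push_cast; ring
    · have := h1 i (by omega) (by omega)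
      rw [hf] at this
      convert this using 1; push_cast; ring
    · rw [hf] at h4
      convert h4 using 2; push_cast; ring
    · rw [hf] at h2
      convert h2 using 2; push_cast; ring
  · right
    refine ⟨fun i h5 h6 => ?_, fun i h5 h6 => ?_, ?_, ?_⟩
    · have := h1 i (by omega) (by omega)
      rw [hf] at this
      convert this using 1; push_cast; ring
    · have := h3 i (by omega) (by omega)
      rw [hf] at this
      convert this using 1; push_cast; ring
    · rw [hf] at h2
      convert h2 using 2; push_cast; ring
    · rw [hf] at h4
      convert h4 using 2; push_cast; ring

/-- If the cells after `b` never left the finite set `B`, two of them would coincide, and going back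
by the period would show `b ∈ B`. -/
theorem exists_end {B : Set G} (hB : B.Finite) {b : G} (hb : b ∉ B) (δ : G) :
    ∃ r : ℕ, (∀ i : ℕ, 1 ≤ i → i ≤ r → b + i * δ ∈ B) ∧ b + (r + 1 : ℕ) * δ ∉ B := by
  classical
  have hex : ∃ r : ℕ, b + (r + 1 : ℕ) * δ ∉ B := by
    by_contra hc
    push Not at hc
    have : ¬ Function.Injective fun r : ℕ => b + (r + 1 : ℕ) * δ := fun hinj =>
      Set.infinite_range_of_injective hinj (hB.subset (Set.range_subset_iff.2 hc))
    have : ∃ r r' : ℕ, r < r' ∧ b + (r + 1 : ℕ) * δ = b + (r' + 1 : ℕ) * δ := by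
      simp only [Function.Injective, not_forall] at this
      obtain ⟨r, r', h1, h2⟩ := this
      rcases lt_or_gt_of_ne h2 with h | h
      · exact ⟨r, r', h, h1⟩
      · exact ⟨r', r, h, h1.symm⟩
    obtain ⟨r, r', h1, h2⟩ := this
    apply hb
    have := hc (r' - r - 1)
    rw [show r' - r - 1 + 1 = r' - r by omega, Nat.cast_sub h1.le] at this
    convert this using 1
    push_cast at h2
    linear_combination h2
  refine ⟨Nat.find hex, fun i h1 h2 => ?_, Nat.find_spec hex⟩
  have := Nat.find_min hex (m := i - 1) (by omega)
  rwa [not_not, show i - 1 + 1 = i by omega] at this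

theorem exists_flanks {B : Set G} (hB : B.Finite) {b : G} (hb : b ∉ B) : ∃ l r, Flanks B b l r := by
  obtain ⟨r, h1, h2⟩ := exists_end hB hb 1
  obtain ⟨l, h3, h4⟩ := exists_end hB hb (-1)
  refine ⟨l, r, fun i h5 h6 => ?_, fun i h5 h6 => ?_, ?_, ?_⟩
  · simpa [sub_eq_add_neg] using h3 i h5 h6
  · simpa using h1 i h5 h6
  · simpa [sub_eq_add_neg] using h4
  · simpa using h2

/-- The offsets of the blocks of `j + 1` cells around a cell with flanks `l` and `r`. -/
def offsets (j l r : ℕ) : Set ℕ := {t | t ≤ j ∧ t ≤ l ∧ j ≤ t + r}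

theorem finite_offsets (j l r : ℕ) : (offsets j l r).Finite :=
  (Set.finite_Iic j).subset fun _ h => h.1

theorem ncard_offsets_eq_zero {j l r : ℕ} : (offsets j l r).ncard = 0 ↔ l + r < j := by
  rw [Set.ncard_eq_zero (finite_offsets j l r), Set.eq_empty_iff_forall_notMem]
  constructor
  · intro h
    by_contra hc
    exact h (min j l) ⟨by omega, by omega, by omega⟩
  · rintro h t ⟨h1, h2, h3⟩
    omega

theorem ncard_offsets_eq_succ {j l r : ℕ} : (offsets j l r).ncard = j + 1 ↔ j ≤ l ∧ j ≤ r := by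
  have hI : (Set.Iic j).ncard = j + 1 := by
    rw [← Nat.card_coe_set_eq, Nat.card_eq_fintype_card]; simp
  rw [← hI]
  constructor
  · intro h
    have e := Set.eq_of_subset_of_ncard_le (fun _ h => h.1 : offsets j l r ⊆ Set.Iic j) h.ge
      (Set.finite_Iic j)
    have h1 : j ∈ offsets j l r := e ▸ (le_refl j : j ∈ Set.Iic j)
    have h2 : 0 ∈ offsets j l r := e ▸ (Nat.zero_le j : 0 ∈ Set.Iic j)
    exact ⟨h1.2.1, by simpa using h2.2.2⟩
  · rintro ⟨h1, h2⟩
    congr 1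
    ext t
    simp only [offsets, Set.mem_ofPred_eq, Set.mem_Iic]
    omega

/-- The count vanishes exactly for `j > l + r` and is maximal, `j + 1`, exactly for `j ≤ min l r`;
so it determines the sum and the minimum, hence the unordered pair. -/
theorem eq_or_swap_of_offsets {l r l' r' : ℕ}
    (h : ∀ j, (offsets j l r).ncard = (offsets j l' r').ncard) :
    (l = l' ∧ r = r') ∨ (l = r' ∧ r = l') := by
  have h1 : ∀ j, l + r < j ↔ l' + r' < j := fun j => by
    rw [← ncard_offsets_eq_zero, ← ncard_offsets_eq_zero, h]
  have h2 : ∀ j, (j ≤ l ∧ j ≤ r) ↔ (j ≤ l' ∧ j ≤ r') := fun j => by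
    rw [← ncard_offsets_eq_succ, ← ncard_offsets_eq_succ, h]
  have a1 := h1 (l + r + 1)
  have a2 := h1 (l' + r' + 1)
  have a3 := h2 (min l r)
  have a4 := h2 (min l' r')
  omega

theorem finite_windows {X : Set G} (hX : X.Finite) (j : ℕ) : (windows X j).Finite :=
  hX.subset fun _ h => by simpa using h 0 (Nat.zero_le j)

/-- The number of new blocks after the addition of a cell. -/
theorem Flanks.ncard_windows {R : Set G} {a : G} {l r : ℕ} (h : Flanks R a l r) (hR : R.Finite)
    (ha : a ∉ R) (hs : Function.Surjective (Int.cast : ℤ → G)) {b : G} (hb : b ∉ insert a R) (j : ℕ) :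
    (windows (insert a R) j).ncard = (windows R j).ncard + (offsets j l r).ncard := by
  obtain ⟨m, hm⟩ := hs (b - a)
  -- Otherwise the cells `a, a + 1, …, a + r` would already make up the whole ring, and `b` would be
  -- one of them.
  have hr0 : ((r + 1 : ℕ) : G) ≠ 0 := by
    intro h0
    apply hb
    have e : b = a + ((m % (r + 1)).toNat : ℕ) := by
      rw [← Int.cast_natCast, Int.toNat_of_nonneg (Int.emod_nonneg _ (by omega)), Int.emod_def]
      push_cast at h0 ⊢
      rw [h0, hm]; ring
    have hlt := Int.emod_lt_of_pos m (show (0 : ℤ) < r + 1 by omega)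
    rcases Nat.eq_zero_or_pos (m % (r + 1)).toNat with h1 | h1
    · rw [h1] at e
      left; simpa using e
    · right; rw [e]; exact h.right _ h1 (by omega)
  have hl0 : ((l + 1 : ℕ) : G) ≠ 0 := by
    intro h0
    apply hb
    have e : b = a - ((-m % (l + 1)).toNat : ℕ) := by
      rw [← Int.cast_natCast, Int.toNat_of_nonneg (Int.emod_nonneg _ (by omega)), Int.emod_def]
      push_cast at h0 ⊢
      rw [h0, hm]; ring
    have hlt := Int.emod_lt_of_pos (-m) (show (0 : ℤ) < l + 1 by omega)
    rcases Nat.eq_zero_or_pos (-m % (l + 1)).toNat with h1 | h1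
    · rw [h1] at e
      left; simpa using e
    · right; rw [e]; exact h.left _ h1 (by omega)
  -- The new blocks are those containing `a`; they are indexed by the offset `t` of `a` from their
  -- first cell.
  have hsplit : windows (insert a R) j = windows R j ∪ (fun t : ℕ => a - (t : G)) '' offsets j l r := by
    ext p
    constructor
    · intro hp
      by_cases hall : p ∈ windows R j
      · exact Or.inl hall
      right
      simp only [windows, Set.mem_ofPred_eq, not_forall] at hall
      obtain ⟨t, h1, h2⟩ := hall
      have e : p + t = a := (hp t h1).resolve_right h2
      refine ⟨t, ⟨h1, ?_, ?_⟩, by simp only [← e]; ring⟩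
      · by_contra hc
        have := hp (t - (l + 1)) (by omega)
        rw [Nat.cast_sub (by omega), show p + ((t : G) - (l + 1 : ℕ)) = a - (l + 1 : ℕ) by rw [← e]; ring]
          at this
        rcases this with h3 | h3
        · exact hl0 (by linear_combination -h3)
        · exact h.left_end h3
      · by_contra hc
        have := hp (t + (r + 1)) (by omega)
        rw [Nat.cast_add, ← add_assoc, e] at this
        rcases this with h3 | h3
        · exact hr0 (by linear_combination h3)
        · exact h.right_end h3
    · rintro (hp | ⟨t, ⟨h1, h2, h3⟩, rfl⟩)
      · exact fun i hi => Or.inr (hp i hi)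
      · intro i hi
        rcases lt_trichotomy i t with h4 | rfl | h4
        · right
          have := h.left (t - i) (by omega) (by omega)
          rw [Nat.cast_sub h4.le] at this
          convert this using 1; ring
        · left; ring
        · right
          have := h.right (i - t) (by omega) (by omega)
          rw [Nat.cast_sub h4.le] at this
          convert this using 1; ring
  have hinj : Set.InjOn (fun t : ℕ => a - (t : G)) (offsets j l r) := by
    have aux : ∀ t t' : ℕ, t < t' → t' ≤ l → a - (t : G) ≠ a - (t' : G) := by
      intro t t' h1 h2 e
      apply h.left_end
      have := h.left (l + 1 - (t' - t)) (by omega) (by omega)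
      rw [Nat.cast_sub (by omega), Nat.cast_sub h1.le] at this
      convert this using 1
      linear_combination -e
    intro t ht t' ht' e
    rcases lt_trichotomy t t' with h1 | h1 | h1
    · exact (aux t t' h1 ht'.2.1 e).elim
    · exact h1
    · exact (aux t' t h1 ht.2.1 e.symm).elim
  rw [hsplit, Set.ncard_union_eq ?_ (finite_windows hR j) ((finite_offsets j l r).image _),
    hinj.ncard_image]
  rw [Set.disjoint_left]
  rintro _ hp ⟨t, ht, rfl⟩
  apply ha
  simpa using hp t ht.1

/-- If the numbers of blocks of each length agree before and after a round, the answer was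
admissible. -/
theorem reply_of_ncard_windows {R B : Set G} {a b : G} (hR : R.Finite) (hB : B.Finite) (ha : a ∉ R)
    (hb : b ∉ B) (hab : b ∉ insert a R) (hba : a ∉ insert b B)
    (hs : Function.Surjective (Int.cast : ℤ → G))
    (h : ∀ j, (windows R j).ncard = (windows B j).ncard)
    (h' : ∀ j, (windows (insert a R) j).ncard = (windows (insert b B) j).ncard) : Reply R B a b := by
  obtain ⟨l', r', hf'⟩ := exists_flanks hB hb
  have key : ∀ l r, Flanks R a l r → Arms B b l r := by
    intro l r hf
    have := eq_or_swap_of_offsets (l := l) (r := r) (l' := l') (r' := r') fun j => by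
      have h1 := hf.ncard_windows hR ha hs hab j
      have h2 := hf'.ncard_windows hB hb hs hba j
      have h3 := h j
      have h4 := h' j
      omega
    rcases this with ⟨rfl, rfl⟩ | ⟨rfl, rfl⟩
    · exact hf'.arms
    · exact hf'.arms.symm
  intro l r hl hr harm
  lift l to ℕ using hl
  lift r to ℕ using hr
  rcases harm.flanks with hf | hf
  · exact key l r hf
  · exact (key r l hf).symm

end Counting

/-! ### Graphs whose edges are cells -/

section Boards

variable {V : Type*} {Γ : SimpleGraph V} {G : Type*} [CommRing G]

/-- Positions of the vertices of a path or a cycle, such that each edge joins the vertices at its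
cell and the next one. -/
structure Board (Γ : SimpleGraph V) (G : Type*) [CommRing G] where
  /-- The position of a vertex. -/
  pos : V → G
  /-- The cell of an edge. -/
  cell : Γ.edgeSet → G
  two_ne : (2 : G) ≠ 0
  inj : Function.Injective pos
  ends : ∀ e : Γ.edgeSet, ∃ x y, (e : Sym2 V) = s(x, y) ∧ pos x = cell e ∧ pos y = cell e + 1

namespace Board

variable (b : Board Γ G)

theorem cell_injective : Function.Injective b.cell := by
  intro e e' h
  obtain ⟨x, y, h1, h2, h3⟩ := b.ends e
  obtain ⟨x', y', h1', h2', h3'⟩ := b.ends e'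
  have hx : x = x' := b.inj (by rw [h2, h2', h])
  have hy : y = y' := b.inj (by rw [h3, h3', h])
  exact Subtype.ext (by rw [h1, h1', hx, hy])

/-- The cells of a list of edges. -/
def cells (l : List Γ.edgeSet) : Set G := {c | ∃ e ∈ l, b.cell e = c}

theorem cells_cons (e : Γ.edgeSet) (l : List Γ.edgeSet) :
    b.cells (e :: l) = insert (b.cell e) (b.cells l) := by
  ext c
  simp [cells, eq_comm]

theorem cells_nil : b.cells [] = ∅ := by
  simp [cells]

theorem cell_mem_cells {e : Γ.edgeSet} {l : List Γ.edgeSet} : b.cell e ∈ b.cells l ↔ e ∈ l :=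
  ⟨fun ⟨_, h, h'⟩ => b.cell_injective h' ▸ h, fun h => ⟨e, h, rfl⟩⟩

theorem finite_cells (l : List Γ.edgeSet) : (b.cells l).Finite := by
  classical
  exact (l.toFinset.finite_toSet.image b.cell).subset fun c ⟨e, h, h'⟩ => ⟨e, by simpa using h, h'⟩

theorem placed (l : List Γ.edgeSet) :
    Placed (SimpleGraph.fromEdgeSet (edges l)) b.pos (b.cells l) := by
  refine ⟨b.two_ne, b.inj, fun x y => ?_, ?_⟩
  · rw [SimpleGraph.fromEdgeSet_adj]
    have aux : ∀ x y, b.pos y = b.pos x + 1 → b.pos x ∈ b.cells l → s(x, y) ∈ edges l := by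
      rintro x y h1 ⟨e, he, h2⟩
      obtain ⟨x', y', h3, h4, h5⟩ := b.ends e
      have hx : x' = x := b.inj (by rw [h4, h2])
      have hy : y' = y := b.inj (by rw [h5, h2, h1])
      exact ⟨e, he, by rw [h3, hx, hy]⟩
    constructor
    · rintro ⟨⟨e, he, h1⟩, -⟩
      obtain ⟨x', y', h3, h4, h5⟩ := b.ends e
      rw [h1, Sym2.eq_iff] at h3
      rcases h3 with ⟨rfl, rfl⟩ | ⟨rfl, rfl⟩
      · exact Or.inl ⟨by rw [h4, h5], ⟨e, he, h4.symm⟩⟩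
      · exact Or.inr ⟨by rw [h4, h5], ⟨e, he, h4.symm⟩⟩
    · have hone : ∀ p : G, p ≠ p + 1 := fun p hp => b.two_ne (by linear_combination -2 * hp)
      rintro (⟨h1, h2⟩ | ⟨h1, h2⟩)
      · exact ⟨aux x y h1 h2, fun h => hone _ (h ▸ h1)⟩
      · exact ⟨Sym2.eq_swap ▸ aux y x h1 h2, fun h => hone _ (h ▸ h1)⟩
  · rintro _ ⟨e, -, rfl⟩
    obtain ⟨x, y, -, h1, h2⟩ := b.ends e
    exact ⟨x, y, h1, h2⟩

theorem ncard_windows_eq [Finite V] {as bs : List Γ.edgeSet} (h : EdgeSetsIso (edges as) (edges bs))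
    (j : ℕ) : (windows (b.cells as) j).ncard = (windows (b.cells bs) j).ncard := by
  have := h.dartCount_eq j
  rw [(b.placed as).dartCount_eq, (b.placed bs).dartCount_eq] at this
  omega

/-- The invariant is that 𝒜 wins the game on cells within the remaining rounds. Isomorphism before
and after a round makes the block counts agree, so the actual answer is a `Reply`, to which `AWins`
applies. -/
theorem gameLength_lt [Finite V] [Nonempty Γ.edgeSet] (hs : Function.Surjective (Int.cast : ℤ → G))
    {T : ℕ} (h : AWins (Set.range b.cell) T ∅ ∅) : gameLength Γ < T := by
  refine SymGame.gameLength_lt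
    (fun as bs => AWins (Set.range b.cell) (T - as.length) (b.cells as) (b.cells bs)) ?_ ?_ ?_
  · simpa [cells_nil] using h
  · intro as bs hw hlt hiso
    obtain ⟨k, hk⟩ : ∃ k, T - as.length = k + 1 := ⟨T - as.length - 1, by omega⟩
    rw [hk] at hw
    obtain ⟨_, ha, hw⟩ := hw
    rw [mem_free] at ha
    obtain ⟨⟨a, rfl⟩, ha, ha'⟩ := ha
    rw [cell_mem_cells] at ha ha'
    refine ⟨a, ha, ha', fun c hc hc' hiso' => ?_⟩
    have hca : c ≠ a := fun h => hc (h ▸ List.mem_cons_self)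
    have e : T - (a :: as).length = k := by rw [List.length_cons]; omega
    show AWins _ (T - (a :: as).length) _ _
    rw [e, cells_cons, cells_cons]
    refine hw _ (mem_free.2 ⟨⟨c, rfl⟩, ?_, ?_⟩) (b.cell_injective.ne hca) ?_
    · rw [cell_mem_cells]; exact fun h => hc (List.mem_cons_of_mem _ h)
    · rwa [cell_mem_cells]
    · refine reply_of_ncard_windows (b.finite_cells _) (b.finite_cells _) (by rwa [cell_mem_cells])
        (by rwa [cell_mem_cells]) ?_ ?_ hs (b.ncard_windows_eq hiso) ?_
      · rwa [← cells_cons, cell_mem_cells]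
      · rw [← cells_cons, cell_mem_cells, List.mem_cons, not_or]
        exact ⟨hca.symm, ha'⟩
      · intro j
        rw [← cells_cons, ← cells_cons]
        exact b.ncard_windows_eq hiso' j
  · intro as bs hw
    by_contra hc
    have hw' : AWins (Set.range b.cell) (T - as.length) (b.cells as) (b.cells bs) := hw
    rw [show T - as.length = 0 by omega] at hw'
    exact hw'

end Board

end Boards

end SymGame

namespace SymGame

set_option linter.unusedSectionVars false

/-! ### The path and the cycle as boards; upper bounds -/

section Concrete

variable {V : Type*} {Γ : SimpleGraph V} {G : Type*} [CommRing G]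

/-- The board of a graph in which adjacent vertices have consecutive positions. -/
noncomputable def Board.ofPos (pos : V → G) (hinj : Function.Injective pos) (h2 : (2 : G) ≠ 0)
    (hadj : ∀ x y, Γ.Adj x y → pos y = pos x + 1 ∨ pos x = pos y + 1) : Board Γ G :=
  have h : ∀ e : Γ.edgeSet, ∃ c x y, (e : Sym2 V) = s(x, y) ∧ pos x = c ∧ pos y = c + 1 := by
    rintro ⟨e, he⟩
    induction e using Sym2.ind with
    | _ x y =>
      rcases hadj x y he with h | h
      · exact ⟨_, x, y, rfl, rfl, h⟩
      · exact ⟨_, y, x, Sym2.eq_swap, rfl, h⟩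
  { pos := pos, cell := fun e => (h e).choose, two_ne := h2, inj := hinj,
    ends := fun e => (h e).choose_spec }

theorem Board.mem_range_cell (b : Board Γ G) {c : G} :
    c ∈ Set.range b.cell ↔ ∃ x y, Γ.Adj x y ∧ b.pos x = c ∧ b.pos y = c + 1 := by
  constructor
  · rintro ⟨e, rfl⟩
    obtain ⟨x, y, h1, h2, h3⟩ := b.ends e
    refine ⟨x, y, ?_, h2, h3⟩
    have := e.2
    rwa [h1] at this
  · rintro ⟨x, y, h1, h2, h3⟩
    refine ⟨⟨s(x, y), h1⟩, ?_⟩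
    obtain ⟨x', y', h4, h5, h6⟩ := b.ends ⟨s(x, y), h1⟩
    rcases Sym2.eq_iff.1 h4 with ⟨rfl, rfl⟩ | ⟨rfl, rfl⟩
    · rw [← h5, h2]
    · exact (b.two_ne (by linear_combination h2 - h6 + h5 - h3)).elim

theorem Board.size_eq (b : Board Γ G) : size Γ = Nat.card (Set.range b.cell) :=
  (Nat.card_range_of_injective b.cell_injective).symm

/-- The board of a path. -/
noncomputable def pathBoard (n : ℕ) : Board (SimpleGraph.pathGraph (n + 1)) ℤ :=
  Board.ofPos (fun x => (x.val : ℤ)) (fun x y h => Fin.ext (by simpa using h)) two_ne_zero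
    fun x y h => by rw [SimpleGraph.pathGraph_adj] at h; omega

theorem range_pathBoard (n : ℕ) : Set.range (pathBoard n).cell = Set.Ico (0 : ℤ) n := by
  ext c
  rw [Board.mem_range_cell, Set.mem_Ico]
  constructor
  · rintro ⟨x, y, -, h1, h2⟩
    have e1 : (x.val : ℤ) = c := h1
    have e2 : (y.val : ℤ) = c + 1 := h2
    omega
  · rintro ⟨h1, h2⟩
    refine ⟨⟨c.toNat, by omega⟩, ⟨c.toNat + 1, by omega⟩, ?_, ?_, ?_⟩
    · rw [SimpleGraph.pathGraph_adj]; exact Or.inl rfl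
    · show ((c.toNat : ℕ) : ℤ) = c
      omega
    · show ((c.toNat + 1 : ℕ) : ℤ) = c + 1
      omega

theorem size_path (n : ℕ) : size (SimpleGraph.pathGraph (n + 1)) = n := by
  rw [(pathBoard n).size_eq, range_pathBoard]
  simp

theorem nonempty_path {n : ℕ} (hn : 0 < n) : Nonempty (SimpleGraph.pathGraph (n + 1)).edgeSet :=
  (Nat.card_pos_iff.1 (hn.trans_eq (size_path n).symm)).1

theorem gameLengthPath_lt {n I : ℕ} (hn : Odd n) (hI : n ≤ 13 * 2 ^ I) (hN : 6 * I + 60 ≤ n) :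
    gameLengthPath n < 2 * (I + 3) ^ 2 + 3 * I + 26 := by
  have := nonempty_path (n := n) (by omega)
  refine (pathBoard n).gameLength_lt (fun x => ⟨x, rfl⟩) ?_
  rw [range_pathBoard]
  obtain ⟨N, rfl⟩ := hn
  have h := awins_interval (N := N) (I := I) (by exact_mod_cast (show N ≤ 13 * 2 ^ I by omega)) (by omega)
  push_cast
  exact h

/-- The board of a cycle. -/
noncomputable def cycleBoard (m : ℕ) : Board (SimpleGraph.cycleGraph (m + 3)) (ZMod (m + 3)) :=
  Board.ofPos (fun x : Fin (m + 3) => (x : ZMod (m + 3))) (fun _ _ h => h)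
    (fun h => by
      have h' : ((2 : ℕ) : ZMod (m + 3)) = 0 := by exact_mod_cast h
      rw [ZMod.natCast_eq_zero_iff] at h'
      have := Nat.le_of_dvd two_pos h'
      omega)
    fun x y h => by
      rw [SimpleGraph.cycleGraph_adj] at h
      rcases h with h | h
      · exact Or.inr ((sub_eq_iff_eq_add'.1 h).trans (by rfl))
      · exact Or.inl ((sub_eq_iff_eq_add'.1 h).trans (by rfl))

theorem range_cycleBoard (m : ℕ) : Set.range (cycleBoard m).cell = Set.univ := by
  ext c
  rw [Board.mem_range_cell]
  refine ⟨fun _ => trivial, fun _ => ?_⟩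
  let x : Fin (m + 3) := c
  refine ⟨x, x + 1, ?_, rfl, rfl⟩
  rw [SimpleGraph.cycleGraph_adj]
  exact Or.inr (add_sub_cancel_left x 1)

theorem size_cycle (m : ℕ) : size (SimpleGraph.cycleGraph (m + 3)) = m + 3 := by
  rw [(cycleBoard m).size_eq, range_cycleBoard, Nat.card_univ, Nat.card_zmod]

theorem nonempty_cycle (m : ℕ) : Nonempty (SimpleGraph.cycleGraph (m + 3)).edgeSet :=
  (Nat.card_pos_iff.1 ((Nat.succ_pos _).trans_eq (size_cycle m).symm)).1

theorem gameLengthCycle_lt {n I : ℕ} (hn : Odd n) (hI : n ≤ 13 * 2 ^ I) (hN : 30 * I + 300 ≤ n) :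
    gameLengthCycle n < 2 * (I + 3) ^ 2 + 4 * I + 36 := by
  obtain ⟨m, rfl⟩ : ∃ m, n = m + 3 := ⟨n - 3, by omega⟩
  have := nonempty_cycle m
  have : Fact (1 < m + 3) := ⟨by omega⟩
  refine (cycleBoard m).gameLength_lt ZMod.intCast_surjective ?_
  rw [range_cycleBoard]
  exact awins_cycle hn (by exact_mod_cast hI) hN

end Concrete

end SymGame

namespace SymGame

set_option linter.unusedSectionVars false

/-! ### Isomorphism from coincidences of endpoints -/

section Isomorphism

variable {V : Type*} {ι : Type*}

/-- The edges of a family of ordered pairs of vertices. -/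
def pairEdges (α : ι × Bool → V) : Set (Sym2 V) := {e | ∃ i, e = s(α (i, false), α (i, true))}

theorem mem_support_pairEdges {α : ι × Bool → V} (hα : ∀ i, α (i, false) ≠ α (i, true)) {v : V} :
    v ∈ (SimpleGraph.fromEdgeSet (pairEdges α)).support ↔ ∃ p, α p = v := by
  rw [SimpleGraph.mem_support]
  simp only [SimpleGraph.fromEdgeSet_adj]
  constructor
  · rintro ⟨w, ⟨i, h⟩, -⟩
    rcases Sym2.eq_iff.1 h with ⟨h1, -⟩ | ⟨h1, -⟩
    · exact ⟨_, h1.symm⟩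
    · exact ⟨_, h1.symm⟩
  · rintro ⟨⟨i, _ | _⟩, rfl⟩
    · exact ⟨_, ⟨i, rfl⟩, hα i⟩
    · exact ⟨_, ⟨i, Sym2.eq_swap⟩, (hα i).symm⟩

/-- Two families of ordered edges with the same coincidences among the endpoints form isomorphic
graphs. -/
theorem edgeSetsIso_pairEdges {α β : ι × Bool → V} (hα : ∀ i, α (i, false) ≠ α (i, true))
    (h : ∀ p q, α p = α q ↔ β p = β q) : EdgeSetsIso (pairEdges α) (pairEdges β) := by
  have hβ : ∀ i, β (i, false) ≠ β (i, true) := fun i e => hα i ((h _ _).2 e)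
  have aux : ∀ {α β : ι × Bool → V}, (∀ i, α (i, false) ≠ α (i, true)) →
      (∀ i, β (i, false) ≠ β (i, true)) → (∀ p q, α p = α q → β p = β q) →
      ∃ φ : (SimpleGraph.fromEdgeSet (pairEdges α)).support →
        (SimpleGraph.fromEdgeSet (pairEdges β)).support,
        ∀ p hp, (φ ⟨α p, hp⟩ : V) = β p := by
    intro α β hα hβ h
    choose f hf using fun v : (SimpleGraph.fromEdgeSet (pairEdges α)).support =>
      (mem_support_pairEdges hα).1 v.2
    exact ⟨fun v => ⟨β (f v), (mem_support_pairEdges hβ).2 ⟨_, rfl⟩⟩, fun p hp => h _ _ (hf _)⟩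
  obtain ⟨φ, hφ⟩ := aux hα hβ fun p q => (h p q).1
  obtain ⟨ψ, hψ⟩ := aux hβ hα fun p q => (h p q).2
  have hφψ : Function.LeftInverse ψ φ := by
    rintro ⟨v, hv⟩
    obtain ⟨p, rfl⟩ := (mem_support_pairEdges hα).1 hv
    apply Subtype.ext
    have e : φ ⟨α p, hv⟩ = ⟨β p, (mem_support_pairEdges hβ).2 ⟨p, rfl⟩⟩ := Subtype.ext (hφ p hv)
    rw [e, hψ]
  have hψφ : Function.RightInverse ψ φ := by
    rintro ⟨v, hv⟩
    obtain ⟨p, rfl⟩ := (mem_support_pairEdges hβ).1 hv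
    apply Subtype.ext
    have e : ψ ⟨β p, hv⟩ = ⟨α p, (mem_support_pairEdges hα).2 ⟨p, rfl⟩⟩ := Subtype.ext (hψ p hv)
    rw [e, hφ]
  refine ⟨⟨⟨φ, ψ, hφψ, hψφ⟩, ?_⟩⟩
  rintro ⟨v, hv⟩ ⟨w, hw⟩
  obtain ⟨p, rfl⟩ := (mem_support_pairEdges hα).1 hv
  obtain ⟨q, rfl⟩ := (mem_support_pairEdges hα).1 hw
  show (SimpleGraph.fromEdgeSet (pairEdges β)).Adj (φ ⟨α p, hv⟩) (φ ⟨α q, hw⟩) ↔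
    (SimpleGraph.fromEdgeSet (pairEdges α)).Adj (α p) (α q)
  rw [hφ, hφ, SimpleGraph.fromEdgeSet_adj, SimpleGraph.fromEdgeSet_adj]
  refine and_congr (exists_congr fun i => ?_) (not_congr (h p q).symm)
  rw [Sym2.eq_iff, Sym2.eq_iff, h, h, h, h]

end Isomorphism

/-! ### Local reflections: the second player's strategy -/

section Reflection

variable {G : Type*} [CommRing G]

/-- The pairing `T` of cells is a reflection on every block of at most `2 ^ (ρ + 1)` consecutive cells,
and no reflection of a short block has a cell as its centre. -/
structure LocalReflection (T : Set (G × G)) (ρ : ℕ) : Prop where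
  symm : ∀ x x', (x, x') ∈ T → (x', x) ∈ T
  reflect : ∀ x x' y y' (d : ℤ), (x, x') ∈ T → (y, y') ∈ T → |d| ≤ 2 ^ (ρ + 1) - 1 → y = x + d →
    y' = x' - d
  odd : ∀ x x' (d : ℤ), (x, x') ∈ T → |d| ≤ 4 * (2 ^ ρ - 1) → x' = x + d → Odd d

/-- Old pairs satisfy the conditions even with the larger radius, so only conditions involving the
new pair, `hr` and `ho`, have to be supplied. -/
theorem LocalReflection.pair {T : Set (G × G)} {ρ : ℕ} (H : LocalReflection T (ρ + 1)) {a b : G}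
    (hr : ∀ x x' (d : ℤ), (x, x') ∈ T → |d| ≤ 2 ^ (ρ + 1) - 1 → (x = a + d → x' = b - d) ∧
      (x = b + d → x' = a - d))
    (ho : ∀ d : ℤ, |d| ≤ 4 * (2 ^ ρ - 1) → b = a + d → Odd d) :
    LocalReflection (insert (a, b) (insert (b, a) T)) ρ := by
  have h2 : (2 : ℤ) ^ (ρ + 1 + 1) = 2 * 2 ^ (ρ + 1) := by ring
  have h2' : (2 : ℤ) ^ (ρ + 1) = 2 * 2 ^ ρ := by ring
  have hpos : (0 : ℤ) < 2 ^ ρ := by positivity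
  refine ⟨?_, ?_, ?_⟩
  · intro x x' h
    simp only [Set.mem_insert_iff, Prod.mk.injEq] at h ⊢
    rcases h with ⟨rfl, rfl⟩ | ⟨rfl, rfl⟩ | h
    · simp
    · simp
    · exact Or.inr (Or.inr (H.symm _ _ h))
  · intro x x' y y' d hx hy hd e
    simp only [Set.mem_insert_iff, Prod.mk.injEq] at hx hy
    have hd' : |-d| ≤ 2 ^ (ρ + 1) - 1 := by rwa [abs_neg]
    rcases hx with ⟨rfl, rfl⟩ | ⟨rfl, rfl⟩ | hx <;> rcases hy with ⟨rfl, rfl⟩ | ⟨rfl, rfl⟩ | hy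
    · linear_combination -e
    · linear_combination -e
    · exact (hr y y' d hy hd).1 e
    · linear_combination -e
    · linear_combination -e
    · exact (hr y y' d hy hd).2 e
    · have := (hr x x' (-d) hx hd').1 (by rw [e]; push_cast; ring)
      rw [this]; push_cast; ring
    · have := (hr x x' (-d) hx hd').2 (by rw [e]; push_cast; ring)
      rw [this]; push_cast; ring
    · exact H.reflect x x' y y' d hx hy (by omega) e
  · intro x x' d hx hd e
    simp only [Set.mem_insert_iff, Prod.mk.injEq] at hx
    rcases hx with ⟨rfl, rfl⟩ | ⟨rfl, rfl⟩ | hx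
    · exact ho d hd e
    · have := ho (-d) (by rwa [abs_neg]) (by rw [e]; push_cast; ring)
      simpa using this
    · exact H.odd x x' d hx (by omega) e

/-- The answer of the second player to a new cell. -/
theorem LocalReflection.step {T : Set (G × G)} {ρ : ℕ} (H : LocalReflection T (ρ + 1))
    (hZ : ∀ m : ℤ, |m| ≤ 4 * (2 ^ ρ - 1) + 1 → (m : G) = 0 → m = 0) {a : G}
    (ha : ∀ x, (a, x) ∉ T) :
    ∃ b, b ≠ a ∧ (∀ x, (b, x) ∉ T) ∧ LocalReflection (insert (a, b) (insert (b, a) T)) ρ ∧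
      ((∃ x x' : G, ∃ d : ℤ, (x, x') ∈ T ∧ |d| ≤ 2 ^ (ρ + 1) ∧ a = x + d ∧ b = x' - d) ∨ b = a + 1) := by
  have h2 : (2 : ℤ) ^ (ρ + 1 + 1) = 2 * 2 ^ (ρ + 1) := by ring
  have h2' : (2 : ℤ) ^ (ρ + 1) = 2 * 2 ^ ρ := by ring
  have hpos : (0 : ℤ) < 2 ^ ρ := by positivity
  -- A cell within the smaller radius of `a` is at distance at most `2 ^ (ρ + 1) + (2 ^ (ρ + 1) - 1)
  -- = 2 ^ (ρ + 2) - 1` from `x`, so the old radius makes the reflected answer consistent.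
  by_cases hnear : ∃ x x' : G, ∃ d : ℤ, (x, x') ∈ T ∧ |d| ≤ 2 ^ (ρ + 1) ∧ a = x + d
  · obtain ⟨x, x', d, hx, hd, e⟩ := hnear
    rw [abs_le] at hd
    refine ⟨x' - d, fun hc => ?_, fun y hy => ?_, H.pair ?_ ?_,
      Or.inl ⟨x, x', d, hx, abs_le.2 hd, e, rfl⟩⟩
    · have := H.odd x x' (2 * d) hx (by rw [abs_le]; omega)
        (by push_cast; linear_combination hc + e)
      exact (Int.not_odd_iff_even.2 (even_two_mul d)) this
    · have := H.reflect x' x _ y (-d) (H.symm _ _ hx) hy (by rw [abs_le]; omega) (by push_cast; ring)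
      refine ha (x' - d) ?_
      rw [e, show x + (d : G) = y by rw [this]; push_cast; ring]
      exact H.symm _ _ hy
    · intro y y' l hy hl
      rw [abs_le] at hl
      constructor
      · intro e'
        have := H.reflect x x' y y' (d + l) hx hy (by rw [abs_le]; omega)
          (by rw [e', e]; push_cast; ring)
        rw [this]; push_cast; ring
      · intro e'
        have := H.reflect x' x y y' (l - d) (H.symm _ _ hx) hy (by rw [abs_le]; omega)
          (by rw [e']; push_cast; ring)
        rw [this, e]; push_cast; ring
    -- The partners `x` and `x'` differ by `2 * d + l`, of size at most `2 ^ (ρ + 2) + 4 * (2 ^ ρ -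
    -- 1) = 4 * (2 ^ (ρ + 1) - 1)`; this recursion is the origin of the bound in `odd`.
    · intro l hl e'
      rw [abs_le] at hl
      have := H.odd x x' (2 * d + l) hx (by rw [abs_le]; omega)
        (by push_cast; linear_combination e' + e)
      rw [Int.odd_iff] at this ⊢
      omega
  · have hfar : ∀ x x' (d : ℤ), (x, x') ∈ T → |d| ≤ 2 ^ (ρ + 1) → a ≠ x + d :=
      fun x x' d h1 h2 h3 => hnear ⟨x, x', d, h1, h2, h3⟩
    refine ⟨a + 1, fun hc => ?_, fun y hy => ?_, H.pair ?_ ?_, Or.inr rfl⟩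
    · have := hZ 1 (by rw [abs_le]; omega) (by push_cast; linear_combination hc)
      omega
    · exact hfar _ _ (-1) hy (by rw [abs_le]; omega) (by push_cast; ring)
    · intro y y' l hy hl
      rw [abs_le] at hl
      constructor
      · intro e'
        exact (hfar y y' (-l) hy (by rw [abs_le]; omega) (by rw [e']; push_cast; ring)).elim
      · intro e'
        exact (hfar y y' (-1 - l) hy (by rw [abs_le]; omega) (by rw [e']; push_cast; ring)).elim
    · intro l hl e'
      rw [abs_le] at hl
      have := hZ (l - 1) (by rw [abs_le]; omega) (by push_cast; linear_combination -e')
      rw [show l = 1 by omega]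
      exact odd_one

end Reflection

/-! ### Lower bounds for path and cycle -/

section LowerBound

variable {V : Type*} {Γ : SimpleGraph V} {G : Type*} [CommRing G]

namespace Board

variable (b : Board Γ G)

/-- The pairs of cells of a list of pairs of edges, together with the pairs in `T`. -/
def pairing (T : Set (G × G)) : List (Γ.edgeSet × Γ.edgeSet) → Set (G × G)
  | [] => T
  | q :: ps => insert (b.cell q.1, b.cell q.2) (insert (b.cell q.2, b.cell q.1) (pairing T ps))

theorem subset_pairing (T : Set (G × G)) (ps : List (Γ.edgeSet × Γ.edgeSet)) : T ⊆ b.pairing T ps := by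
  induction ps with
  | nil => exact le_rfl
  | cons q ps ih => exact fun p hp => Or.inr (Or.inr (ih hp))

theorem mem_pairing {T : Set (G × G)} {ps : List (Γ.edgeSet × Γ.edgeSet)} {p : G × G} :
    p ∈ b.pairing T ps ↔ p ∈ T ∨
      ∃ q ∈ ps, p = (b.cell q.1, b.cell q.2) ∨ p = (b.cell q.2, b.cell q.1) := by
  induction ps with
  | nil => simp [pairing]
  | cons q ps ih =>
    rw [pairing, Set.mem_insert_iff, Set.mem_insert_iff, ih, ← or_assoc, or_left_comm]
    simp only [List.mem_cons, exists_eq_or_imp]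

/-- Radius one suffices: two edges meet only if their cells are at distance at most one, and there
the reflection turns right endpoints into left endpoints. Accordingly `β` lists the endpoints in the
opposite order to `α`. -/
theorem edgeSetsIso_of_reflection {T : Set (G × G)} {ps : List (Γ.edgeSet × Γ.edgeSet)} {ρ : ℕ}
    (H : LocalReflection (b.pairing T ps) ρ) :
    EdgeSetsIso (edges (ps.map Prod.fst)) (edges (ps.map Prod.snd)) := by
  choose x y h1 h2 h3 using b.ends
  let α : {q // q ∈ ps} × Bool → V := fun p => if p.2 then y p.1.1.1 else x p.1.1.1
  let β : {q // q ∈ ps} × Bool → V := fun p => if p.2 then x p.1.1.2 else y p.1.1.2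
  have hone : (1 : G) ≠ 0 := fun h => b.two_ne (by linear_combination 2 * h)
  have hpos : (1 : ℤ) ≤ 2 ^ (ρ + 1) - 1 := by
    have : (0 : ℤ) < 2 ^ ρ := by positivity
    rw [pow_succ]; omega
  have key := edgeSetsIso_pairEdges (α := α) (β := β) (fun i e => hone (by
    have := congrArg b.pos e
    simp only [α, Bool.false_eq_true, if_false, if_true, h2, h3] at this
    linear_combination -this)) ?_
  · have e1 : edges (ps.map Prod.fst) = pairEdges α := by
      ext e
      constructor
      · rintro ⟨z, hz, rfl⟩
        obtain ⟨q, hq, rfl⟩ := List.mem_map.1 hz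
        exact ⟨⟨q, hq⟩, h1 q.1⟩
      · rintro ⟨⟨q, hq⟩, rfl⟩
        exact ⟨q.1, List.mem_map.2 ⟨q, hq, rfl⟩, h1 q.1⟩
    have e2 : edges (ps.map Prod.snd) = pairEdges β := by
      ext e
      constructor
      · rintro ⟨z, hz, rfl⟩
        obtain ⟨q, hq, rfl⟩ := List.mem_map.1 hz
        exact ⟨⟨q, hq⟩, (h1 q.2).trans Sym2.eq_swap⟩
      · rintro ⟨⟨q, hq⟩, rfl⟩
        exact ⟨q.2, List.mem_map.2 ⟨q, hq, rfl⟩, (h1 q.2).trans Sym2.eq_swap⟩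
    rwa [e1, e2]
  · have hr : ∀ c c' e e' (i j : Bool), (c, c') ∈ b.pairing T ps → (e, e') ∈ b.pairing T ps →
        (c + (if i then 1 else 0) = e + (if j then 1 else 0)) →
        c' + (if i then 0 else 1) = e' + (if j then 0 else 1) := by
      intro c c' e e' i j hc he h
      have := H.reflect c c' e e' ((if i then 1 else 0) - (if j then 1 else 0)) hc he
        (by rw [abs_le]; cases i <;> cases j <;> simp <;> omega)
        (by cases i <;> cases j <;> simp at h ⊢ <;> linear_combination -h)
      rw [this]
      cases i <;> cases j <;> simp
    have hα : ∀ p, b.pos (α p) = b.cell p.1.1.1 + (if p.2 then 1 else 0) := by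
      rintro ⟨q, _ | _⟩ <;> simp [α, h2, h3]
    have hβ : ∀ p, b.pos (β p) = b.cell p.1.1.2 + (if p.2 then 0 else 1) := by
      rintro ⟨q, _ | _⟩ <;> simp [β, h2, h3]
    have hmem : ∀ q : {q // q ∈ ps}, (b.cell q.1.1, b.cell q.1.2) ∈ b.pairing T ps := fun q =>
      b.mem_pairing.2 (Or.inr ⟨q.1, q.2, Or.inl rfl⟩)
    intro p q
    rw [← b.inj.eq_iff, ← b.inj.eq_iff (a := β p), hα, hα, hβ, hβ]
    constructor
    · exact hr _ _ _ _ _ _ (hmem p.1) (hmem q.1)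
    · intro h
      have := hr _ _ _ _ (!p.2) (!q.2) (H.symm _ _ (hmem p.1)) (H.symm _ _ (hmem q.1))
        (by rcases p with ⟨p, _ | _⟩ <;> rcases q with ⟨q, _ | _⟩ <;> simpa using h)
      rcases p with ⟨p, _ | _⟩ <;> rcases q with ⟨q, _ | _⟩ <;> simpa using this

/-- The radius exponent starts at `k` and drops by one per round, so `k` rounds can be played. `T`
holds virtual pairs off the board, and `hF` states that answers stay on it. -/
theorem le_gameLength [Finite V] [Nonempty Γ.edgeSet] {k : ℕ} (hk : 2 * k ≤ size Γ) {T : Set (G × G)}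
    (hT : LocalReflection T k) (hTc : ∀ e x, (b.cell e, x) ∉ T)
    (hZ : ∀ m : ℤ, |m| ≤ 4 * (2 ^ (k - 1) - 1) + 1 → (m : G) = 0 → m = 0)
    (hF : ∀ S ρ a c, T ⊆ S → (∀ p ∈ S, p ∈ T ∨ p.1 ∈ Set.range b.cell) → LocalReflection S (ρ + 1) →
      a ∈ Set.range b.cell → (∀ x, (c, x) ∉ S) →
      ((∃ x x' : G, ∃ d : ℤ, (x, x') ∈ S ∧ |d| ≤ 2 ^ (ρ + 1) ∧ a = x + d ∧ c = x' - d) ∨ c = a + 1) →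
      c ∈ Set.range b.cell) : k ≤ gameLength Γ := by
  refine SymGame.le_gameLength hk (fun as bs => ∃ ps : List (Γ.edgeSet × Γ.edgeSet),
    as = ps.map Prod.fst ∧ bs = ps.map Prod.snd ∧ LocalReflection (b.pairing T ps) (k - ps.length))
    ⟨[], rfl, rfl, hT⟩ ?_ ?_
  · rintro _ _ a ⟨ps, rfl, rfl, H⟩ hlt - ha ha'
    rw [List.length_map] at hlt
    obtain ⟨ρ, hρ⟩ : ∃ ρ, k - ps.length = ρ + 1 := ⟨k - ps.length - 1, by omega⟩
    rw [hρ] at H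
    have hdom : ∀ e : Γ.edgeSet, (∀ x, (b.cell e, x) ∉ b.pairing T ps) ↔
        e ∉ ps.map Prod.fst ∧ e ∉ ps.map Prod.snd := by
      intro e
      constructor
      · intro h
        constructor
        · intro he
          obtain ⟨q, hq, rfl⟩ := List.mem_map.1 he
          exact h _ (b.mem_pairing.2 (Or.inr ⟨q, hq, Or.inl rfl⟩))
        · intro he
          obtain ⟨q, hq, rfl⟩ := List.mem_map.1 he
          exact h _ (b.mem_pairing.2 (Or.inr ⟨q, hq, Or.inr rfl⟩))
      · rintro ⟨h1, h2⟩ x hx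
        rcases b.mem_pairing.1 hx with h | ⟨q, hq, h | h⟩
        · exact hTc _ _ h
        · exact h1 (List.mem_map.2 ⟨q, hq, (b.cell_injective (Prod.mk.inj h).1).symm⟩)
        · exact h2 (List.mem_map.2 ⟨q, hq, (b.cell_injective (Prod.mk.inj h).1).symm⟩)
    have hpow : (2 : ℤ) ^ ρ ≤ 2 ^ (k - 1) := pow_le_pow_right₀ (by norm_num) (by omega)
    obtain ⟨c, h1, h2, h3, h4⟩ := H.step (fun m hm => hZ m (by omega)) ((hdom a).2 ⟨ha, ha'⟩)
    obtain ⟨e, rfl⟩ := hF _ ρ _ c (b.subset_pairing T ps) (fun p hp => by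
      rcases b.mem_pairing.1 hp with h | ⟨q, hq, rfl | rfl⟩
      · exact Or.inl h
      · exact Or.inr ⟨_, rfl⟩
      · exact Or.inr ⟨_, rfl⟩) H ⟨a, rfl⟩ h2 h4
    have h5 := (hdom e).1 h2
    refine ⟨e, ?_, h5.2, (a, e) :: ps, rfl, rfl, ?_⟩
    · rw [List.mem_cons, not_or]
      exact ⟨fun h => h1 (h ▸ rfl), h5.1⟩
    · rw [List.length_cons, ← Nat.sub_sub, hρ]
      exact h3
  · rintro _ _ ⟨ps, rfl, rfl, H⟩
    exact b.edgeSetsIso_of_reflection H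

end Board

/-- The virtual cells `-1` and `n` beyond the ends are paired with each other; their distance `n +
1` exceeds `4 * (2 ^ k - 1)`, so the parity condition is vacuous for them. -/
theorem le_gameLengthPath {n k : ℕ} (hk : 4 ^ k + 1 ≤ n) : k ≤ gameLengthPath n := by
  have := nonempty_path (n := n) ((Nat.succ_pos _).trans_le hk)
  have hk2 : 4 * (2 ^ k - 1) < (n : ℤ) + 1 := by
    have h4 : ((4 : ℕ) ^ k : ℤ) = (2 ^ k) * (2 ^ k) := by rw [← mul_pow]; norm_num
    have h : ((4 ^ k + 1 : ℕ) : ℤ) ≤ n := by exact_mod_cast hk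
    push_cast at h h4
    nlinarith [sq_nonneg ((2 : ℤ) ^ k - 2)]
  have hsize : 2 * k ≤ size (SimpleGraph.pathGraph (n + 1)) := by
    rw [size_path]
    have : 2 * k ≤ 4 ^ k + 1 := by
      clear hk2 hk
      induction k with
      | zero => norm_num
      | succ k ih => rw [pow_succ]; have := Nat.one_le_pow k 4 (by norm_num); omega
    omega
  refine (pathBoard n).le_gameLength hsize (T := {((-1 : ℤ), (n : ℤ)), ((n : ℤ), (-1 : ℤ))})
    ⟨?_, ?_, ?_⟩ ?_ ?_ ?_
  · simp only [Set.mem_insert_iff, Set.mem_singleton_iff, Prod.mk.injEq]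
    intro x x' h
    omega
  · simp only [Set.mem_insert_iff, Set.mem_singleton_iff, Prod.mk.injEq]
    intro x x' y y' d h1 h2 _ h3
    rw [Int.cast_id] at h3 ⊢
    omega
  · simp only [Set.mem_insert_iff, Set.mem_singleton_iff, Prod.mk.injEq]
    intro x x' d h1 h2 h3
    rw [Int.cast_id] at h3
    rw [abs_le] at h2
    omega
  · intro e x hx
    have : (pathBoard n).cell e ∈ Set.Ico (0 : ℤ) n := range_pathBoard n ▸ ⟨e, rfl⟩
    simp only [Set.mem_insert_iff, Set.mem_singleton_iff, Prod.mk.injEq] at hx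
    rw [Set.mem_Ico] at this
    omega
  · intro m _ h
    simpa using h
  · intro S ρ a c hTS hS H ha hc h
    rw [range_pathBoard, Set.mem_Ico] at ha ⊢
    have hl : ((-1 : ℤ), (n : ℤ)) ∈ S := hTS (by simp)
    have hr : ((n : ℤ), (-1 : ℤ)) ∈ S := hTS (by simp)
    have hcl : c ≠ -1 := fun h => hc _ (h ▸ hl)
    have hcr : c ≠ n := fun h => hc _ (h ▸ hr)
    rcases h with ⟨x, x', d, h1, h2, h3, h4⟩ | rfl
    · rw [Int.cast_id] at h3 h4
      have hx' : -1 ≤ x' ∧ x' ≤ n := by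
        rcases hS _ (H.symm _ _ h1) with h | h
        · simp only [Set.mem_insert_iff, Set.mem_singleton_iff, Prod.mk.injEq] at h
          omega
        · rw [range_pathBoard, Set.mem_Ico] at h
          omega
      have hp : (2 : ℤ) ^ (ρ + 1 + 1) = 2 * 2 ^ (ρ + 1) := by ring
      have hpos : (0 : ℤ) < 2 ^ (ρ + 1) := by positivity
      rw [abs_le] at h2
      by_contra hcon
      -- An answer beyond an end would have passed the virtual cell there; its reflection is the
      -- other virtual cell, so `a` itself would be off the board.
      rcases lt_or_ge c 0 with h5 | h5
      · have := H.reflect x' x _ _ (-1 - x') (H.symm _ _ h1) hl (by rw [abs_le]; omega) (by simp)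
        rw [Int.cast_id] at this
        omega
      · have := H.reflect x' x _ _ (n - x') (H.symm _ _ h1) hr (by rw [abs_le]; omega) (by simp)
        rw [Int.cast_id] at this
        omega
    · omega

/-- There are no ends, so `T` is empty; the cycle only has to be long enough that short distances
are not affected by going round. -/
theorem le_gameLengthCycle {n k : ℕ} (hn3 : 3 ≤ n) (hk : 2 ^ (2 * k - 1) + 1 ≤ n) :
    k ≤ gameLengthCycle n := by
  rcases Nat.eq_zero_or_pos k with rfl | hk0
  · exact Nat.zero_le _
  obtain ⟨m, rfl⟩ : ∃ m, n = m + 3 := ⟨n - 3, by omega⟩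
  obtain ⟨j, rfl⟩ : ∃ j, k = j + 1 := ⟨k - 1, by omega⟩
  have := nonempty_cycle m
  have h4 : 2 ^ (2 * (j + 1) - 1) = 2 * (2 ^ j * 2 ^ j) := by
    rw [show 2 * (j + 1) - 1 = j + j + 1 by omega, pow_succ, pow_add]; ring
  rw [h4] at hk
  have hj : j < 2 ^ j := Nat.lt_two_pow_self
  refine (cycleBoard m).le_gameLength (T := ∅) ?_ ⟨by simp, by simp, by simp⟩ (by simp) ?_ ?_
  · rw [size_cycle]
    nlinarith
  · intro l hl h
    rw [ZMod.intCast_zmod_eq_zero_iff_dvd] at h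
    refine Int.eq_zero_of_abs_lt_dvd h (hl.trans_lt ?_)
    have h' : ((2 * (2 ^ j * 2 ^ j) + 1 : ℕ) : ℤ) ≤ ((m + 3 : ℕ) : ℤ) := by exact_mod_cast hk
    push_cast at h' ⊢
    have : (0 : ℤ) < 2 ^ j := by positivity
    nlinarith [sq_nonneg ((2 : ℤ) ^ j - 1)]
  · intro S ρ a c _ _ _ _ _ _
    rw [range_cycleBoard]
    trivial

end LowerBound

end SymGame

namespace SymGame

set_option linter.unusedSectionVars false

/-! ### Numerical estimates -/

section Estimates

theorem gameLength_le {V : Type*} {Γ : SimpleGraph V} [Finite Γ.edgeSet] [Nonempty Γ.edgeSet] :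
    2 * gameLength Γ ≤ size Γ := by
  have : gameLength Γ ≤ size Γ / 2 := ciSup_le' fun S₂ => by
    have S₁ : StrategyA Γ := Classical.arbitrary _
    refine (ciInf_le (OrderBot.bddBelow _) S₁).trans ?_
    have := playLength_le S₁ S₂
    omega
  omega

theorem edgeSetsIso_singleton {V : Type*} {Γ : SimpleGraph V} (a b : Γ.edgeSet) :
    EdgeSetsIso (edges [a]) (edges [b]) := by
  have key : ∀ e : Γ.edgeSet, ∃ α : Unit × Bool → V, (∀ i, α (i, false) ≠ α (i, true)) ∧
      edges [e] = pairEdges α := by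
    rintro ⟨e, he⟩
    induction e using Sym2.ind with
    | _ x y =>
      refine ⟨fun p => if p.2 then y else x, fun _ => he.ne, ?_⟩
      ext z
      simp [edges, pairEdges, eq_comm]
  obtain ⟨α, hα, e⟩ := key a
  obtain ⟨β, hβ, e'⟩ := key b
  rw [e, e']
  refine edgeSetsIso_pairEdges hα ?_
  rintro ⟨i, _ | _⟩ ⟨j, _ | _⟩
  · simp
  · exact iff_of_false (hα ()) (hβ ())
  · exact iff_of_false (hα ()).symm (hβ ()).symm
  · simp

theorem one_le_gameLength {V : Type*} {Γ : SimpleGraph V} [Finite Γ.edgeSet] [Nonempty Γ.edgeSet]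
    (h : 2 ≤ size Γ) : 1 ≤ gameLength Γ := by
  refine le_gameLength (k := 1) h
    (fun as bs => (as = [] ∧ bs = []) ∨ ∃ a b, as = [a] ∧ bs = [b]) (Or.inl ⟨rfl, rfl⟩) ?_ ?_
  · rintro as bs a (⟨rfl, rfl⟩ | ⟨c, d, rfl, rfl⟩) hlt _ _ _
    · obtain ⟨e, he, -⟩ := exists_fresh (l := [a]) (l' := []) (by
        have h' : 2 ≤ Nat.card Γ.edgeSet := h
        simp only [List.length_singleton, List.length_nil]
        omega)
      exact ⟨e, he, List.not_mem_nil, Or.inr ⟨a, e, rfl, rfl⟩⟩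
    · simp at hlt
  · rintro as bs (⟨rfl, rfl⟩ | ⟨a, b, rfl, rfl⟩)
    · exact ⟨SimpleGraph.Iso.refl⟩
    · exact edgeSetsIso_singleton a b

theorem one_le_gameLengthPath {n : ℕ} (hn : 2 ≤ n) : 1 ≤ gameLengthPath n := by
  have := nonempty_path (n := n) (by omega)
  exact one_le_gameLength (by rwa [size_path])

theorem gameLengthPath_le {n : ℕ} (hn : 0 < n) : 2 * gameLengthPath n ≤ n := by
  have := nonempty_path hn
  exact gameLength_le.trans_eq (size_path n)

theorem gameLengthCycle_le {n : ℕ} (hn : 3 ≤ n) : 2 * gameLengthCycle n ≤ n := by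
  obtain ⟨m, rfl⟩ : ∃ m, n = m + 3 := ⟨n - 3, by omega⟩
  have := nonempty_cycle m
  exact gameLength_le.trans_eq (size_cycle m)

theorem lt_gameLengthPath {n : ℕ} (hn : 3 ≤ n) :
    (1 / 2 : ℝ) * Real.logb 2 ((n : ℝ) - 1) - 1 < (gameLengthPath n : ℝ) := by
  have h0 : n - 1 ≠ 0 := by omega
  have h1 := Nat.pow_log_le_self 4 h0
  have h2 := Nat.lt_pow_succ_log_self (b := 4) (by norm_num) (n - 1)
  set k := Nat.log 4 (n - 1)
  have h3 : k ≤ gameLengthPath n := le_gameLengthPath (by omega)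
  have h3' : (k : ℝ) ≤ gameLengthPath n := by exact_mod_cast h3
  have h4 : Real.logb 2 ((n : ℝ) - 1) < 2 * (k + 1) := by
    have hn' : (3 : ℝ) ≤ n := by exact_mod_cast hn
    rw [Real.logb_lt_iff_lt_rpow (by norm_num) (by linarith)]
    have h5 : ((n - 1 : ℕ) : ℝ) < (4 : ℝ) ^ (k + 1) := by exact_mod_cast h2
    rw [Nat.cast_sub (by omega), Nat.cast_one] at h5
    refine h5.trans_eq ?_
    rw [Real.rpow_mul (by norm_num), ← Nat.cast_succ, Real.rpow_natCast]
    norm_num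
  linarith

theorem lt_gameLengthCycle {n : ℕ} (hodd : Odd n) (hn : 3 ≤ n) :
    (1 / 2 : ℝ) * Real.logb 2 n - 1 / 2 < (gameLengthCycle n : ℝ) := by
  have h0 : n - 1 ≠ 0 := by omega
  have h1 := Nat.pow_log_le_self 2 h0
  have h2 := Nat.lt_pow_succ_log_self (b := 2) (by norm_num) (n - 1)
  set j := Nat.log 2 (n - 1)
  set k := (j + 1) / 2
  have h3 : k ≤ gameLengthCycle n := by
    refine le_gameLengthCycle hn ?_
    have hj : 1 ≤ j := Nat.log_pos (by norm_num) (by omega)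
    have := Nat.pow_le_pow_right (n := 2) (by norm_num) (show 2 * k - 1 ≤ j by omega)
    omega
  have h3' : (k : ℝ) ≤ gameLengthCycle n := by exact_mod_cast h3
  have h4 : n < 2 ^ (2 * k + 1) := by
    -- This gives only `n ≤ 2 ^ (2 * k + 1)`; equality is excluded because `n` is odd.
    have := Nat.pow_le_pow_right (n := 2) (by norm_num) (show j + 1 ≤ 2 * k + 1 by omega)
    rcases eq_or_lt_of_le (show n ≤ 2 ^ (2 * k + 1) by omega) with h | h
    · rw [h, pow_succ] at hodd
      exact (Nat.not_odd_iff_even.2 (even_two.mul_left _) hodd).elim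
    · exact h
  have h5 : Real.logb 2 n < 2 * k + 1 := by
    rw [Real.logb_lt_iff_lt_rpow (by norm_num) (by exact_mod_cast (by omega : 0 < n))]
    have : (n : ℝ) < (2 : ℝ) ^ (2 * k + 1) := by exact_mod_cast h4
    refine this.trans_eq ?_
    rw [← Real.rpow_natCast]
    norm_num
  linarith

theorem one_le_logb {n : ℕ} (hn : 3 ≤ n) : 1 ≤ Real.logb 2 n := by
  have h : (3 : ℝ) ≤ n := by exact_mod_cast hn
  rw [Real.le_logb_iff_rpow_le (by norm_num) (by linarith), Real.rpow_one]
  linarith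

/-- The explicit bound gives `L > log n / 2 - 3 / 2`, and `L ≥ 1` for `n ≥ 3`; weights `2 / 5` and
`3 / 5` cancel the constants and leave `log n / 5`. -/
theorem logb_le_gameLengthPath {n : ℕ} (hodd : Odd n) :
    (1 / 5 : ℝ) * Real.logb 2 n ≤ gameLengthPath n := by
  obtain ⟨m, hm⟩ := hodd
  rcases Nat.eq_zero_or_pos m with rfl | hm0
  · rw [hm]; simp
  have h1 : (1 : ℝ) ≤ gameLengthPath n := by exact_mod_cast one_le_gameLengthPath (by omega)
  have h2 := lt_gameLengthPath (n := n) (by omega)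
  have hn : (3 : ℝ) ≤ n := by exact_mod_cast (by omega : 3 ≤ n)
  have h3 : Real.logb 2 n ≤ Real.logb 2 ((n : ℝ) - 1) + 1 := by
    have e : Real.logb 2 (((n : ℝ) - 1) * 2) = Real.logb 2 ((n : ℝ) - 1) + 1 := by
      rw [Real.logb_mul (by linarith) (by norm_num), Real.logb_self_eq_one (by norm_num)]
    rw [← e]
    exact Real.logb_le_logb_of_le (by norm_num) (by linarith) (by linarith)
  linarith

theorem logb_le_gameLengthCycle {n : ℕ} (hodd : Odd n) (hn : 3 ≤ n) :
    (1 / 3 : ℝ) * Real.logb 2 n ≤ gameLengthCycle n := by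
  have h1 : (1 : ℝ) ≤ gameLengthCycle n := by
    exact_mod_cast le_gameLengthCycle (k := 1) hn (by simpa using hn)
  have h2 := lt_gameLengthCycle hodd hn
  linarith

theorem thirty_mul_log_le {n : ℕ} (hn : 2 ^ 14 ≤ n) : 30 * Nat.log 2 n + 300 ≤ n := by
  have h1 : 14 ≤ Nat.log 2 n := Nat.le_log_of_pow_le (by norm_num) hn
  have h2 : ∀ i, 14 ≤ i → 30 * i + 300 ≤ 2 ^ i := by
    intro i hi
    induction i, hi using Nat.le_induction with
    | base => norm_num
    | succ i hi ih => rw [pow_succ]; omega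
  exact (h2 _ h1).trans (Nat.pow_log_le_self 2 (by omega))

/-- The inequality `2 * (x + 3) ^ 2 + 4 * x + 36 ≤ 3.5 * x ^ 2` holds from `x = 14` on, which is the
source of the threshold `2 ^ 14`. -/
theorem le_of_lt_log {n L : ℕ} (hn : 2 ^ 14 ≤ n)
    (hL : L < 2 * (Nat.log 2 n + 3) ^ 2 + 4 * Nat.log 2 n + 36) :
    (L : ℝ) ≤ 3.5 * Real.logb 2 n ^ 2 := by
  have h1 : (Nat.log 2 n : ℝ) ≤ Real.logb 2 n := by
    have := Real.natLog_le_logb n 2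
    exact_mod_cast this
  have h2 : (14 : ℝ) ≤ Nat.log 2 n := by exact_mod_cast Nat.le_log_of_pow_le (by norm_num) hn
  have h3 : (L : ℝ) < 2 * ((Nat.log 2 n : ℝ) + 3) ^ 2 + 4 * Nat.log 2 n + 36 := by exact_mod_cast hL
  nlinarith

theorem le_thirteen_mul_pow_log (n : ℕ) : n ≤ 13 * 2 ^ Nat.log 2 n := by
  have := Nat.lt_pow_succ_log_self (b := 2) (by norm_num) n
  rw [pow_succ] at this
  omega

theorem gameLengthPath_le_logb {n : ℕ} (hodd : Odd n) (hn : 2 ^ 14 ≤ n) :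
    (gameLengthPath n : ℝ) ≤ 3.5 * Real.logb 2 n ^ 2 := by
  have h := thirty_mul_log_le hn
  refine le_of_lt_log hn ((gameLengthPath_lt hodd (le_thirteen_mul_pow_log n) (by omega)).trans_le ?_)
  omega

theorem gameLengthCycle_le_logb {n : ℕ} (hodd : Odd n) (hn : 2 ^ 14 ≤ n) :
    (gameLengthCycle n : ℝ) ≤ 3.5 * Real.logb 2 n ^ 2 :=
  le_of_lt_log hn (gameLengthCycle_lt hodd (le_thirteen_mul_pow_log n) (thirty_mul_log_le hn))

/-- A bound for all large arguments yields a bound with an error term. -/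
theorem exists_error_term {p : ℕ → Prop} {L : ℕ → ℕ}
    (h1 : ∀ n, p n → 2 ^ 14 ≤ n → (L n : ℝ) ≤ 3.5 * Real.logb 2 n ^ 2)
    (h2 : ∀ n, p n → n < 2 ^ 14 → L n = 0 ∨ 3 ≤ n) :
    ∃ ε : ℕ → ℝ, Tendsto ε atTop (𝓝 0) ∧
      ∀ n, p n → (L n : ℝ) ≤ (3.5 + ε n) * Real.logb 2 n ^ 2 := by
  -- The error term vanishes from `2 ^ 14` on; below, it absorbs all of `L n`, which is possible
  -- because `log n ≥ 1` unless `L n = 0`.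
  refine ⟨fun n => if n < 2 ^ 14 then L n / Real.logb 2 n ^ 2 else 0, ?_, fun n hn => ?_⟩
  · refine tendsto_const_nhds.congr' ?_
    filter_upwards [eventually_ge_atTop (2 ^ 14)] with n hn
    rw [if_neg (by omega)]
  · beta_reduce
    by_cases h : n < 2 ^ 14
    · rw [if_pos h]
      rcases h2 n hn h with h3 | h3
      · rw [h3]
        have : 0 ≤ Real.logb 2 n ^ 2 := sq_nonneg _
        simp only [Nat.cast_zero, zero_div, add_zero]
        positivity
      · have := one_le_logb h3
        rw [add_mul, div_mul_cancel₀ _ (by positivity)]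
        have : 0 ≤ 3.5 * Real.logb 2 n ^ 2 := by positivity
        linarith
    · rw [if_neg h, add_zero]
      exact h1 n hn (by omega)

theorem exists_constant {p : ℕ → Prop} {L : ℕ → ℕ}
    (h1 : ∀ n, p n → 2 ^ 14 ≤ n → (L n : ℝ) ≤ 3.5 * Real.logb 2 n ^ 2)
    (h2 : ∀ n, p n → n < 2 ^ 14 → L n = 0 ∨ 3 ≤ n) (h3 : ∀ n, p n → L n ≤ n) :
    ∃ C : ℝ, 0 < C ∧ ∀ n, p n → (L n : ℝ) ≤ C * Real.logb 2 n ^ 2 := by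
  refine ⟨2 ^ 14, by positivity, fun n hn => ?_⟩
  have hsq : 0 ≤ Real.logb 2 n ^ 2 := sq_nonneg _
  by_cases h : n < 2 ^ 14
  · rcases h2 n hn h with h4 | h4
    · rw [h4, Nat.cast_zero]
      positivity
    · have h5 : (L n : ℝ) ≤ 2 ^ 14 := by exact_mod_cast (h3 n hn).trans h.le
      have := one_le_logb h4
      nlinarith
  · have := h1 n hn (by omega)
    nlinarith

theorem gameLengthPath_eq_zero_or {n : ℕ} (hn : Odd n) : gameLengthPath n = 0 ∨ 3 ≤ n := by
  obtain ⟨m, rfl⟩ := hn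
  rcases Nat.eq_zero_or_pos m with rfl | hm
  · left
    have := gameLengthPath_le (n := 2 * 0 + 1) one_pos
    omega
  · right; omega

end Estimates

end SymGame


theorem theorem3p1 :
    -- lower bounds of order `log n`
    (∃ c : ℝ, 0 < c ∧ ∀ n : ℕ, Odd n →
      c * Real.logb 2 n ≤ (SymGame.gameLengthPath n : ℝ)) ∧
    (∃ c : ℝ, 0 < c ∧ ∀ n : ℕ, Odd n → 3 ≤ n →
      c * Real.logb 2 n ≤ (SymGame.gameLengthCycle n : ℝ)) ∧
    -- upper bounds of order `log² n`
    (∃ C : ℝ, 0 < C ∧ ∀ n : ℕ, Odd n →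
      (SymGame.gameLengthPath n : ℝ) ≤ C * Real.logb 2 n ^ 2) ∧
    (∃ C : ℝ, 0 < C ∧ ∀ n : ℕ, Odd n → 3 ≤ n →
      (SymGame.gameLengthCycle n : ℝ) ≤ C * Real.logb 2 n ^ 2) ∧
    -- explicit lower bounds
    (∀ n : ℕ, Odd n → 3 ≤ n →
      (1 / 2 : ℝ) * Real.logb 2 ((n : ℝ) - 1) - 1 < (SymGame.gameLengthPath n : ℝ)) ∧
    (∀ n : ℕ, Odd n → 3 ≤ n →
      (1 / 2 : ℝ) * Real.logb 2 n - 1 / 2 < (SymGame.gameLengthCycle n : ℝ)) ∧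
    -- explicit upper bounds
    (∃ ε : ℕ → ℝ, Tendsto ε atTop (𝓝 0) ∧ ∀ n : ℕ, Odd n →
      (SymGame.gameLengthPath n : ℝ) ≤ (3.5 + ε n) * Real.logb 2 n ^ 2) ∧
    (∃ ε : ℕ → ℝ, Tendsto ε atTop (𝓝 0) ∧ ∀ n : ℕ, Odd n → 3 ≤ n →
      (SymGame.gameLengthCycle n : ℝ) ≤ (3.5 + ε n) * Real.logb 2 n ^ 2) := by
  have h1 : ∀ n, Odd n → SymGame.gameLengthPath n ≤ n := fun n hn => by
    have := SymGame.gameLengthPath_le hn.pos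
    omega
  have h2 : ∀ n, Odd n ∧ 3 ≤ n → SymGame.gameLengthCycle n ≤ n := fun n hn => by
    have := SymGame.gameLengthCycle_le hn.2
    omega
  refine ⟨⟨1 / 5, by norm_num, fun n hn => SymGame.logb_le_gameLengthPath hn⟩,
    ⟨1 / 3, by norm_num, fun n hn hn3 => SymGame.logb_le_gameLengthCycle hn hn3⟩,
    SymGame.exists_constant (p := Odd) (fun n hn => SymGame.gameLengthPath_le_logb hn)
      (fun n hn _ => SymGame.gameLengthPath_eq_zero_or hn) h1, ?_,
    fun n _ hn => SymGame.lt_gameLengthPath hn, fun n hn hn3 => SymGame.lt_gameLengthCycle hn hn3,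
    SymGame.exists_error_term (p := Odd) (fun n hn => SymGame.gameLengthPath_le_logb hn)
      (fun n hn _ => SymGame.gameLengthPath_eq_zero_or hn), ?_⟩
  · obtain ⟨C, hC, h⟩ := SymGame.exists_constant (p := fun n => Odd n ∧ 3 ≤ n)
      (fun n hn => SymGame.gameLengthCycle_le_logb hn.1) (fun n hn _ => Or.inr hn.2) h2
    exact ⟨C, hC, fun n hn hn3 => h n ⟨hn, hn3⟩⟩
  · obtain ⟨ε, hε, h⟩ := SymGame.exists_error_term (p := fun n => Odd n ∧ 3 ≤ n)
      (fun n hn => SymGame.gameLengthCycle_le_logb hn.1) (fun n hn _ => Or.inr hn.2)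
    exact ⟨ε, hε, fun n hn hn3 => h n ⟨hn, hn3⟩⟩
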